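/- **Setting.** All simplices lie in a real vector space $E$ (for instance a Euclidean space) and have ordered vertices $v_0,\dots,v_n$; a subsimplex $F\subseteq T$ of dimension $m$ inherits the order, i.e. it is given by a strictly ascending map $\imath:[0:m]\to[0:n]$. Let $\lambda_0,\dots,\lambda_n$ be the barycentric coordinates of the $n$-simplex $T$. For a multiindex $\alpha$ on $[0:n]$ put $\lambda^\alpha=\prod_i\lambda_i^{\alpha(i)}$; for $\sigma:[1:k]\to[0:n]$ put $d\lambda_\sigma=d\lambda_{\sigma(1)}\wedge\dots\wedge d\lambda_{\sigma(k)}$ and $\lambda_\sigma=\prod_j\lambda_{\sigma(j)}$ (similarly $\lambda_\rho$ below); for $\rho:[0:k]\to[0:n]$ let $$\phi_\rho=\sum_{i=0}^k(-1)^i\lambda_{\rho(i)}\,d\lambda_{\rho(0)}\wedge\dots\widehat{d\lambda_{\rho(i)}}\dots\wedge d\lambda_{\rho(k)}$$ be the Whitney form. Let $\Sigma(k,n)$ and $\Sigma_0(k,n)$ be the sets of strictly ascending maps $[1:k]\to[0:n]$ and $[0:k]\to[0:n]$. Then $$\mathbb C\mathcal P_r\Lambda^k(T)=\operatorname{span}_{\mathbb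 C}\{\lambda^\alpha d\lambda_\sigma: |\alpha|=r,\ \sigma\in\Sigma(k,n)\},\qquad \mathbb C\mathcal P_r^-\Lambda^k(T)=\operatorname{span}_{\mathbb C}\{\lambda^\alpha \phi_\rho: |\alpha|=r-1,\ \rho\in\Sigma_0(k,n)\}.$$ For $\sigma\in\Sigma(k,n)$ let $\sigma^c\in\Sigma_0(n-k,n)$ have the complementary image, and let $\epsilon(\sigma,\sigma^c)$ be the sign of the permutation sorting the sequence $(\sigma,\sigma^c)$. **Operators.** The following linear maps are determined by their values on spanning sets: * $\mathcal I(\lambda^\alpha d\lambda_\sigma)=\epsilon(\sigma,\sigma^c)\lambda^\alpha\lambda_\sigma\phi_{\sigma^c}$, $|\alpha|=s$, on $\mathbb C\mathcal P_s\Lambda^{k}(T)$, with values in $(n-k)$-forms. * $\mathcal J(\lambda^\alpha\lambda_{\sigma^c}d\lambda_\sigma)=\epsilon(\sigma,\sigma^c)\lambda^\alpha\phi_{\sigma^c}$, $|\alpha|=s-1$, $\sigma\in\Sigma(k,n)$, a bijection from the span of the arguments (a space of $k$-forms) onto $\mathbb C\mathcal P^-_{s}\Lambda^{n-k}(T)$.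 * For a subsimplex $F\subseteq T$, $\operatorname{ext}^{r,k,-}_{F,T}(\lambda_F^\alpha\phi^F_\rho)=\lambda_T^{\tilde\alpha}\phi^T_{\imath\circ\rho}$ $(|\alpha|=r-1)$, and for $r\ge1$ $\operatorname{ext}^{r,k}_{F,T}(\lambda_F^\alpha d\lambda^F_\sigma)=\lambda_T^{\tilde\alpha}\,\Psi_{\imath(\sigma(1))}\wedge\dots\wedge\Psi_{\imath(\sigma(k))}$ $(|\alpha|=r)$. Here $\tilde\alpha$ is the extension of $\alpha$ by zero and $\Psi_i=d\lambda^T_i-\frac{\tilde\alpha_i}{|\tilde\alpha|}\sum_{j\in\operatorname{im}\imath}d\lambda^T_j$. **Recursive construction.** For every $n$-simplex $T$ and every $k$ let a basis $\mathcal{AP}_0\Lambda^k(T)$ of $\mathbb C\mathcal P_0\Lambda^k(T)$ be fixed, arbitrary except in the following cases. * $n=2$, $k=1$: $\{d\lambda_0+\xi d\lambda_1+\xi^2d\lambda_2,\ d\lambda_0+\xi^2d\lambda_1+\xi d\lambda_2\}$ with $\xi=e^{2\pi i/3}$. * $n=3$: $\{\psi_w,\psi_p,\psi_k\}$ for $k=1$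 and $\{\psi_w\wedge\psi_p,\psi_w\wedge\psi_k,\psi_p\wedge\psi_k\}$ for $k=2$, where $\psi_w=d\lambda_0-d\lambda_1+d\lambda_2-d\lambda_3$, $\psi_p=d\lambda_0+d\lambda_1-d\lambda_2-d\lambda_3$, $\psi_k=d\lambda_0-d\lambda_1-d\lambda_2+d\lambda_3$. * $n=4$, $k=2$: $\{\zeta_0,\dots,\zeta_5\}$, where, with $d\lambda_{ij}=d\lambda_i\wedge d\lambda_j$, $$\zeta_0=d\lambda_{01}+i\,d\lambda_{02}-i\,d\lambda_{03}-d\lambda_{04}+d\lambda_{12}+i\,d\lambda_{13}-i\,d\lambda_{14}+d\lambda_{23}+i\,d\lambda_{24}+d\lambda_{34},$$ $\zeta_1=S_\tau^*\zeta_0$ and $\zeta_{j+1}=S_\kappa^*\zeta_j$ for $1\le j\le4$, with $\tau=(0\,1)$, $\kappa=(0\,1\,2\,3\,4)$ and $S_\pi$ the affine automorphism of $T$ with $S_\pi(v_i)=v_{\pi^{-1}(i)}$, so that $S_\pi^*d\lambda_i=d\lambda_{\pi(i)}$. Let $\mathcal{AP}_s\Lambda^k(T)$ and $\mathcal{AP}^-_s\Lambda^k(T)$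 be empty for $s<0$. For an $n$-simplex $T$ and $0\le k\le n$ define recursively $$\mathcal A\mathring{\mathcal P}^-_r\Lambda^k(T)=\mathcal I\,\mathcal{AP}_{r-n+k-1}\Lambda^{n-k}(T),\qquad \mathcal A\mathring{\mathcal P}_r\Lambda^k(T)=\mathcal J^{-1}\mathcal{AP}^-_{r-n+k}\Lambda^{n-k}(T),$$ $$\mathcal{AP}^-_r\Lambda^k(T)=\bigcup_{F\subseteq T}\operatorname{ext}^{r,k,-}_{F,T}\mathcal A\mathring{\mathcal P}^-_r\Lambda^k(F)\ (r\ge0),\qquad \mathcal{AP}_r\Lambda^k(T)=\bigcup_{F\subseteq T}\operatorname{ext}^{r,k}_{F,T}\mathcal A\mathring{\mathcal P}_r\Lambda^k(F)\ (r\ge1),$$ where the unions run over all subsimplices $F$ of $T$ with $\dim F\ge k$. A finite set $Q$ of complex differential forms on $T$ is called *$\mathbb C$-invariant* if for every affine automorphism $S$ of $T$ there are a permutation $\tau$ of $Q$ and nonzero numbers $\chi_\omega\in\mathbb C$ with $S^*\omega=\chi_\omega\,\tau(\omega)$ for all $\omega\in Q$. **Theorem.** Let $T$ be a $4$-simplex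 and $r\in\mathbb N_0$. Then $\mathcal{AP}_r\Lambda^2(T)$ is a $\mathbb C$-invariant basis of $\mathbb C\mathcal P_r\Lambda^2(T)$, and $\mathcal{AP}_r^-\Lambda^2(T)$ is a $\mathbb C$-invariant basis of $\mathbb C\mathcal P_r^-\Lambda^2(T)$. -/

import Mathlib

noncomputable section

namespace FEEC

variable {E : Type*} [AddCommGroup E] [Module ℝ E]

/-! ### Simplices with ordered vertices, barycentric coordinates -/

/-- The affine hull of an `n`-simplex `T` with ordered vertices `T.points 0, …, T.points n`. -/
abbrev Hull {n : ℕ} (T : Affine.Simplex ℝ E n) : AffineSubspace ℝ E :=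
  affineSpan ℝ (Set.range T.points)

/-- The tangent space of the simplex. -/
abbrev Tangent {n : ℕ} (T : Affine.Simplex ℝ E n) : Submodule ℝ E :=
  (Hull T).direction

/-- The simplex as a set of points: the convex hull of its vertices, seen inside the affine hull. -/
def Body {n : ℕ} (T : Affine.Simplex ℝ E n) : Set (Hull T) :=
  {x | (x : E) ∈ convexHull ℝ (Set.range T.points)}

/-- The vertices form an affine basis of the affine hull. -/
def vertexBasis {n : ℕ} (T : Affine.Simplex ℝ E n) : AffineBasis (Fin (n + 1)) ℝ (Hull T) where
  toFun i := ⟨T.points i, mem_affineSpan ℝ (Set.mem_range_self i)⟩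
  ind' := AffineIndependent.of_comp (Hull T).subtype T.independent
  tot' := by
    have h := affineSpan_coe_preimage_eq_top (k := ℝ) (Set.range T.points)
    convert h using 2
    ext x
    constructor
    · rintro ⟨i, rfl⟩
      exact ⟨i, rfl⟩
    · rintro ⟨i, hi⟩
      exact ⟨i, Subtype.ext hi⟩

/-- The barycentric coordinate `λ_i`: the affine function with `λ_i(v_j) = δ_{ij}`. -/
def lam {n : ℕ} (T : Affine.Simplex ℝ E n) (i : Fin (n + 1)) : Hull T →ᵃ[ℝ] ℝ :=
  (vertexBasis T).coord i

/-- The differential `dλ_i`. As `λ_i` is affine, this is the constant 1-form given by the linear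
part of `λ_i`. -/
def dlam {n : ℕ} (T : Affine.Simplex ℝ E n) (i : Fin (n + 1)) : Tangent T →ₗ[ℝ] ℝ :=
  (lam T i).linear

/-- The subsimplex of `T` whose vertices are selected by the strictly ascending map `ι`, with the
order of vertices inherited from `T`. -/
def face {n m : ℕ} (T : Affine.Simplex ℝ E n) (ι : Fin (m + 1) ↪o Fin (n + 1)) :
    Affine.Simplex ℝ E m :=
  ⟨T.points ∘ ι, T.independent.comp_embedding ι.toEmbedding⟩

/-! ### Barycentric differential forms -/

/-- Complex-valued differential `k`-forms over `T`: fields of alternating `k`-forms on the tangent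
space. All the forms that occur below are polynomial, hence smooth and bounded. -/
abbrev Form {n : ℕ} (T : Affine.Simplex ℝ E n) (k : ℕ) : Type _ :=
  Body T → (Tangent T) [⋀^Fin k]→ₗ[ℝ] ℂ

/-- The exterior product `f₁ ∧ … ∧ f_k` of real covectors,
`(f₁ ∧ … ∧ f_k)(w₁, …, w_k) = det (f_i(w_j))`, regarded as complex-valued. -/
def wedge {M : Type*} [AddCommGroup M] [Module ℝ M] {k : ℕ} (f : Fin k → M →ₗ[ℝ] ℝ) :
    M [⋀^Fin k]→ₗ[ℝ] ℂ :=
  Complex.ofRealCLM.toLinearMap.compAlternatingMap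
    (Matrix.detRowAlternating.compLinearMap (LinearMap.pi f))

/-- The exterior product of constant real 1-forms, as a (constant) differential form. -/
def constWedge {n : ℕ} (T : Affine.Simplex ℝ E n) {k : ℕ} (f : Fin k → Tangent T →ₗ[ℝ] ℝ) :
    Form T k :=
  fun _ => wedge f

/-- The barycentric polynomial `λ^α`. -/
def lamPow {n : ℕ} (T : Affine.Simplex ℝ E n) (α : Fin (n + 1) → ℕ) : Body T → ℂ :=
  fun x => ∏ i, (lam T i x : ℂ) ^ α i

/-- The product `λ_τ = ∏_j λ_{τ(j)}`. -/
def lamProd {n m : ℕ} (T : Affine.Simplex ℝ E n) (τ : Fin m → Fin (n + 1)) : Body T → ℂ :=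
  fun x => ∏ j, (lam T (τ j) x : ℂ)

/-- The barycentric alternator `dλ_σ = dλ_{σ(1)} ∧ … ∧ dλ_{σ(k)}`. -/
def dlamWedge {n k : ℕ} (T : Affine.Simplex ℝ E n) (σ : Fin k → Fin (n + 1)) : Form T k :=
  constWedge T fun j => dlam T (σ j)

/-- The Whitney form
`φ_ρ = ∑_i (-1)^i λ_{ρ(i)} dλ_{ρ(0)} ∧ … (omit dλ_{ρ(i)}) … ∧ dλ_{ρ(k)}`. -/
def whitney {n k : ℕ} (T : Affine.Simplex ℝ E n) (ρ : Fin (k + 1) → Fin (n + 1)) : Form T k :=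
  fun x => ∑ i : Fin (k + 1),
    ((-1 : ℂ) ^ (i : ℕ) * (lam T (ρ i) x : ℂ)) • dlamWedge T (fun j => ρ (i.succAbove j)) x

/-! ### Finite element spaces -/

/-- `ℂ𝒫_rΛ^k(T)`, the complex span of all `λ^α dλ_σ` with `|α| = r`. -/
def PForms (r k : ℕ) {n : ℕ} (T : Affine.Simplex ℝ E n) : Submodule ℂ (Form T k) :=
  Submodule.span ℂ {ω | ∃ (α : Fin (n + 1) → ℕ) (σ : Fin k ↪o Fin (n + 1)),
    ∑ i, α i = r ∧ ω = lamPow T α • dlamWedge T σ}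

/-- `ℂ𝒫_r⁻Λ^k(T)`, the complex span of all `λ^α φ_ρ` with `|α| = r - 1` (zero if `r = 0`). -/
def PMinusForms (r k : ℕ) {n : ℕ} (T : Affine.Simplex ℝ E n) : Submodule ℂ (Form T k) :=
  Submodule.span ℂ {ω | ∃ (α : Fin (n + 1) → ℕ) (ρ : Fin (k + 1) ↪o Fin (n + 1)),
    (∑ i, α i) + 1 = r ∧ ω = lamPow T α • whitney T ρ}

/-! ### Canonical isomorphisms and extension operators

Each of these operators is the linear map with prescribed values on a spanning set of its domain.
It is given here by its graph: the linear span, in the product of domain and codomain, of the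
prescribed pairs (element of the spanning set, value). -/

/-- The sign of the permutation that sorts the sequence `τ`, by counting inversions. -/
def seqSign {m N : ℕ} (τ : Fin m → Fin N) : ℂ :=
  (-1) ^ (Finset.univ.filter fun p : Fin m × Fin m => p.1 < p.2 ∧ τ p.2 < τ p.1).card

/-- Graph of the canonical isomorphism `𝓘 : ℂ𝒫_rΛ^k(T) → ℂ𝒫̊⁻_{r+k+1}Λ^l(T)`, where `l = n - k`,
`𝓘(λ^α dλ_σ) = ε(σ,σᶜ) λ^α λ_σ φ_{σᶜ}`. -/
def graphI (r k l : ℕ) {n : ℕ} (T : Affine.Simplex ℝ E n) :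
    Submodule ℂ (Form T k × Form T l) :=
  Submodule.span ℂ {p | ∃ (α : Fin (n + 1) → ℕ) (σ : Fin k ↪o Fin (n + 1))
      (σc : Fin (l + 1) ↪o Fin (n + 1)),
    ∑ i, α i = r ∧ IsCompl (Set.range σ) (Set.range σc) ∧
    p = (lamPow T α • dlamWedge T σ,
      seqSign (Fin.append σ σc) • (lamPow T α • lamProd T σ • whitney T σc))}

/-- Graph of the canonical isomorphism `𝓙 : ℂ𝒫̊_{s+l}Λ^k(T) → ℂ𝒫⁻_sΛ^l(T)`, where `l = n - k`,
`𝓙(λ^α λ_{σᶜ} dλ_σ) = ε(σ,σᶜ) λ^α φ_{σᶜ}` for `|α| = s - 1`. -/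
def graphJ (s k l : ℕ) {n : ℕ} (T : Affine.Simplex ℝ E n) :
    Submodule ℂ (Form T k × Form T l) :=
  Submodule.span ℂ {p | ∃ (α : Fin (n + 1) → ℕ) (σ : Fin k ↪o Fin (n + 1))
      (σc : Fin (l + 1) ↪o Fin (n + 1)),
    (∑ i, α i) + 1 = s ∧ IsCompl (Set.range σ) (Set.range σc) ∧
    p = (lamPow T α • lamProd T σc • dlamWedge T σ,
      seqSign (Fin.append σ σc) • (lamPow T α • whitney T σc))}

/-- `Ψ_i^{β,F,T} = dλ_i - (β_i / |β|) ∑_{j ∈ F} dλ_j` for the face `F` selected by `ι`. -/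
def Psi {n m : ℕ} (T : Affine.Simplex ℝ E n) (ι : Fin (m + 1) ↪o Fin (n + 1))
    (β : Fin (n + 1) → ℕ) (i : Fin (n + 1)) : Tangent T →ₗ[ℝ] ℝ :=
  dlam T i - ((β i : ℝ) / ((∑ j, β j : ℕ) : ℝ)) • ∑ j, dlam T (ι j)

/-- Graph of the extension operator `ext^{r,k}_{F,T}`,
`λ_F^α dλ^F_σ ↦ λ_T^β Ψ_{ι∘σ(1)} ∧ … ∧ Ψ_{ι∘σ(k)}` for `|α| = r`, where `β` is the
extension of `α` by zero. -/
def graphExt (r k : ℕ) {n m : ℕ} (T : Affine.Simplex ℝ E n) (ι : Fin (m + 1) ↪o Fin (n + 1)) :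
    Submodule ℂ (Form (face T ι) k × Form T k) :=
  Submodule.span ℂ {p | ∃ (α : Fin (m + 1) → ℕ) (σ : Fin k ↪o Fin (m + 1)),
    ∑ i, α i = r ∧
    p = (lamPow (face T ι) α • dlamWedge (face T ι) σ,
      lamPow T (Function.extend ι α 0) •
        constWedge T fun j => Psi T ι (Function.extend ι α 0) (ι (σ j)))}

/-- Graph of the extension operator `ext^{r,k,-}_{F,T}`,
`λ_F^α φ^F_ρ ↦ λ_T^β φ^T_{ι∘ρ}` for `|α| = r - 1`, where `β` is the extension of `α` by zero. -/
def graphExtMinus (r k : ℕ) {n m : ℕ} (T : Affine.Simplex ℝ E n)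
    (ι : Fin (m + 1) ↪o Fin (n + 1)) :
    Submodule ℂ (Form (face T ι) k × Form T k) :=
  Submodule.span ℂ {p | ∃ (α : Fin (m + 1) → ℕ) (ρ : Fin (k + 1) ↪o Fin (m + 1)),
    (∑ i, α i) + 1 = r ∧
    p = (lamPow (face T ι) α • whitney (face T ι) ρ,
      lamPow T (Function.extend ι α 0) • whitney T (fun j => ι (ρ j)))}

/-- The image of a set under the operator with graph `G`. -/
def image {V W : Type*} [AddCommGroup V] [Module ℂ V] [AddCommGroup W] [Module ℂ W]
    (G : Submodule ℂ (V × W)) (Q : Set V) : Set W :=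
  {w | ∃ v ∈ Q, (v, w) ∈ G}

/-- The preimage of a set under the operator with graph `G`; for an invertible operator this is
the image under the inverse operator. -/
def preimage {V W : Type*} [AddCommGroup V] [Module ℂ V] [AddCommGroup W] [Module ℂ W]
    (G : Submodule ℂ (V × W)) (Q : Set W) : Set V :=
  {v | ∃ w ∈ Q, (v, w) ∈ G}

/-! ### Bases of the constant forms -/

/-- The complex constant 1-form `∑ c_i dλ_i`. -/
def oneForm {n : ℕ} (T : Affine.Simplex ℝ E n) (c : Fin (n + 1) → ℂ) : Form T 1 :=
  ∑ i, c i • dlamWedge T ![i]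

/-- The primitive cubic root of unity. -/
def xi3 : ℂ := Complex.exp (2 * Complex.I * Real.pi / 3)

/-- The real constant covector `∑ c_i dλ_i`. -/
def covector {n : ℕ} (T : Affine.Simplex ℝ E n) (c : Fin (n + 1) → ℝ) : Tangent T →ₗ[ℝ] ℝ :=
  ∑ i, c i • dlam T i

/-- `ψ_w = dλ₀ - dλ₁ + dλ₂ - dλ₃` on a tetrahedron. -/
def psiW (T : Affine.Simplex ℝ E 3) : Tangent T →ₗ[ℝ] ℝ := covector T ![1, -1, 1, -1]

/-- `ψ_p = dλ₀ + dλ₁ - dλ₂ - dλ₃` on a tetrahedron. -/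
def psiP (T : Affine.Simplex ℝ E 3) : Tangent T →ₗ[ℝ] ℝ := covector T ![1, 1, -1, -1]

/-- `ψ_k = dλ₀ - dλ₁ - dλ₂ + dλ₃` on a tetrahedron. -/
def psiK (T : Affine.Simplex ℝ E 3) : Tangent T →ₗ[ℝ] ℝ := covector T ![1, -1, -1, 1]

/-- On a 4-simplex, the pullback `S_π^* ζ₀` of the 2-form
`ζ₀ = dλ₀₁ + i dλ₀₂ - i dλ₀₃ - dλ₀₄ + dλ₁₂ + i dλ₁₃ - i dλ₁₄ + dλ₂₃ + i dλ₂₄ + dλ₃₄`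
along the affine map `S_π` with `S_π(v_j) = v_{π⁻¹(j)}`; it satisfies `S_π^* dλ_i = dλ_{π(i)}`. -/
def zeta (T : Affine.Simplex ℝ E 4) (π : Equiv.Perm (Fin 5)) : Form T 2 :=
  let w : Fin 5 → Fin 5 → Form T 2 := fun i j => dlamWedge T ![π i, π j]
  w 0 1 + Complex.I • w 0 2 - Complex.I • w 0 3 - w 0 4 + w 1 2 + Complex.I • w 1 3
    - Complex.I • w 1 4 + w 2 3 + Complex.I • w 2 4 + w 3 4

/-- The sets `𝒜𝒫₀Λ^k(T)` with which the recursion starts. They are prescribed for constant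
1-forms on triangles, constant 1-forms and 2-forms on tetrahedra and constant 2-forms on
4-simplices; in all other cases an arbitrary choice `B` is used.

On a 4-simplex the basis is `ζ₀`, `ζ₁ = S_τ^* ζ₀`, `ζ₂ = S_κ^* ζ₁`, …, `ζ₅ = S_κ^* ζ₄`, where
`τ = (0 1)` and `κ = (0 1 2 3 4)`. -/
def constBasis (B : ∀ (n k : ℕ) (T : Affine.Simplex ℝ E n), Set (Form T k)) :
    ∀ (n k : ℕ) (T : Affine.Simplex ℝ E n), Set (Form T k)
  | 2, 1, T => {oneForm T ![1, xi3, xi3 ^ 2], oneForm T ![1, xi3 ^ 2, xi3]}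
  | 3, 1, T => {constWedge T ![psiW T], constWedge T ![psiP T], constWedge T ![psiK T]}
  | 3, 2, T => {constWedge T ![psiW T, psiP T], constWedge T ![psiW T, psiK T],
      constWedge T ![psiP T, psiK T]}
  | 4, 2, T => {zeta T 1} ∪
      Set.range fun j : Fin 5 => zeta T (finRotate 5 ^ (j : ℕ) * Equiv.swap 0 1)
  | n, k, T => B n k T

/-! ### The recursive construction -/

mutual

/-- `𝒜𝒫_rΛ^k(T)`: the given basis if `r = 0`, and `⋃_F ext^{r,k}_{F,T} 𝒜𝒫̊_rΛ^k(F)` over all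
subsimplices `F` of `T` if `r ≥ 1`. -/
def basisP (B : ∀ (n k : ℕ) (T : Affine.Simplex ℝ E n), Set (Form T k))
    (r n k : ℕ) (T : Affine.Simplex ℝ E n) : Set (Form T k) :=
  match r with
  | 0 => constBasis B n k T
  | q + 1 => ⋃ (m : ℕ) (ι : Fin (m + 1) ↪o Fin (n + 1)),
      image (graphExt (q + 1) k T ι) (basisP0 B (q + 1) m k (face T ι))
termination_by 4 * r + 3

/-- `𝒜𝒫̊_rΛ^k(T) = 𝓙⁻¹ 𝒜𝒫⁻_{r-n+k}Λ^{n-k}(T)`, with `l = n - k` and `s = r - l`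
(empty if `r < l` or `n < k`). -/
def basisP0 (B : ∀ (n k : ℕ) (T : Affine.Simplex ℝ E n), Set (Form T k))
    (r n k : ℕ) (T : Affine.Simplex ℝ E n) : Set (Form T k) :=
  ⋃ (l : ℕ) (s : ℕ) (_ : k + l = n) (_ : s + l = r),
    preimage (graphJ s k l T) (basisPMinus B s n l T)
termination_by 4 * r + 2

/-- `𝒜𝒫⁻_rΛ^k(T) = ⋃_F ext^{r,k,-}_{F,T} 𝒜𝒫̊⁻_rΛ^k(F)` over all subsimplices `F` of `T`. -/
def basisPMinus (B : ∀ (n k : ℕ) (T : Affine.Simplex ℝ E n), Set (Form T k))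
    (r n k : ℕ) (T : Affine.Simplex ℝ E n) : Set (Form T k) :=
  ⋃ (m : ℕ) (ι : Fin (m + 1) ↪o Fin (n + 1)),
    image (graphExtMinus r k T ι) (basisPMinus0 B r m k (face T ι))
termination_by 4 * r + 1

/-- `𝒜𝒫̊⁻_rΛ^k(T) = 𝓘 𝒜𝒫_{r-n+k-1}Λ^{n-k}(T)`, with `l = n - k` and `s = r - l - 1`
(empty if `r < l + 1` or `n < k`). -/
def basisPMinus0 (B : ∀ (n k : ℕ) (T : Affine.Simplex ℝ E n), Set (Form T k))
    (r n k : ℕ) (T : Affine.Simplex ℝ E n) : Set (Form T k) :=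
  ⋃ (l : ℕ) (s : ℕ) (_ : k + l = n) (_ : s + l + 1 = r),
    image (graphI s l k T) (basisP B s n l T)
termination_by 4 * r

end

/-! ### Simplicial symmetries and invariance -/

/-- The affine automorphisms of the simplex `T`, each given by its affine extension to the affine
hull of `T`. -/
def Sym {n : ℕ} (T : Affine.Simplex ℝ E n) : Type _ :=
  {S : Hull T ≃ᵃ[ℝ] Hull T // ∀ x, S x ∈ Body T ↔ x ∈ Body T}

/-- The pullback `S^* ω`. -/
def pullback {n k : ℕ} {T : Affine.Simplex ℝ E n} (S : Sym T) (ω : Form T k) : Form T k :=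
  fun x => (ω ⟨S.1 x, (S.2 x).2 x.2⟩).compLinearMap (S.1.linear : Tangent T →ₗ[ℝ] Tangent T)

/-- `Q` is `ℂ`-invariant: it is finite, and every simplicial symmetry permutes the elements of `Q`
up to nonzero complex factors. -/
def IsCInvariant {n k : ℕ} {T : Affine.Simplex ℝ E n} (Q : Set (Form T k)) : Prop :=
  Q.Finite ∧ ∀ S : Sym T, ∃ (τ : Equiv.Perm Q) (χ : Q → ℂ),
    ∀ ω : Q, χ ω ≠ 0 ∧ pullback S (ω : Form T k) = χ ω • (τ ω : Form T k)

/-- `Q` is a basis of the subspace `V`. -/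
def IsBasisOf {W : Type*} [AddCommGroup W] [Module ℂ W] (Q : Set W) (V : Submodule ℂ W) : Prop :=
  LinearIndepOn ℂ id Q ∧ Submodule.span ℂ Q = V

end FEEC

end

-- The basis property rests on a geometric decomposition. For `r ≥ 1` the space `PForms r k T` is
-- the direct sum, over the faces `F`, of the extensions of `PInt r k F`, the span of those `λ^α
-- dλ_σ` in which every vertex of `F` occurs in `α` or `σ`. The trimmed spaces decompose in the same
-- way with `PMinusInt`, for every `r`. The trace onto `F` undoes the extension from `F`, and the
-- extended forms have zero trace on every face that does not contain `F`. The pieces are therefore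
-- independent by triangularity in the dimension (`iSupIndep_of_triangular`). Spanning is
-- `pMinusForms_le_span` and `pForms_le_span`, and `isBasisOf_iUnion_image` combines these facts.
-- The isomorphisms `𝓘` and `𝓙⁻¹` carry full and trimmed spaces of complementary form degree onto
-- `PMinusInt` and `PInt` (`map_starAForm`, `map_starBForm`), so bases propagate by induction on
-- `r`.
--
-- All operators are prescribed on spanning sets that satisfy linear relations, so single-valuedness
-- of their graphs is part of the proof. `𝓘` and `𝓙⁻¹` are restrictions of pointwise star operators
-- `starA` and `starB`: a form is evaluated on the vectors from a point to all tuples of vertices,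
-- weighted by barycentric coordinates, and paired with a contracted determinant. No expansion of
-- the form is chosen. The two operators compose to multiplication by the product of all `λ_i`,
-- hence are injective on the polynomial spaces. The trimmed extension is pullback along the central
-- projection to the face, times a power of the sum of the face coordinates
-- (`apply_of_mem_graphExtMinus`). The full extension is single-valued because the monomials `λ^α`
-- of a fixed degree are linearly independent (`coeff_eq_zero_of_sum_lamPow`).
--
-- For invariance, every operator commutes with relabelling of vertices, up to the sign of the
-- permutation for the star operators. Hence covariance of the constant bases is inherited
-- (`isCovariant_basisP_and_basisPMinus`). Starting from 2-forms on a 4-simplex, only constant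
-- spaces that are one-dimensional or have a prescribed basis are reached (`Linked`). The prescribed
-- bases are handled by finite checks. On a triangle the coefficients are the nontrivial characters
-- of `ℤ/3`, and on a tetrahedron those of the Klein four-group. On a 4-simplex the coefficient of
-- `dλ_a ∧ dλ_b` in `ζ₀` is `χ(b - a)` with `χ` a quartic character modulo 5. So `ζ₀` is fixed up to
-- factors by the affine group of the field with five elements, which has index six in the symmetric
-- group, and the six basis forms span the six lines in its orbit.

noncomputable section

namespace FEEC

variable {E : Type*} [AddCommGroup E] [Module ℝ E]

/-! ### Barycentric coordinates of points and tangent vectors -/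

section Coordinates

variable {n : ℕ} (T : Affine.Simplex ℝ E n)

/-- The barycentric coordinates of a point. -/
def bary (x : Hull T) : Fin (n + 1) → ℝ := fun i => lam T i x

/-- The tangent vector as a vector of barycentric increments. -/
def tanCoord : Tangent T →ₗ[ℝ] (Fin (n + 1) → ℝ) := LinearMap.pi (dlam T)

@[simp] lemma bary_apply (x : Hull T) (i : Fin (n + 1)) : bary T x i = lam T i x := rfl

@[simp] lemma tanCoord_apply (w : Tangent T) (i : Fin (n + 1)) : tanCoord T w i = dlam T i w := rfl

lemma lam_vertex (i j : Fin (n + 1)) : lam T i (vertexBasis T j) = if i = j then 1 else 0 :=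
  (vertexBasis T).coord_apply i j

lemma sum_lam (x : Hull T) : ∑ i, lam T i x = 1 :=
  (vertexBasis T).sum_coord_apply_eq_one x

lemma lam_ext {x y : Hull T} (h : ∀ i, lam T i x = lam T i y) : x = y :=
  (vertexBasis T).ext_elem h

lemma dlam_vsub (i : Fin (n + 1)) (x y : Hull T) :
    dlam T i (x -ᵥ y) = lam T i x - lam T i y := by
  simp [dlam]

lemma sum_dlam (w : Tangent T) : ∑ i, dlam T i w = 0 := by
  have h : w = (w +ᵥ vertexBasis T 0) -ᵥ vertexBasis T 0 := by simp
  rw [h]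
  simp only [dlam_vsub, Finset.sum_sub_distrib, sum_lam, sub_self]

lemma sum_dlam_eq_zero : ∑ i, dlam T i = 0 := by
  ext w
  simpa using sum_dlam T w

lemma dlam_ext {v w : Tangent T} (h : ∀ i, dlam T i v = dlam T i w) : v = w := by
  have : v +ᵥ vertexBasis T 0 = w +ᵥ vertexBasis T 0 := by
    refine lam_ext T fun i => ?_
    rw [AffineMap.map_vadd, AffineMap.map_vadd]
    exact congrArg (· +ᵥ _) (h i)
  exact vadd_right_cancel _ this

/-- The edge vector from the vertex `0` to the vertex `i`. -/
def edge (i : Fin (n + 1)) : Tangent T := vertexBasis T i -ᵥ vertexBasis T 0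

lemma dlam_edge (i j : Fin (n + 1)) :
    dlam T i (edge T j) = (if i = j then 1 else 0) - if i = 0 then 1 else 0 := by
  simp only [edge, dlam_vsub, lam_vertex]

/-- The tangent vector with given coordinates of sum zero. -/
def vec : (Fin (n + 1) → ℝ) →ₗ[ℝ] Tangent T := ∑ i, (LinearMap.proj i).smulRight (edge T i)

lemma vec_apply (c : Fin (n + 1) → ℝ) : vec T c = ∑ i, c i • edge T i := by
  simp [vec]

/-- All edges start at vertex `0`, so coordinate `0` absorbs the defect when `c` does not sum to
zero. -/
lemma dlam_vec_general (c : Fin (n + 1) → ℝ) (i : Fin (n + 1)) :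
    dlam T i (vec T c) = c i - if i = 0 then ∑ j, c j else 0 := by
  simp only [vec_apply, map_sum, map_smul, dlam_edge, smul_eq_mul, mul_sub, Finset.sum_sub_distrib]
  congr 1
  · simp
  · split_ifs <;> simp

lemma dlam_vec {c : Fin (n + 1) → ℝ} (hc : ∑ j, c j = 0) (i : Fin (n + 1)) :
    dlam T i (vec T c) = c i := by
  rw [dlam_vec_general, hc]; simp

/-- The point with given coordinates of sum one. -/
def pt (c : Fin (n + 1) → ℝ) : Hull T := vec T c +ᵥ vertexBasis T 0

lemma lam_pt {c : Fin (n + 1) → ℝ} (hc : ∑ j, c j = 1) (i : Fin (n + 1)) :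
    lam T i (pt T c) = c i := by
  have : lam T i (pt T c) = dlam T i (vec T c) + lam T i (vertexBasis T 0) := by
    rw [pt, AffineMap.map_vadd]; rfl
  rw [this, dlam_vec_general, lam_vertex, hc]
  split_ifs <;> ring

lemma mem_body_iff (x : Hull T) : x ∈ Body T ↔ ∀ i, 0 ≤ lam T i x := by
  constructor
  · intro hx
    have hx' : (x : E) ∈ convexHull ℝ (Set.range T.points) := hx
    rw [convexHull_range_eq_exists_affineCombination] at hx'
    obtain ⟨s, w, hw0, hw1, hx⟩ := hx'
    intro i
    have key : x = s.affineCombination ℝ (vertexBasis T) w := by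
      apply Subtype.ext
      rw [← hx]
      have := s.map_affineCombination (vertexBasis T) w hw1 (Hull T).subtype
      rw [AffineSubspace.coe_subtype] at this
      rw [this]; rfl
    rw [key]
    by_cases hi : i ∈ s
    · rw [lam, (vertexBasis T).coord_apply_combination_of_mem hi hw1]
      exact hw0 i hi
    · rw [lam, (vertexBasis T).coord_apply_combination_of_notMem hi hw1]
  · intro h
    have key : x = Finset.univ.affineCombination ℝ (vertexBasis T) (bary T x) :=
      ((vertexBasis T).affineCombination_coord_eq_self x).symm
    change (x : E) ∈ convexHull ℝ (Set.range T.points)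
    rw [convexHull_range_eq_exists_affineCombination]
    refine ⟨Finset.univ, bary T x, fun i _ => h i, sum_lam T x, ?_⟩
    have := Finset.univ.map_affineCombination (vertexBasis T) (bary T x) (sum_lam T x)
      (Hull T).subtype
    rw [AffineSubspace.coe_subtype, ← key] at this
    rw [this]; rfl

lemma pt_mem_body {c : Fin (n + 1) → ℝ} (hc : ∑ j, c j = 1) (h0 : ∀ i, 0 ≤ c i) :
    pt T c ∈ Body T :=
  (mem_body_iff T _).2 fun i => by rw [lam_pt T hc]; exact h0 i

lemma lam_nonneg (x : Body T) (i : Fin (n + 1)) : 0 ≤ lam T i x := (mem_body_iff T _).1 x.2 i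

/-- The coordinates with respect to the edge vectors starting in vertex `0`. -/
def edgeEquiv : Tangent T ≃ₗ[ℝ] (Fin n → ℝ) where
      toFun w i := dlam T i.succ w
      map_add' v w := by ext; simp
      map_smul' a v := by ext; simp
      invFun c := ∑ i, c i • edge T i.succ
      left_inv w := by
        refine dlam_ext T fun i => ?_
        refine Fin.cases ?_ (fun i => ?_) i
        · have := sum_dlam T w
          rw [Fin.sum_univ_succ] at this
          simp only [map_sum, map_smul, dlam_edge]
          simp [(Fin.succ_ne_zero _).symm]
          linarith
        · simp [map_sum, dlam_edge]
      right_inv c := by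
        ext i
        simp [map_sum, dlam_edge]

/-- The edge vectors starting in vertex `0` form a basis of the tangent space. -/
def edgeBasis : Module.Basis (Fin n) ℝ (Tangent T) := Module.Basis.ofEquivFun (edgeEquiv T)

end Coordinates

/-! ### Pullback along simplicial maps -/

lemma alternatingMap_sum_apply {R M N ι κ : Type*} [Semiring R] [AddCommMonoid M] [Module R M]
    [AddCommMonoid N] [Module R N] (s : Finset κ) (g : κ → M [⋀^ι]→ₗ[R] N) (w : ι → M) :
    (∑ a ∈ s, g a) w = ∑ a ∈ s, g a w := by
  classical
  induction s using Finset.induction_on with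
  | empty => simp
  | insert a s ha ih => simp [Finset.sum_insert ha, ih]

section Pull

variable {n m : ℕ} (T : Affine.Simplex ℝ E n) (T' : Affine.Simplex ℝ E m)
  (f : Fin (n + 1) → Fin (m + 1))

/-- The coordinates of the image of a coordinate vector under the simplicial map `f`. -/
def pushCoord (c : Fin (n + 1) → ℝ) (j : Fin (m + 1)) : ℝ := ∑ i, if f i = j then c i else 0

lemma sum_pushCoord (c : Fin (n + 1) → ℝ) : ∑ j, pushCoord f c j = ∑ i, c i := by
  simp only [pushCoord]
  rw [Finset.sum_comm]
  simp

variable {f}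

lemma pushCoord_apply (hf : Function.Injective f) (c : Fin (n + 1) → ℝ) (i : Fin (n + 1)) :
    pushCoord f c (f i) = c i := by
  simp [pushCoord, hf.eq_iff]

lemma pushCoord_of_notMem (c : Fin (n + 1) → ℝ) {j : Fin (m + 1)} (hj : j ∉ Set.range f) :
    pushCoord f c j = 0 :=
  Finset.sum_eq_zero fun i _ => if_neg fun h => hj ⟨i, h⟩

variable (f)

/-- The map of bodies given on vertices by `f`. -/
def bodyMap (x : Body T) : Body T' :=
  ⟨pt T' (pushCoord f (bary T x)), pt_mem_body T'
    (by rw [sum_pushCoord]; exact sum_lam T x)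
    fun _ => Finset.sum_nonneg fun i _ => by
      split_ifs
      exacts [lam_nonneg T x i, le_rfl]⟩

/-- The tangent map of the simplicial map given on vertices by `f`. -/
def tanMap : Tangent T →ₗ[ℝ] Tangent T' :=
  vec T' ∘ₗ LinearMap.pi (fun j => ∑ i, (if f i = j then (1 : ℝ) else 0) • dlam T i)

lemma lam_bodyMap (x : Body T) (j : Fin (m + 1)) :
    lam T' j (bodyMap T T' f x) = pushCoord f (bary T x) j :=
  lam_pt T' (by rw [sum_pushCoord]; exact sum_lam T x) j

lemma dlam_tanMap (w : Tangent T) (j : Fin (m + 1)) :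
    dlam T' j (tanMap T T' f w) = pushCoord f (tanCoord T w) j := by
  have h : ∀ j, (LinearMap.pi (fun j => ∑ i, (if f i = j then (1 : ℝ) else 0) • dlam T i)) w j =
      pushCoord f (tanCoord T w) j := fun j => by
    simp [pushCoord, ite_smul, LinearMap.sum_apply, apply_ite (fun g : Tangent T →ₗ[ℝ] ℝ => g w)]
  rw [tanMap, LinearMap.comp_apply, dlam_vec, h]
  simp only [h, sum_pushCoord]
  exact sum_dlam T w

/-- The pullback of differential forms along the simplicial map given on vertices by `f`. -/
def pull (k : ℕ) : Form T' k →ₗ[ℂ] Form T k where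
  toFun ω x := (ω (bodyMap T T' f x)).compLinearMap (tanMap T T' f)
  map_add' _ _ := rfl
  map_smul' _ _ := rfl

lemma pull_apply {k : ℕ} (ω : Form T' k) (x : Body T) :
    pull T T' f k ω x = (ω (bodyMap T T' f x)).compLinearMap (tanMap T T' f) := rfl

variable {f}

lemma lam_bodyMap_apply (hf : Function.Injective f) (x : Body T) (i : Fin (n + 1)) :
    lam T' (f i) (bodyMap T T' f x) = lam T i x := by
  rw [lam_bodyMap, pushCoord_apply hf]; rfl

lemma lam_bodyMap_of_notMem (x : Body T) {j : Fin (m + 1)} (hj : j ∉ Set.range f) :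
    lam T' j (bodyMap T T' f x) = 0 := by
  rw [lam_bodyMap, pushCoord_of_notMem _ hj]

lemma dlam_comp_tanMap (hf : Function.Injective f) (i : Fin (n + 1)) :
    dlam T' (f i) ∘ₗ tanMap T T' f = dlam T i := by
  ext w
  rw [LinearMap.comp_apply, dlam_tanMap, pushCoord_apply hf]; rfl

lemma dlam_comp_tanMap_of_notMem {j : Fin (m + 1)} (hj : j ∉ Set.range f) :
    dlam T' j ∘ₗ tanMap T T' f = 0 := by
  ext w
  rw [LinearMap.comp_apply, dlam_tanMap, pushCoord_of_notMem _ hj]; rfl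

lemma pull_smul {k : ℕ} (h : Body T' → ℂ) (ω : Form T' k) :
    pull T T' f k (h • ω) = (h ∘ bodyMap T T' f) • pull T T' f k ω := rfl

lemma wedge_compLinearMap {M N : Type*} [AddCommGroup M] [Module ℝ M] [AddCommGroup N]
    [Module ℝ N] {k : ℕ} (g : Fin k → M →ₗ[ℝ] ℝ) (L : N →ₗ[ℝ] M) :
    (wedge g).compLinearMap L = wedge fun j => g j ∘ₗ L := rfl

lemma pull_constWedge {k : ℕ} (g : Fin k → Tangent T' →ₗ[ℝ] ℝ) :
    pull T T' f k (constWedge T' g) = constWedge T fun j => g j ∘ₗ tanMap T T' f := rfl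

lemma pull_dlamWedge {k : ℕ} (hf : Function.Injective f) (σ : Fin k → Fin (n + 1)) :
    pull T T' f k (dlamWedge T' (f ∘ σ)) = dlamWedge T σ := by
  simp only [dlamWedge, pull_constWedge, Function.comp_apply, dlam_comp_tanMap T T' hf]

lemma wedge_apply {M : Type*} [AddCommGroup M] [Module ℝ M] {k : ℕ} (f : Fin k → M →ₗ[ℝ] ℝ)
    (w : Fin k → M) : wedge f w = ((Matrix.det (Matrix.of fun j i => f i (w j)) : ℝ) : ℂ) := rfl

lemma wedge_eq_zero_of_zero {M : Type*} [AddCommGroup M] [Module ℝ M] {k : ℕ}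
    (f : Fin k → M →ₗ[ℝ] ℝ) (i : Fin k) (h : f i = 0) : wedge f = 0 := by
  ext w
  rw [wedge_apply, Matrix.det_eq_zero_of_column_eq_zero i]
  · simp
  · intro j; simp [h]

lemma pull_constWedge_eq_zero {k : ℕ} (g : Fin k → Tangent T' →ₗ[ℝ] ℝ) (i : Fin k)
    (h : g i ∘ₗ tanMap T T' f = 0) : pull T T' f k (constWedge T' g) = 0 := by
  rw [pull_constWedge]
  funext x
  exact wedge_eq_zero_of_zero _ i h

lemma pull_whitney {k : ℕ} (hf : Function.Injective f) (ρ : Fin (k + 1) → Fin (n + 1)) :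
    pull T T' f k (whitney T' (f ∘ ρ)) = whitney T ρ := by
  funext x
  ext w
  simp only [pull_apply, whitney, AlternatingMap.compLinearMap_apply, alternatingMap_sum_apply,
    AlternatingMap.smul_apply, Function.comp_apply, lam_bodyMap_apply T T' hf]
  refine Finset.sum_congr rfl fun i _ => ?_
  congr 1
  have := congrFun (pull_dlamWedge T T' hf (fun j => ρ (i.succAbove j))) x
  exact DFunLike.congr_fun this w

/-- Every summand of the Whitney form contains `λ_{ρ(i)}` or `dλ_{ρ(i)}`, and both pull back to zero
when that vertex is missed. -/
lemma pull_whitney_eq_zero {k : ℕ} (ρ : Fin (k + 1) → Fin (m + 1)) (i : Fin (k + 1))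
    (h : ρ i ∉ Set.range f) : pull T T' f k (whitney T' ρ) = 0 := by
  funext x
  ext w
  simp only [pull_apply, whitney, AlternatingMap.compLinearMap_apply, alternatingMap_sum_apply,
    AlternatingMap.smul_apply]
  refine Finset.sum_eq_zero fun a _ => ?_
  by_cases ha : a = i
  · subst ha
    rw [lam_bodyMap_of_notMem T T' x h]
    simp
  · obtain ⟨j, rfl⟩ := Fin.exists_succAbove_eq (Ne.symm ha)
    have := congrFun (pull_constWedge_eq_zero T T' (fun j => dlam T' (ρ (a.succAbove j))) j
      (dlam_comp_tanMap_of_notMem T T' h)) x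
    have := DFunLike.congr_fun this w
    simp only [pull_apply, AlternatingMap.compLinearMap_apply] at this
    rw [dlamWedge, this]
    simp

lemma lamPow_comp_bodyMap (hf : Function.Injective f) (α : Fin (n + 1) → ℕ) :
    lamPow T' (Function.extend f α 0) ∘ bodyMap T T' f = lamPow T α := by
  classical
  funext x
  simp only [lamPow, Function.comp_apply]
  rw [← Finset.prod_subset (Finset.subset_univ (Finset.univ.image f)),
    Finset.prod_image fun a _ b _ h => hf h]
  · simp [lam_bodyMap_apply T T' hf, hf.extend_apply]
  · intro j _ hj
    rw [Function.extend_apply' _ _ _ (by simpa using hj)]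
    simp

lemma lamPow_comp_bodyMap_eq_zero (α : Fin (m + 1) → ℕ) (j : Fin (m + 1))
    (hj : j ∉ Set.range f) (h : α j ≠ 0) : lamPow T' α ∘ bodyMap T T' f = 0 := by
  funext x
  simp only [lamPow, Function.comp_apply]
  refine Finset.prod_eq_zero (Finset.mem_univ j) ?_
  rw [lam_bodyMap_of_notMem T T' x hj]
  simp [h]

end Pull

/-! ### Determinant formulas -/

section Determinants

lemma det_of_comp_perm {k N : ℕ} (M : Fin k → Fin N → ℝ) (f : Fin k → Fin N)
    (p : Equiv.Perm (Fin k)) :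
    Matrix.det (Matrix.of fun r c => M r (f (p c))) =
      (p.sign : ℤ) * Matrix.det (Matrix.of fun r c => M r (f c)) := by
  have := Matrix.det_permute' p (Matrix.of fun r c => M r (f c))
  exact this

lemma det_of_not_injective {k N : ℕ} (M : Fin k → Fin N → ℝ) (f : Fin k → Fin N)
    (hf : ¬ Function.Injective f) : Matrix.det (Matrix.of fun r c => M r (f c)) = 0 := by
  rw [Function.not_injective_iff] at hf
  obtain ⟨i, j, hij, hne⟩ := hf
  refine Matrix.det_zero_of_column_eq hne fun r => ?_
  simp [hij]

/-- A submodule that contains the values of an alternating family at strictly ascending maps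
contains all its values. -/
lemma mem_of_mem_ascending {W : Type*} [AddCommGroup W] [Module ℂ W] {k N : ℕ}
    (g : (Fin k → Fin N) → W)
    (hp : ∀ f (p : Equiv.Perm (Fin k)), g (f ∘ p) = ((p.sign : ℤ) : ℂ) • g f)
    (hinj : ∀ f, ¬ Function.Injective f → g f = 0) {S : Submodule ℂ W}
    (f : Fin k → Fin N)
    (h : ∀ σ : Fin k ↪o Fin N, Set.range σ = Set.range f → g σ ∈ S) : g f ∈ S := by
  by_cases hf : Function.Injective f
  · have hm : StrictMono (f ∘ Tuple.sort f) :=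
      (Tuple.monotone_sort f).strictMono_of_injective (hf.comp (Tuple.sort f).injective)
    have h1 := h (OrderEmbedding.ofStrictMono _ hm) (by
      simp [OrderEmbedding.coe_ofStrictMono, Set.range_comp])
    rw [OrderEmbedding.coe_ofStrictMono, hp] at h1
    have h2 := S.smul_mem (((Tuple.sort f).sign : ℤ) : ℂ) h1
    rw [smul_smul] at h2
    have h3 : (((Tuple.sort f).sign : ℤ) : ℂ) * (((Tuple.sort f).sign : ℤ) : ℂ) = 1 := by
      rcases Int.units_eq_one_or (Tuple.sort f).sign with h | h <;> simp [h]
    rwa [h3, one_smul] at h2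
  · rw [hinj f hf]; exact S.zero_mem

/-- The product formula for the sign has a factor `-1` exactly for each inversion. -/
lemma seqSign_perm {m : ℕ} (p : Equiv.Perm (Fin m)) : seqSign p = ((p.sign : ℤ) : ℂ) := by
  rw [Equiv.Perm.sign_eq_prod_prod_Ioi, seqSign]
  have h1 : (Finset.univ.filter fun q : Fin m × Fin m => q.1 < q.2 ∧ p q.2 < p q.1).card =
      ∑ i, ∑ j ∈ Finset.Ioi i, if p i < p j then 0 else 1 := by
    rw [Finset.card_filter, Fintype.sum_prod_type]
    refine Finset.sum_congr rfl fun i _ => ?_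
    rw [← Finset.sum_filter_add_sum_filter_not Finset.univ (fun j => i < j)]
    rw [Finset.sum_eq_zero (s := Finset.univ.filter fun j => ¬ i < j), add_zero]
    · refine Finset.sum_congr (by ext; simp) fun j hj => ?_
      have hij : i < j := by simpa using hj
      have hne : p i ≠ p j := fun h => hij.ne (p.injective h)
      rcases lt_or_gt_of_ne hne with h | h
      · simp [h, h.not_gt]
      · simp [h, h.not_gt, hij]
    · intro j hj
      simp only [Finset.mem_filter, Finset.mem_univ, true_and] at hj
      simp [hj]
  rw [h1]
  push_cast
  rw [← Finset.prod_pow_eq_pow_sum]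
  refine Finset.prod_congr rfl fun i _ => ?_
  rw [← Finset.prod_pow_eq_pow_sum]
  refine Finset.prod_congr rfl fun j _ => ?_
  split_ifs <;> simp

lemma seqSign_mul_self {m N : ℕ} (τ : Fin m → Fin N) : seqSign τ * seqSign τ = 1 := by
  rw [seqSign, ← mul_pow]; simp

lemma append_bijective {k l N : ℕ} {σ : Fin k → Fin N} {ρ : Fin l → Fin N}
    (hσ : Function.Injective σ) (hρ : Function.Injective ρ)
    (h : IsCompl (Set.range σ) (Set.range ρ)) : Function.Bijective (Fin.append σ ρ) := by
  constructor
  · rw [Fin.append_injective_iff]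
    exact ⟨hσ, hρ, fun i j hij =>
      Set.disjoint_left.1 h.disjoint ⟨i, rfl⟩ ⟨j, hij.symm⟩⟩
  · intro a
    by_cases ha : a ∈ Set.range σ
    · obtain ⟨i, rfl⟩ := ha
      exact ⟨Fin.castAdd _ i, by simp⟩
    · rw [← Set.mem_compl_iff, h.compl_eq] at ha
      obtain ⟨i, rfl⟩ := ha
      exact ⟨Fin.natAdd _ i, by simp⟩

variable {k l : ℕ}

/-- Reordering the columns by `(σ, ρ)` makes the matrix block triangular with an identity block. The
cost is the sign of the reordering, which is the `ε(σ,σᶜ)` in the definitions of `𝓘` and `𝓙`. -/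
lemma det_append_single_left {σ : Fin k → Fin (k + l)} {ρ : Fin l → Fin (k + l)}
    (hσ : Function.Injective σ) (hρ : Function.Injective ρ)
    (h : IsCompl (Set.range σ) (Set.range ρ)) (y : Fin l → Fin (k + l) → ℝ) :
    ((Matrix.det (Matrix.of (Fin.append (fun j => Pi.single (σ j) (1 : ℝ)) y)) : ℝ) : ℂ) =
      seqSign (Fin.append σ ρ) * (Matrix.det (Matrix.of fun r c => y r (ρ c)) : ℝ) := by
  set p : Equiv.Perm (Fin (k + l)) := Equiv.ofBijective _ (append_bijective hσ hρ h) with hp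
  have h0 : seqSign (Fin.append σ ρ) = ((p.sign : ℤ) : ℂ) := seqSign_perm p
  have hpe : ∀ c, p c = Fin.append σ ρ c := fun c => rfl
  set A : Matrix (Fin (k + l)) (Fin (k + l)) ℝ :=
    Matrix.of (Fin.append (fun j => Pi.single (σ j) (1 : ℝ)) y)
  have h1 : (A.submatrix id p).det = (p.sign : ℤ) * A.det := Matrix.det_permute' p A
  have h2 : (A.submatrix id p).det = Matrix.det (Matrix.of fun r c => y r (ρ c)) := by
    rw [← Matrix.det_submatrix_equiv_self finSumFinEquiv]
    have : (A.submatrix id p).submatrix finSumFinEquiv finSumFinEquiv =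
        Matrix.fromBlocks 1 0 (Matrix.of fun r c => y r (σ c)) (Matrix.of fun r c => y r (ρ c)) := by
      ext i j
      rcases i with i | i <;> rcases j with j | j
      · simp [A, hpe, Matrix.one_apply, Pi.single_apply, hσ.eq_iff, eq_comm]
      · have : ρ j ≠ σ i := fun e => Set.disjoint_left.1 h.disjoint ⟨i, rfl⟩ ⟨j, e⟩
        simp [A, hpe, this]
      · simp [A, hpe]
      · simp [A, hpe]
    rw [this, Matrix.det_fromBlocks_zero₁₂, Matrix.det_one, one_mul]
  have h3 : A.det = (p.sign : ℤ) * Matrix.det (Matrix.of fun r c => y r (ρ c)) := by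
    rw [← h2, h1, ← mul_assoc, ← Int.cast_mul]
    rcases Int.units_eq_one_or p.sign with h | h <;> simp [h]
  rw [h3, h0]; push_cast; rfl

lemma det_append_single_right {σ : Fin k → Fin (k + l)} {ρ : Fin l → Fin (k + l)}
    (hσ : Function.Injective σ) (hρ : Function.Injective ρ)
    (h : IsCompl (Set.range σ) (Set.range ρ)) (y : Fin k → Fin (k + l) → ℝ) :
    ((Matrix.det (Matrix.of (Fin.append y (fun j => Pi.single (ρ j) (1 : ℝ)))) : ℝ) : ℂ) =
      seqSign (Fin.append σ ρ) * (Matrix.det (Matrix.of fun r c => y r (σ c)) : ℝ) := by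
  set p : Equiv.Perm (Fin (k + l)) := Equiv.ofBijective _ (append_bijective hσ hρ h) with hp
  have h0 : seqSign (Fin.append σ ρ) = ((p.sign : ℤ) : ℂ) := seqSign_perm p
  have hpe : ∀ c, p c = Fin.append σ ρ c := fun c => rfl
  set A : Matrix (Fin (k + l)) (Fin (k + l)) ℝ :=
    Matrix.of (Fin.append y (fun j => Pi.single (ρ j) (1 : ℝ)))
  have h1 : (A.submatrix id p).det = (p.sign : ℤ) * A.det := Matrix.det_permute' p A
  have h2 : (A.submatrix id p).det = Matrix.det (Matrix.of fun r c => y r (σ c)) := by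
    rw [← Matrix.det_submatrix_equiv_self finSumFinEquiv]
    have : (A.submatrix id p).submatrix finSumFinEquiv finSumFinEquiv =
        Matrix.fromBlocks (Matrix.of fun r c => y r (σ c)) (Matrix.of fun r c => y r (ρ c)) 0 1 := by
      ext i j
      rcases i with i | i <;> rcases j with j | j
      · simp [A, hpe]
      · simp [A, hpe]
      · have : σ j ≠ ρ i := fun e => Set.disjoint_left.1 h.disjoint ⟨j, rfl⟩ ⟨i, e.symm⟩
        simp [A, hpe, this]
      · simp [A, hpe, Matrix.one_apply, Pi.single_apply, hρ.eq_iff, eq_comm]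
    rw [this, Matrix.det_fromBlocks_zero₂₁, Matrix.det_one, mul_one]
  have h3 : A.det = (p.sign : ℤ) * Matrix.det (Matrix.of fun r c => y r (σ c)) := by
    rw [← h2, h1, ← mul_assoc, ← Int.cast_mul]
    rcases Int.units_eq_one_or p.sign with h | h <;> simp [h]
  rw [h3, h0]; push_cast; rfl

lemma append_update_left {α : Type*} (u : Fin k → α) (y : Fin l → α) (i : Fin k) (a : α) :
    Fin.append (Function.update u i a) y = Function.update (Fin.append u y) (Fin.castAdd l i) a := by
  ext j
  refine Fin.addCases (fun j => ?_) (fun j => ?_) j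
  · rcases eq_or_ne j i with rfl | h
    · simp
    · have : Fin.castAdd l j ≠ Fin.castAdd l i := fun e => h (Fin.castAdd_injective _ _ e)
      simp [h, this]
  · have : Fin.natAdd k j ≠ Fin.castAdd l i := fun e => by
      have := congrArg Fin.val e
      simp at this; omega
    simp [this]

lemma append_update_right {α : Type*} (u : Fin k → α) (y : Fin l → α) (i : Fin l) (a : α) :
    Fin.append u (Function.update y i a) = Function.update (Fin.append u y) (Fin.natAdd k i) a := by
  ext j
  refine Fin.addCases (fun j => ?_) (fun j => ?_) j
  · have : Fin.castAdd l j ≠ Fin.natAdd k i := fun e => by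
      have := congrArg Fin.val e
      simp at this; omega
    simp [this]
  · rcases eq_or_ne j i with rfl | h
    · simp
    · have : Fin.natAdd k j ≠ Fin.natAdd k i := fun e => h (Fin.natAdd_injective _ _ e)
      simp [h, this]

/-- The determinant as an alternating function of its first rows. -/
def detLeft (y : Fin l → Fin (k + l) → ℝ) : (Fin (k + l) → ℝ) [⋀^Fin k]→ₗ[ℝ] ℝ where
  toFun u := Matrix.detRowAlternating (Fin.append u y)
  map_update_add' := by
    intro inst u i a b
    rw [Subsingleton.elim inst (instDecidableEqFin k)]
    simp only [append_update_left, AlternatingMap.map_update_add]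
  map_update_smul' := by
    intro inst u i a b
    rw [Subsingleton.elim inst (instDecidableEqFin k)]
    simp only [append_update_left, AlternatingMap.map_update_smul]
  map_eq_zero_of_eq' u i j h hij := by
    refine AlternatingMap.map_eq_zero_of_eq _ _ (i := Fin.castAdd l i) (j := Fin.castAdd l j) ?_ ?_
    · simpa using h
    · exact fun e => hij (Fin.castAdd_injective _ _ e)

/-- The determinant as an alternating function of its last rows. -/
def detRight (u : Fin k → Fin (k + l) → ℝ) : (Fin (k + l) → ℝ) [⋀^Fin l]→ₗ[ℝ] ℝ where
  toFun y := Matrix.detRowAlternating (Fin.append u y)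
  map_update_add' := by
    intro inst y i a b
    rw [Subsingleton.elim inst (instDecidableEqFin l)]
    simp only [append_update_right, AlternatingMap.map_update_add]
  map_update_smul' := by
    intro inst y i a b
    rw [Subsingleton.elim inst (instDecidableEqFin l)]
    simp only [append_update_right, AlternatingMap.map_update_smul]
  map_eq_zero_of_eq' y i j h hij := by
    refine AlternatingMap.map_eq_zero_of_eq _ _ (i := Fin.natAdd k i) (j := Fin.natAdd k j) ?_ ?_
    · simpa using h
    · exact fun e => hij (Fin.natAdd_injective _ _ e)

lemma detLeft_apply (y : Fin l → Fin (k + l) → ℝ) (u : Fin k → Fin (k + l) → ℝ) :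
    detLeft y u = Matrix.det (Matrix.of (Fin.append u y)) := rfl

lemma detRight_apply (y : Fin l → Fin (k + l) → ℝ) (u : Fin k → Fin (k + l) → ℝ) :
    detRight u y = Matrix.det (Matrix.of (Fin.append u y)) := rfl

/-- An alternating form which vanishes if one argument is `x` is insensitive to adding multiples
of `x` to the arguments. -/
lemma map_add_smul_of_vanish {V : Type*} [AddCommGroup V] [Module ℝ V]
    (Θ : V [⋀^Fin k]→ₗ[ℝ] ℝ) (x : V) (hx : ∀ v : Fin k → V, (∃ i, v i = x) → Θ v = 0)
    (y : Fin k → V) (c : Fin k → ℝ) : Θ (fun j => y j + c j • x) = Θ y := by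
  classical
  have h := Θ.toMultilinearMap.map_add_univ y (fun j => c j • x)
  simp only [AlternatingMap.coe_multilinearMap] at h
  change Θ (y + fun j => c j • x) = _
  -- In the multilinear expansion, every term other than the one with all `y j` has a multiple of
  -- `x` in some slot.
  rw [h, Finset.sum_eq_single Finset.univ]
  · simp
  · intro s _ hs
    obtain ⟨i, hi⟩ : ∃ i, i ∉ s := by
      by_contra! H
      exact hs (Finset.eq_univ_of_forall H)
    set v := s.piecewise y fun j => c j • x with hv
    have hvi : v i = c i • x := by simp [hv, hi]
    have : v = Function.update v i (c i • x) := by rw [← hvi]; simp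
    rw [this, Θ.map_update_smul, hx _ ⟨i, by simp⟩, smul_zero]
  · simp

/-- Contraction of an alternating form `Θ` annihilated by `x` with `dx_τ`, weighted by the
coordinates of `x`. -/
lemma sum_weighted_contract {N : ℕ} (x : Fin N → ℝ)
    (Θ : (Fin N → ℝ) [⋀^Fin k]→ₗ[ℝ] ℝ) (hx : ∀ v : Fin k → Fin N → ℝ, (∃ i, v i = x) → Θ v = 0)
    (τ : Fin k → Fin N) :
    ∑ f : Fin k → Fin N, (∏ j, x (f j)) *
        Matrix.det (Matrix.of fun j i => ((Pi.single (f j) 1 : Fin N → ℝ) - x) (τ i)) *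
        Θ (fun j => Pi.single (f j) 1) =
      (k.factorial : ℝ) * ((∏ j, x (τ j)) * Θ (fun j => Pi.single (τ j) 1)) := by
  -- For a single term `p` of the Leibniz expansion, the sum over `f` factors slot by slot through
  -- the multilinearity of `Θ`.
  have h1 : ∀ p : Equiv.Perm (Fin k), ∑ f : Fin k → Fin N, (∏ j, x (f j)) *
        (∏ j, ((Pi.single (f j) 1 : Fin N → ℝ) - x) (τ (p j))) * Θ (fun j => Pi.single (f j) 1) =
      (p.sign : ℤ) * ((∏ j, x (τ j)) * Θ (fun j => Pi.single (τ j) 1)) := by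
    intro p
    have e := Θ.toMultilinearMap.map_sum (fun (j : Fin k) (i : Fin N) =>
      (x i * ((Pi.single i 1 : Fin N → ℝ) - x) (τ (p j))) • (Pi.single i (1 : ℝ) : Fin N → ℝ))
    simp only [AlternatingMap.coe_multilinearMap, MultilinearMap.map_smul_univ] at e
    -- The argument in slot `j` is a multiple of `e_{τ(p j)} - x`, and the `x` may be dropped
    -- because `Θ` vanishes on it.
    have e2 : ∀ j : Fin k, (∑ i, (x i * ((Pi.single i 1 : Fin N → ℝ) - x) (τ (p j))) •
        (Pi.single i (1 : ℝ) : Fin N → ℝ)) =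
        x (τ (p j)) • (Pi.single (τ (p j)) 1 + (-1 : ℝ) • x) := by
      intro j
      ext a
      simp only [Finset.sum_apply, Pi.smul_apply, smul_eq_mul, Pi.sub_apply, Pi.add_apply]
      rw [Finset.sum_eq_single a]
      · rcases eq_or_ne a (τ (p j)) with h | h
        · simp only [h, Pi.single_eq_same]; ring
        · simp [h, h.symm, mul_comm]
      · intro b _ hb
        simp [Pi.single_apply, hb.symm]
      · simp
    simp only [e2] at e
    have e3 := Θ.toMultilinearMap.map_smul_univ (fun j => x (τ (p j)))
      (fun j => Pi.single (τ (p j)) 1 + (-1 : ℝ) • x)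
    simp only [AlternatingMap.coe_multilinearMap] at e3
    rw [e3, map_add_smul_of_vanish Θ x hx (fun j => Pi.single (τ (p j)) 1) (fun _ => -1)] at e
    have e4 : Θ (fun j => Pi.single (τ (p j)) 1) = (p.sign : ℤ) * Θ (fun j => Pi.single (τ j) 1) := by
      have := Θ.map_perm (fun j => Pi.single (τ j) 1) p
      rw [Units.smul_def, zsmul_eq_mul] at this
      exact this
    rw [e4, Equiv.prod_comp p (fun j => x (τ j))] at e
    rw [smul_eq_mul] at e
    rw [mul_left_comm, e]
    refine Finset.sum_congr rfl fun f _ => ?_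
    rw [Finset.prod_mul_distrib, smul_eq_mul]
  have h2 : ∀ f : Fin k → Fin N,
      Matrix.det (Matrix.of fun j i => ((Pi.single (f j) 1 : Fin N → ℝ) - x) (τ i)) =
      ∑ p : Equiv.Perm (Fin k), ((p.sign : ℤ) : ℝ) *
        ∏ j, ((Pi.single (f j) 1 : Fin N → ℝ) - x) (τ (p j)) := by
    intro f
    rw [← Matrix.det_transpose, Matrix.det_apply']
    rfl
  simp only [h2, Finset.mul_sum, Finset.sum_mul]
  rw [Finset.sum_comm]
  -- The Leibniz sign cancels the sign from reordering the arguments of `Θ`, so all `k!`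
  -- permutations contribute equally.
  have h3 : ∀ p : Equiv.Perm (Fin k), ∑ f : Fin k → Fin N, (∏ j, x (f j)) *
        (((p.sign : ℤ) : ℝ) * ∏ j, ((Pi.single (f j) 1 : Fin N → ℝ) - x) (τ (p j))) *
        Θ (fun j => Pi.single (f j) 1) = (∏ j, x (τ j)) * Θ (fun j => Pi.single (τ j) 1) := by
    intro p
    have := congrArg (((p.sign : ℤ) : ℝ) * ·) (h1 p)
    simp only [Finset.mul_sum] at this
    have hs : ((p.sign : ℤ) : ℝ) * ((p.sign : ℤ) : ℝ) = 1 := by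
      rcases Int.units_eq_one_or p.sign with h | h <;> simp [h]
    rw [← mul_assoc ((p.sign : ℤ) : ℝ) ((p.sign : ℤ) : ℝ), hs, one_mul] at this
    rw [← this]
    exact Finset.sum_congr rfl fun f _ => by ring
  rw [Finset.sum_congr rfl fun p _ => h3 p]
  simp [Fintype.card_perm]

/-- Linear dependence of `k + l + 1` vectors in a space of dimension `k + l`, in the form of a
Laplace expansion. -/
lemma sum_alternating_det_append (u : Fin k → Fin (k + (l + 1)) → ℝ)
    (x : Fin (k + (l + 1)) → ℝ) (y : Fin (l + 1) → Fin (k + (l + 1)) → ℝ)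
    (hu : ∀ j, ∑ i, u j i = 0) (hx : ∑ i, x i = 1) (hy : ∀ j, ∑ i, y j i = 1) :
    ∑ i : Fin (l + 1), (-1 : ℝ) ^ (i : ℕ) *
        Matrix.det (Matrix.of (Fin.append u (Fin.cons x fun j => y (i.succAbove j)))) =
      Matrix.det (Matrix.of (Fin.append u y)) := by
  let z : Fin (k + (l + 1) + 1) → Fin (k + (l + 1)) → ℝ :=
    Fin.append (m := k) (n := l + 1 + 1) u (Fin.cons x y : Fin (l + 1 + 1) → Fin (k + (l + 1)) → ℝ)
  -- The prepended column contains the row sums, so `M` annihilates `(1, -1, …, -1)`. Expanding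
  -- along this column, the rows `u` contribute nothing, the row `x` gives the right-hand side, and
  -- the rows `y` give the alternating sum.
  let M : Matrix (Fin (k + (l + 1) + 1)) (Fin (k + (l + 1) + 1)) ℝ :=
    Matrix.of fun r => Fin.cons (∑ i, z r i) (z r)
  have hM : M.det = 0 := by
    rw [← Matrix.exists_mulVec_eq_zero_iff]
    refine ⟨Fin.cons 1 fun _ => -1, fun h => ?_, ?_⟩
    · have := congrFun h 0
      simp at this
    · ext r
      simp [M, Matrix.mulVec, dotProduct, Fin.sum_univ_succ (n := k + (l + 1))]
  rw [Matrix.det_succ_column_zero] at hM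
  have hsum := Fin.sum_univ_add (a := k) (b := l + 1 + 1) (fun i : Fin (k + (l + 1) + 1) =>
    (-1 : ℝ) ^ (i : ℕ) * M i 0 * (M.submatrix i.succAbove Fin.succ).det)
  replace hM := hsum.symm.trans hM
  rw [Fin.sum_univ_succ (n := l + 1)] at hM
  have hA : ∀ i : Fin k, M (Fin.castAdd (l + 1 + 1) i) 0 = 0 := by
    intro i
    simp [M, z, hu]
  have hB : M (Fin.natAdd k (0 : Fin (l + 1 + 1))) 0 = 1 := by
    have : z (Fin.natAdd k (0 : Fin (l + 1 + 1))) = x := by simp [z]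
    simp only [M, Matrix.of_apply, Fin.cons_zero, this, hx]
  have hC : ∀ i : Fin (l + 1), M (Fin.natAdd k i.succ) 0 = 1 := by
    intro i
    have : z (Fin.natAdd k i.succ) = y i := by simp [z]
    simp only [M, Matrix.of_apply, Fin.cons_zero, this, hy]
  have hD : M.submatrix (Fin.succAbove (n := k + (l + 1)) (Fin.natAdd k (0 : Fin (l + 1 + 1)))) Fin.succ =
      Matrix.of (Fin.append u y) := by
    ext r c
    simp only [M, Matrix.submatrix_apply, Matrix.of_apply, Fin.cons_succ]
    refine congrFun ?_ c
    refine Fin.addCases (fun r => ?_) (fun r => ?_) r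
    · have : Fin.succAbove (n := k + (l + 1)) (Fin.natAdd k (0 : Fin (l + 1 + 1))) (Fin.castAdd (l + 1) r) =
          Fin.castAdd (l + 1 + 1) r := by
        rw [Fin.succAbove_of_castSucc_lt]
        · rfl
        · simp [Fin.lt_def]
      rw [this]; simp [z]
    · have : Fin.succAbove (n := k + (l + 1)) (Fin.natAdd k (0 : Fin (l + 1 + 1))) (Fin.natAdd k r) =
          Fin.natAdd k r.succ := by
        rw [Fin.succAbove_of_le_castSucc]
        · rfl
        · simp [Fin.le_def]
      rw [this]; simp [z]
  have hE : ∀ i : Fin (l + 1), M.submatrix (Fin.succAbove (n := k + (l + 1)) (Fin.natAdd k i.succ)) Fin.succ =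
      Matrix.of (Fin.append u (Fin.cons x fun j => y (i.succAbove j))) := by
    intro i
    ext r c
    simp only [M, Matrix.submatrix_apply, Matrix.of_apply, Fin.cons_succ]
    refine congrFun ?_ c
    refine Fin.addCases (fun r => ?_) (fun r => ?_) r
    · have : Fin.succAbove (n := k + (l + 1)) (Fin.natAdd k i.succ) (Fin.castAdd (l + 1) r) =
          Fin.castAdd (l + 1 + 1) r := by
        rw [Fin.succAbove_of_castSucc_lt]
        · rfl
        · simp only [Fin.lt_def, Fin.val_castSucc, Fin.val_castAdd, Fin.val_natAdd, Fin.val_succ]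
          omega
      rw [this]; simp [z]
    · have : Fin.succAbove (n := k + (l + 1)) (Fin.natAdd k i.succ) (Fin.natAdd k r) =
          Fin.natAdd k (i.succ.succAbove r) := by
        ext
        simp only [Fin.succAbove, Fin.lt_def, Fin.val_castSucc, Fin.val_natAdd, Fin.val_succ]
        split_ifs <;> simp <;> omega
      rw [this]
      have : z (Fin.natAdd k (i.succ.succAbove r)) =
          (Fin.cons x y : Fin (l + 1 + 1) → Fin (k + (l + 1)) → ℝ) (i.succ.succAbove r) := by
        simp [z]
      rw [this, Fin.append_right]
      refine Fin.cases ?_ (fun r => ?_) r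
      · simp
      · simp
  simp only [hA, hB, hC, hD, hE, Fin.val_natAdd, Fin.val_zero, Fin.val_succ, mul_zero, zero_mul,
    Finset.sum_const_zero, zero_add, mul_one, add_zero] at hM
  have h5 : ∀ i : Fin (l + 1), (-1 : ℝ) ^ (k + ((i : ℕ) + 1)) *
      Matrix.det (Matrix.of (Fin.append u (Fin.cons x fun j => y (i.succAbove j)))) =
      -((-1 : ℝ) ^ k * ((-1 : ℝ) ^ (i : ℕ) *
      Matrix.det (Matrix.of (Fin.append u (Fin.cons x fun j => y (i.succAbove j)))))) :=
    fun i => by rw [pow_add, pow_succ]; ring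
  rw [Finset.sum_congr rfl fun i _ => h5 i, Finset.sum_neg_distrib, ← Finset.mul_sum,
    ← sub_eq_add_neg, ← mul_sub, mul_eq_zero] at hM
  rcases hM with h | h
  · exact absurd h (pow_ne_zero _ (by norm_num))
  · linarith

end Determinants

/-! ### Whitney forms as determinants, sorting of index sequences -/

section Sorting

variable {n k : ℕ} (T : Affine.Simplex ℝ E n)

lemma wedge_dlam_apply (σ : Fin k → Fin (n + 1)) (w : Fin k → Tangent T) :
    wedge (fun j => dlam T (σ j)) w =
      ((Matrix.det (Matrix.of fun r c => tanCoord T (w r) (σ c)) : ℝ) : ℂ) := rfl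

/-- The definition of the Whitney form is the Laplace expansion of this determinant along the row of
the point. In this shape, sorting, projection to faces and relabelling are row and column
operations. -/
lemma whitney_apply (ρ : Fin (k + 1) → Fin (n + 1)) (x : Body T) (w : Fin k → Tangent T) :
    whitney T ρ x w = ((Matrix.det (Matrix.of fun r c =>
      (Fin.cons (bary T x) (fun j => tanCoord T (w j)) : Fin (k + 1) → Fin (n + 1) → ℝ) r (ρ c)) :
        ℝ) : ℂ) := by
  rw [Matrix.det_succ_row_zero]
  simp only [whitney, alternatingMap_sum_apply, AlternatingMap.smul_apply, dlamWedge, constWedge,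
    wedge_dlam_apply]
  push_cast
  rfl

lemma wedge_dlam_comp_perm (σ : Fin k → Fin (n + 1)) (p : Equiv.Perm (Fin k)) :
    wedge (fun j => dlam T ((σ ∘ p) j)) =
      ((p.sign : ℤ) : ℂ) • wedge (fun j => dlam T (σ j)) := by
  ext w
  rw [AlternatingMap.smul_apply, wedge_dlam_apply, wedge_dlam_apply]
  simp only [Function.comp_apply]
  rw [det_of_comp_perm (fun r => tanCoord T (w r))]
  simp

lemma wedge_dlam_of_not_injective (σ : Fin k → Fin (n + 1)) (hσ : ¬ Function.Injective σ) :
    wedge (fun j => dlam T (σ j)) = 0 := by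
  ext w
  rw [wedge_dlam_apply, det_of_not_injective (fun r => tanCoord T (w r)) _ hσ]
  simp

lemma dlamWedge_comp_perm (σ : Fin k → Fin (n + 1)) (p : Equiv.Perm (Fin k)) :
    dlamWedge T (σ ∘ p) = ((p.sign : ℤ) : ℂ) • dlamWedge T σ := by
  funext x
  exact wedge_dlam_comp_perm T σ p

lemma dlamWedge_of_not_injective (σ : Fin k → Fin (n + 1)) (hσ : ¬ Function.Injective σ) :
    dlamWedge T σ = 0 := by
  funext x
  exact wedge_dlam_of_not_injective T σ hσ

lemma whitney_comp_perm (ρ : Fin (k + 1) → Fin (n + 1)) (p : Equiv.Perm (Fin (k + 1))) :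
    whitney T (ρ ∘ p) = ((p.sign : ℤ) : ℂ) • whitney T ρ := by
  funext x
  ext w
  rw [Pi.smul_apply, AlternatingMap.smul_apply, whitney_apply, whitney_apply]
  simp only [Function.comp_apply]
  rw [det_of_comp_perm]
  simp

lemma whitney_of_not_injective (ρ : Fin (k + 1) → Fin (n + 1)) (hρ : ¬ Function.Injective ρ) :
    whitney T ρ = 0 := by
  funext x
  ext w
  rw [whitney_apply, det_of_not_injective _ _ hρ]
  simp

/-- The wedge product of covectors is multilinear. -/
lemma wedge_sum_smul {M : Type*} [AddCommGroup M] [Module ℝ M] {N : ℕ} (θ : Fin N → M →ₗ[ℝ] ℝ)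
    (p : Fin k → Fin N → ℝ) :
    wedge (fun j => ∑ i, p j i • θ i) =
      ∑ f : Fin k → Fin N, ((∏ j, p j (f j) : ℝ) : ℂ) • wedge (fun j => θ (f j)) := by
  ext w
  rw [alternatingMap_sum_apply, wedge_apply, ← Matrix.det_transpose]
  have e := (Matrix.detRowAlternating (R := ℝ) (n := Fin k)).toMultilinearMap.map_sum
    (fun j (i : Fin N) => p j i • fun r => θ i (w r))
  have e1 : (Matrix.of fun j i => (∑ a, p i a • θ a) (w j)).transpose =
      fun j => ∑ i, p j i • fun r => θ i (w r) := by
    ext j r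
    simp [Finset.sum_apply]
  rw [e1]
  simp only [AlternatingMap.coe_multilinearMap, MultilinearMap.map_smul_univ] at e
  change ((Matrix.detRowAlternating (fun j => ∑ i, p j i • fun r => θ i (w r)) : ℝ) : ℂ) = _
  rw [e]
  push_cast
  refine Finset.sum_congr rfl fun f _ => ?_
  rw [AlternatingMap.smul_apply, wedge_apply, ← Matrix.det_transpose, smul_eq_mul, smul_eq_mul]
  push_cast
  rfl

end Sorting

/-! ### The star operators -/

section Star

variable {k l : ℕ} (T : Affine.Simplex ℝ E (k + l))

/-- The contraction of the determinant with the vertices `f` and a point in the first slots. -/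
def volR (f : Fin k → Fin (k + l + 1)) (x : Hull T) : (Tangent T) [⋀^Fin l]→ₗ[ℝ] ℂ :=
  Complex.ofRealCLM.toLinearMap.compAlternatingMap
    (((detRight (k := k) (l := l + 1) (fun j => Pi.single (f j) (1 : ℝ))).curryLeft
      (bary T x)).compLinearMap (tanCoord T))

/-- The contraction of the determinant with a point and the vertices `g` in the last slots. -/
def volL (g : Fin l → Fin (k + l + 1)) (x : Hull T) : (Tangent T) [⋀^Fin k]→ₗ[ℝ] ℂ :=
  Complex.ofRealCLM.toLinearMap.compAlternatingMap
    ((detLeft (k := k) (l := l + 1) (Fin.cons (bary T x) fun j => Pi.single (g j) (1 : ℝ)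
      )).compLinearMap (tanCoord T))

lemma volR_apply (f : Fin k → Fin (k + l + 1)) (x : Hull T) (w : Fin l → Tangent T) :
    volR T f x w = ((Matrix.det (Matrix.of (Fin.append (n := l + 1)
      (fun j => Pi.single (f j) (1 : ℝ))
      (Fin.cons (bary T x) fun j => tanCoord T (w j)))) : ℝ) : ℂ) := rfl

lemma volL_apply (g : Fin l → Fin (k + l + 1)) (x : Hull T) (u : Fin k → Tangent T) :
    volL T g x u = ((Matrix.det (Matrix.of (Fin.append (n := l + 1)
      (fun j => tanCoord T (u j))
      (Fin.cons (bary T x) fun j => Pi.single (g j) (1 : ℝ)))) : ℝ) : ℂ) := rfl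

/-- The pointwise star operator which underlies the isomorphism `𝓘`. -/
def starA (x : Hull T) : ((Tangent T) [⋀^Fin k]→ₗ[ℝ] ℂ) →ₗ[ℂ] ((Tangent T) [⋀^Fin l]→ₗ[ℝ] ℂ) where
  toFun ω := (k.factorial : ℂ)⁻¹ • ∑ f : Fin k → Fin (k + l + 1),
    (((∏ j, lam T (f j) x : ℝ) : ℂ) * ω (fun j => vertexBasis T (f j) -ᵥ x)) • volR T f x
  map_add' ω η := by
    simp only [AlternatingMap.add_apply, mul_add, add_smul, Finset.sum_add_distrib, smul_add]
  map_smul' c ω := by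
    simp only [AlternatingMap.smul_apply, RingHom.id_apply,
      Finset.smul_sum, smul_smul, smul_eq_mul]
    refine Finset.sum_congr rfl fun f _ => ?_
    congr 1; ring

/-- The pointwise star operator which underlies the inverse of the isomorphism `𝓙`. -/
def starB (x : Hull T) : ((Tangent T) [⋀^Fin l]→ₗ[ℝ] ℂ) →ₗ[ℂ] ((Tangent T) [⋀^Fin k]→ₗ[ℝ] ℂ) where
  toFun ω := (l.factorial : ℂ)⁻¹ • ∑ g : Fin l → Fin (k + l + 1),
    (((∏ j, lam T (g j) x : ℝ) : ℂ) * ω (fun j => vertexBasis T (g j) -ᵥ x)) • volL T g x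
  map_add' ω η := by
    simp only [AlternatingMap.add_apply, mul_add, add_smul, Finset.sum_add_distrib, smul_add]
  map_smul' c ω := by
    simp only [AlternatingMap.smul_apply, RingHom.id_apply,
      Finset.smul_sum, smul_smul, smul_eq_mul]
    refine Finset.sum_congr rfl fun f _ => ?_
    congr 1; ring

lemma starA_apply (x : Hull T) (ω : (Tangent T) [⋀^Fin k]→ₗ[ℝ] ℂ) :
    starA T x ω = (k.factorial : ℂ)⁻¹ • ∑ f : Fin k → Fin (k + l + 1),
      (((∏ j, lam T (f j) x : ℝ) : ℂ) * ω (fun j => vertexBasis T (f j) -ᵥ x)) • volR T f x := rfl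

lemma starB_apply (x : Hull T) (ω : (Tangent T) [⋀^Fin l]→ₗ[ℝ] ℂ) :
    starB T x ω = (l.factorial : ℂ)⁻¹ • ∑ g : Fin l → Fin (k + l + 1),
      (((∏ j, lam T (g j) x : ℝ) : ℂ) * ω (fun j => vertexBasis T (g j) -ᵥ x)) • volL T g x := rfl

lemma wedge_dlam_vertex_vsub {n m : ℕ} (T : Affine.Simplex ℝ E n) (τ f : Fin m → Fin (n + 1))
    (x : Hull T) : wedge (fun j => dlam T (τ j)) (fun j => vertexBasis T (f j) -ᵥ x) =
      ((Matrix.det (Matrix.of fun j i =>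
        ((Pi.single (f j) 1 : Fin (n + 1) → ℝ) - bary T x) (τ i)) : ℝ) : ℂ) := by
  rw [wedge_apply]
  congr 3
  ext j i
  simp [dlam_vsub, lam_vertex, Pi.single_apply]

/-- The determinant with `x` in a fixed slot vanishes when a free argument equals `x`, which is the
condition for `sum_weighted_contract`. The factorial in that identity explains the normalization of
`starA`. -/
lemma starA_wedge (x : Hull T) (τ : Fin k → Fin (k + l + 1)) :
    starA T x (wedge fun j => dlam T (τ j)) = ((∏ j, lam T (τ j) x : ℝ) : ℂ) • volR T τ x := by
  ext w
  have h := sum_weighted_contract (k := k) (bary T x)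
    (detLeft (k := k) (l := l + 1) (Fin.cons (bary T x) fun j => tanCoord T (w j))) (by
      rintro v ⟨i, hi⟩
      rw [detLeft_apply]
      refine Matrix.det_zero_of_row_eq (i := Fin.castAdd (l + 1) i)
        (j := Fin.natAdd k (0 : Fin (l + 1))) ?_ ?_
      · intro e
        have := congrArg Fin.val e
        simp at this
        omega
      · ext c
        simp [hi]) τ
  simp only [starA_apply, AlternatingMap.smul_apply, alternatingMap_sum_apply,
    wedge_dlam_vertex_vsub, volR_apply, smul_eq_mul]
  have hk : (k.factorial : ℂ) ≠ 0 := by exact_mod_cast k.factorial_ne_zero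
  rw [inv_mul_eq_iff_eq_mul₀ hk]
  have h' := congrArg (fun r : ℝ => (r : ℂ)) h
  simp only [detLeft_apply] at h'
  push_cast at h' ⊢
  exact h'

lemma starB_wedge (x : Hull T) (τ : Fin l → Fin (k + l + 1)) :
    starB T x (wedge fun j => dlam T (τ j)) = ((∏ j, lam T (τ j) x : ℝ) : ℂ) • volL T τ x := by
  ext u
  have h := sum_weighted_contract (k := l) (bary T x)
    ((detRight (k := k) (l := l + 1) (fun j => tanCoord T (u j))).curryLeft (bary T x)) (by
      rintro v ⟨i, hi⟩
      rw [AlternatingMap.curryLeft_apply_apply, detRight_apply]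
      refine Matrix.det_zero_of_row_eq (i := Fin.natAdd k (0 : Fin (l + 1)))
        (j := Fin.natAdd k i.succ) ?_ ?_
      · intro e
        have := congrArg Fin.val e
        simp at this
      · ext c
        simp [hi]) τ
  simp only [starB_apply, AlternatingMap.smul_apply, alternatingMap_sum_apply,
    wedge_dlam_vertex_vsub, volL_apply, smul_eq_mul]
  have hk : (l.factorial : ℂ) ≠ 0 := by exact_mod_cast l.factorial_ne_zero
  rw [inv_mul_eq_iff_eq_mul₀ hk]
  have h' := congrArg (fun r : ℝ => (r : ℂ)) h
  simp only [AlternatingMap.curryLeft_apply_apply, detRight_apply] at h'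
  push_cast at h' ⊢
  exact h'

variable {σ : Fin k → Fin (k + l + 1)} {ρ : Fin (l + 1) → Fin (k + l + 1)}

lemma volR_eq_whitney (hσ : Function.Injective σ) (hρ : Function.Injective ρ)
    (h : IsCompl (Set.range σ) (Set.range ρ)) (x : Body T) :
    volR T σ x = seqSign (Fin.append σ ρ) • whitney T ρ x := by
  ext w
  rw [volR_apply, AlternatingMap.smul_apply, whitney_apply]
  exact det_append_single_left hσ hρ h _

lemma starA_dlamWedge (hσ : Function.Injective σ) (hρ : Function.Injective ρ)
    (h : IsCompl (Set.range σ) (Set.range ρ)) (x : Body T) :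
    starA T x (dlamWedge T σ x) =
      (seqSign (Fin.append σ ρ) * lamProd T σ x) • whitney T ρ x := by
  rw [dlamWedge, constWedge, starA_wedge, volR_eq_whitney T hσ hρ h, smul_smul, lamProd, mul_comm]
  push_cast
  rfl

/-- In the summand that omits `ρ i`, the coefficient `λ_{ρ(i)}` completes the weight to the full
product `λ_ρ`. The remaining alternating sum of determinants collapses by
`sum_alternating_det_append`, which removes the point `x`. -/
lemma starB_whitney_apply (ρ : Fin (l + 1) → Fin (k + l + 1)) (x : Body T)
    (u : Fin k → Tangent T) :
    starB T x (whitney T ρ x) u = lamProd T ρ x * ((Matrix.det (Matrix.of (Fin.append (n := l + 1)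
      (fun j => tanCoord T (u j)) (fun j => Pi.single (ρ j) (1 : ℝ)))) : ℝ) : ℂ) := by
  have h := sum_alternating_det_append (k := k) (l := l) (fun j => tanCoord T (u j)) (bary T x)
    (fun j => Pi.single (ρ j) (1 : ℝ)) (fun j => sum_dlam T (u j)) (sum_lam T x) (fun j => by simp)
  rw [← h]
  simp only [whitney, map_sum, map_smul, dlamWedge, constWedge, starB_wedge,
    alternatingMap_sum_apply, AlternatingMap.smul_apply, volL_apply, smul_eq_mul]
  push_cast
  rw [Finset.mul_sum]
  refine Finset.sum_congr rfl fun i _ => ?_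
  have : lamProd T ρ x = (lam T (ρ i) x : ℂ) * ∏ j, (lam T (ρ (i.succAbove j)) x : ℂ) := by
    rw [lamProd, Fin.prod_univ_succAbove _ i]
  rw [this]
  ring

lemma starB_whitney (hσ : Function.Injective σ) (hρ : Function.Injective ρ)
    (h : IsCompl (Set.range σ) (Set.range ρ)) (x : Body T) :
    starB T x (whitney T ρ x) =
      (seqSign (Fin.append σ ρ) * lamProd T ρ x) • dlamWedge T σ x := by
  ext u
  rw [starB_whitney_apply, AlternatingMap.smul_apply, dlamWedge, constWedge, wedge_dlam_apply]
  have := det_append_single_right (k := k) (l := l + 1) hσ hρ h (fun j => tanCoord T (u j))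
  rw [this, smul_eq_mul]
  ring

/-- The star operator of `starA` on differential forms. -/
def starAForm : Form T k →ₗ[ℂ] Form T l where
  toFun ω x := starA T x (ω x)
  map_add' _ _ := by funext x; simp
  map_smul' _ _ := by funext x; simp

/-- The star operator of `starB` on differential forms. -/
def starBForm : Form T l →ₗ[ℂ] Form T k where
  toFun ω x := starB T x (ω x)
  map_add' _ _ := by funext x; simp
  map_smul' _ _ := by funext x; simp

lemma starAForm_smul (h : Body T → ℂ) (ω : Form T k) :
    starAForm T (h • ω) = h • starAForm T ω := by
  funext x
  simp [starAForm]

lemma starBForm_smul (h : Body T → ℂ) (ω : Form T l) :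
    starBForm T (h • ω) = h • starBForm T ω := by
  funext x
  simp [starBForm]

lemma starAForm_dlamWedge (hσ : Function.Injective σ) (hρ : Function.Injective ρ)
    (h : IsCompl (Set.range σ) (Set.range ρ)) :
    starAForm T (dlamWedge T σ) = seqSign (Fin.append σ ρ) • (lamProd T σ • whitney T ρ) := by
  funext x
  change starA T x (dlamWedge T σ x) = _
  rw [starA_dlamWedge T hσ hρ h x, mul_smul]
  rfl

lemma starBForm_whitney (hσ : Function.Injective σ) (hρ : Function.Injective ρ)
    (h : IsCompl (Set.range σ) (Set.range ρ)) :
    starBForm T (whitney T ρ) = seqSign (Fin.append σ ρ) • (lamProd T ρ • dlamWedge T σ) := by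
  funext x
  change starB T x (whitney T ρ x) = _
  rw [starB_whitney T hσ hρ h x, mul_smul]
  rfl

/-- The product of all barycentric coordinates. -/
def bubble {n : ℕ} (T : Affine.Simplex ℝ E n) : Body T → ℂ := fun x => ∏ i, (lam T i x : ℂ)

lemma lamProd_mul_lamProd (hσ : Function.Injective σ) (hρ : Function.Injective ρ)
    (h : IsCompl (Set.range σ) (Set.range ρ)) : lamProd T σ * lamProd T ρ = bubble T := by
  funext x
  have e := (Equiv.ofBijective _ (append_bijective hσ hρ h)).prod_comp (fun i => (lam T i x : ℂ))
  have e2 := Fin.prod_univ_add (a := k) (b := l + 1)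
    (fun i => (lam T (Fin.append σ ρ i) x : ℂ))
  simp only [Fin.append_left, Fin.append_right] at e2
  exact e2.symm.trans e

end Star

/-! ### Finite element spaces -/

section Spaces

variable {n : ℕ} (T : Affine.Simplex ℝ E n)

/-- Relabelled index sequences and those arising from expansions of wedge products need not be
ascending. -/
lemma lamPow_smul_dlamWedge_mem {r k : ℕ} {α : Fin (n + 1) → ℕ} (hα : ∑ i, α i = r)
    (f : Fin k → Fin (n + 1)) : lamPow T α • dlamWedge T f ∈ PForms r k T := by
  refine mem_of_mem_ascending (fun f => lamPow T α • dlamWedge T f) (fun f p => ?_)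
    (fun f hf => ?_) f fun σ _ => Submodule.subset_span ⟨α, σ, hα, rfl⟩
  · rw [dlamWedge_comp_perm, smul_comm]
  · rw [dlamWedge_of_not_injective T f hf, smul_zero]

lemma lamPow_smul_whitney_mem {r k : ℕ} {α : Fin (n + 1) → ℕ} (hα : ∑ i, α i + 1 = r)
    (f : Fin (k + 1) → Fin (n + 1)) : lamPow T α • whitney T f ∈ PMinusForms r k T := by
  refine mem_of_mem_ascending (fun f => lamPow T α • whitney T f) (fun f p => ?_)
    (fun f hf => ?_) f fun σ _ => Submodule.subset_span ⟨α, σ, hα, rfl⟩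
  · rw [whitney_comp_perm, smul_comm]
  · rw [whitney_of_not_injective T f hf, smul_zero]

/-- The multiindex that counts how often each index is attained. -/
def countIndex {N m : ℕ} (σ : Fin m → Fin N) (i : Fin N) : ℕ := ∑ j, if σ j = i then 1 else 0

lemma sum_countIndex {N m : ℕ} (σ : Fin m → Fin N) : ∑ i, countIndex σ i = m := by
  simp only [countIndex]
  rw [Finset.sum_comm]
  simp

lemma countIndex_ne_zero_iff {N m : ℕ} (σ : Fin m → Fin N) (i : Fin N) :
    countIndex σ i ≠ 0 ↔ i ∈ Set.range σ := by
  simp [countIndex]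

lemma countIndex_le_one {N m : ℕ} {σ : Fin m → Fin N} (hσ : Function.Injective σ) (i : Fin N) :
    countIndex σ i ≤ 1 := by
  rw [countIndex, ← Finset.card_filter]
  refine Finset.card_le_one.2 fun a ha b hb => hσ ?_
  simp only [Finset.mem_filter, Finset.mem_univ, true_and] at ha hb
  rw [ha, hb]

lemma lamPow_add (α β : Fin (n + 1) → ℕ) : lamPow T (α + β) = lamPow T α * lamPow T β := by
  funext x
  simp [lamPow, pow_add, Finset.prod_mul_distrib]

lemma lamPow_countIndex {m : ℕ} (σ : Fin m → Fin (n + 1)) :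
    lamPow T (countIndex σ) = lamProd T σ := by
  funext x
  simp only [lamPow, lamProd, countIndex, ← Finset.prod_pow_eq_pow_sum]
  rw [Finset.prod_comm]
  refine Finset.prod_congr rfl fun j _ => ?_
  simp only [pow_ite, pow_one, pow_zero]
  simp

lemma exists_isCompl {N k l : ℕ} (h : k + l = N) (σ : Fin k ↪o Fin N) :
    ∃ ρ : Fin l ↪o Fin N, IsCompl (Set.range σ) (Set.range ρ) := by
  classical
  have hc : (Finset.univ.image σ)ᶜ.card = l := by
    rw [Finset.card_compl, Finset.card_image_of_injective _ σ.injective]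
    simp
    omega
  refine ⟨(Finset.univ.image σ)ᶜ.orderEmbOfFin hc, ?_⟩
  rw [Finset.range_orderEmbOfFin]
  simpa using isCompl_compl

/-! ### Continuity of the coefficients -/

/-- The forms whose coefficients are continuous functions of the barycentric coordinates. -/
def ContForms (k : ℕ) : Submodule ℂ (Form T k) where
  carrier := {η | ∀ w, ∃ g : (Fin (n + 1) → ℝ) → ℂ, Continuous g ∧ ∀ x, η x w = g (bary T x)}
  add_mem' {η θ} hη hθ w := by
    obtain ⟨g, hg, h1⟩ := hη w
    obtain ⟨g', hg', h2⟩ := hθ w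
    exact ⟨g + g', hg.add hg', fun x => by simp [h1, h2]⟩
  zero_mem' w := ⟨0, continuous_zero, fun x => rfl⟩
  smul_mem' c η hη w := by
    obtain ⟨g, hg, h1⟩ := hη w
    exact ⟨c • g, hg.const_smul c, fun x => by simp [h1]⟩

lemma pForms_le_contForms (r k : ℕ) : PForms r k T ≤ ContForms T k := by
  refine Submodule.span_le.2 ?_
  rintro _ ⟨α, σ, -, rfl⟩ w
  refine ⟨fun c => (∏ i, (c i : ℂ) ^ α i) * wedge (fun j => dlam T (σ j)) w, ?_, fun x => rfl⟩
  fun_prop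

lemma pMinusForms_le_contForms (r k : ℕ) : PMinusForms r k T ≤ ContForms T k := by
  refine Submodule.span_le.2 ?_
  rintro _ ⟨α, ρ, -, rfl⟩ w
  refine ⟨fun c => (∏ i, (c i : ℂ) ^ α i) * ∑ i : Fin (k + 1), ((-1 : ℂ) ^ (i : ℕ) *
    (c (ρ i) : ℂ)) * wedge (fun j => dlam T (ρ (i.succAbove j))) w, ?_, fun x => ?_⟩
  · fun_prop
  · simp only [whitney, Pi.smul_apply', AlternatingMap.smul_apply, alternatingMap_sum_apply,
      smul_eq_mul]
    rfl

lemma eq_zero_of_interior {k : ℕ} {η : Form T k} (hη : η ∈ ContForms T k)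
    (h : ∀ x : Body T, (∀ i, 0 < lam T i x) → η x = 0) : η = 0 := by
  funext x
  ext w
  obtain ⟨g, hg, hx⟩ := hη w
  rw [hx]
  -- The segment from `x` to the barycenter is interior for `0 < t < 1`; let `t` tend to `0`.
  let c : ℝ → Fin (n + 1) → ℝ := fun t i => (1 - t) * bary T x i + t * ((n : ℝ) + 1)⁻¹
  have hn : (0 : ℝ) < (n : ℝ) + 1 := by positivity
  have hc : Continuous c := by
    refine continuous_pi fun i => ?_
    fun_prop
  have h1 : ∀ t, ∑ i, c t i = 1 := by
    intro t
    simp only [c, Finset.sum_add_distrib, ← Finset.mul_sum]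
    have : ∑ i, bary T x i = 1 := sum_lam T x
    rw [this]
    simp
    field_simp
    ring
  have h2 : ∀ t ∈ Set.Ioo (0 : ℝ) 1, ∀ i, 0 < c t i := by
    intro t ht i
    have := lam_nonneg T x i
    have h3 : 0 ≤ (1 - t) * bary T x i := mul_nonneg (by linarith [ht.2]) this
    have h4 : 0 < t * ((n : ℝ) + 1)⁻¹ := mul_pos ht.1 (inv_pos.2 hn)
    exact add_pos_of_nonneg_of_pos h3 h4
  have h5 : ∀ t ∈ Set.Ioo (0 : ℝ) 1, g (c t) = 0 := by
    intro t ht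
    have e : bary T (pt T (c t)) = c t := by
      funext i
      exact lam_pt T (h1 t) i
    have := hx ⟨pt T (c t), pt_mem_body T (h1 t) fun i => (h2 t ht i).le⟩
    rw [e, h] at this
    · simpa using this.symm
    · intro i
      change 0 < bary T (pt T (c t)) i
      rw [e]
      exact h2 t ht i
  have h0 : c 0 = bary T x := by
    funext i; simp [c]
  have l1 : Filter.Tendsto (fun t => g (c t)) (nhdsWithin 0 (Set.Ioi 0)) (nhds (g (bary T x))) := by
    rw [← h0]
    exact ((hg.comp hc).tendsto 0).mono_left nhdsWithin_le_nhds
  have l2 : Filter.Tendsto (fun t => g (c t)) (nhdsWithin 0 (Set.Ioi 0)) (nhds 0) := by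
    refine tendsto_const_nhds.congr' ?_
    filter_upwards [Ioo_mem_nhdsGT (zero_lt_one' ℝ)] with t ht
    exact (h5 t ht).symm
  exact tendsto_nhds_unique l1 l2

/-- The product of the coordinates vanishes on the boundary, so only interior values can be
cancelled; continuity supplies the rest. -/
lemma eq_zero_of_bubble_smul_eq_zero {k : ℕ} {η : Form T k} (hη : η ∈ ContForms T k)
    (h : bubble T • η = 0) : η = 0 := by
  refine eq_zero_of_interior T hη fun x hx => ?_
  have := congrFun h x
  rw [Pi.smul_apply'] at this
  refine (smul_eq_zero.1 this).resolve_left ?_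
  exact Finset.prod_ne_zero_iff.2 fun i _ => by exact_mod_cast (hx i).ne'

/-! ### Bases and linear maps -/

lemma IsBasisOf.image_linear {V W : Type*} [AddCommGroup V] [Module ℂ V] [AddCommGroup W]
    [Module ℂ W] {Q : Set V} {U : Submodule ℂ V} (hQ : IsBasisOf Q U) (L : V →ₗ[ℂ] W)
    (hL : ∀ v ∈ U, L v = 0 → v = 0) : IsBasisOf (L '' Q) (U.map L) := by
  constructor
  · have := LinearIndepOn.image (f := L) (s := Q) hQ.1 ?_
    · exact this
    · rw [hQ.2, Submodule.disjoint_def]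
      exact fun v hv hv' => hL v hv hv'
  · rw [Submodule.span_image, hQ.2]

end Spaces

/-! ### The canonical isomorphisms -/

section Isomorphisms

/-- The span of the `λ^α φ_ρ` such that every index occurs in `α` or in `ρ`. -/
def PMinusInt (r k : ℕ) {n : ℕ} (T : Affine.Simplex ℝ E n) : Submodule ℂ (Form T k) :=
  Submodule.span ℂ {ω | ∃ (α : Fin (n + 1) → ℕ) (ρ : Fin (k + 1) ↪o Fin (n + 1)),
    (∑ i, α i) + 1 = r ∧ (∀ i, α i ≠ 0 ∨ i ∈ Set.range ρ) ∧ ω = lamPow T α • whitney T ρ}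

/-- The span of the `λ^α dλ_σ` such that every index occurs in `α` or in `σ`. -/
def PInt (r k : ℕ) {n : ℕ} (T : Affine.Simplex ℝ E n) : Submodule ℂ (Form T k) :=
  Submodule.span ℂ {ω | ∃ (α : Fin (n + 1) → ℕ) (σ : Fin k ↪o Fin (n + 1)),
    ∑ i, α i = r ∧ (∀ i, α i ≠ 0 ∨ i ∈ Set.range σ) ∧ ω = lamPow T α • dlamWedge T σ}

variable {k l : ℕ} (T : Affine.Simplex ℝ E (k + l))

/-- This makes `𝓘` well defined: the prescribed values respect all linear relations among the `λ^α
dλ_σ`, because one linear map produces them. -/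
lemma mem_graphI_iff (r : ℕ) (p : Form T k × Form T l) :
    p ∈ graphI r k l T ↔ p.1 ∈ PForms r k T ∧ p.2 = starAForm T p.1 := by
  have hs : ∀ (α : Fin (k + l + 1) → ℕ) (σ : Fin k ↪o Fin (k + l + 1))
      (σc : Fin (l + 1) ↪o Fin (k + l + 1)), IsCompl (Set.range σ) (Set.range σc) →
      starAForm T (lamPow T α • dlamWedge T σ) =
        seqSign (Fin.append σ σc) • (lamPow T α • lamProd T σ • whitney T σc) := by
    intro α σ σc hc
    rw [starAForm_smul, starAForm_dlamWedge T σ.injective σc.injective hc, smul_comm]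
  constructor
  · intro hp
    have : graphI r k l T ≤ (PForms r k T).comap (LinearMap.fst ℂ _ _) ⊓
        (LinearMap.ker (LinearMap.snd ℂ _ _ - starAForm T ∘ₗ LinearMap.fst ℂ _ _)) := by
      refine Submodule.span_le.2 ?_
      rintro _ ⟨α, σ, σc, hα, hc, rfl⟩
      refine ⟨Submodule.subset_span ⟨α, σ, hα, rfl⟩, ?_⟩
      simp only [SetLike.mem_coe, LinearMap.mem_ker, LinearMap.sub_apply, LinearMap.snd_apply,
        LinearMap.comp_apply, LinearMap.fst_apply]
      rw [hs α σ σc hc, sub_self]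
    obtain ⟨h1, h2⟩ := this hp
    refine ⟨h1, ?_⟩
    simpa [sub_eq_zero] using h2
  · rintro ⟨h1, h2⟩
    have : PForms r k T ≤ (graphI r k l T).comap (LinearMap.prod LinearMap.id (starAForm T)) := by
      refine Submodule.span_le.2 ?_
      rintro _ ⟨α, σ, hα, rfl⟩
      obtain ⟨σc, hc⟩ := exists_isCompl (l := l + 1) rfl σ
      refine Submodule.subset_span ⟨α, σ, σc, hα, hc, ?_⟩
      rw [← hs α σ σc hc]
      rfl
    have h3 : (p.1, starAForm T p.1) ∈ graphI r k l T := this h1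
    rwa [← h2] at h3

/-- The graph of `𝓙` is read from its codomain, since the recursion uses the inverse; `starBForm`
gives `𝓙⁻¹` directly. -/
lemma mem_graphJ_iff (s : ℕ) (p : Form T k × Form T l) :
    p ∈ graphJ s k l T ↔ p.2 ∈ PMinusForms s l T ∧ p.1 = starBForm T p.2 := by
  have hs : ∀ (α : Fin (k + l + 1) → ℕ) (σ : Fin k ↪o Fin (k + l + 1))
      (σc : Fin (l + 1) ↪o Fin (k + l + 1)), IsCompl (Set.range σ) (Set.range σc) →
      starBForm T (seqSign (Fin.append σ σc) • (lamPow T α • whitney T σc)) =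
        lamPow T α • lamProd T σc • dlamWedge T σ := by
    intro α σ σc hc
    rw [map_smul, starBForm_smul, starBForm_whitney T σ.injective σc.injective hc,
      smul_comm (lamPow T α), smul_smul, seqSign_mul_self, one_smul]
  constructor
  · intro hp
    have : graphJ s k l T ≤ (PMinusForms s l T).comap (LinearMap.snd ℂ _ _) ⊓
        (LinearMap.ker (LinearMap.fst ℂ _ _ - starBForm T ∘ₗ LinearMap.snd ℂ _ _)) := by
      refine Submodule.span_le.2 ?_
      rintro _ ⟨α, σ, σc, hα, hc, rfl⟩
      have h0 : lamPow T α • whitney T σc ∈ PMinusForms s l T :=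
        Submodule.subset_span ⟨α, σc, hα, rfl⟩
      refine ⟨Submodule.smul_mem _ _ h0, ?_⟩
      simp only [SetLike.mem_coe, LinearMap.mem_ker, LinearMap.sub_apply, LinearMap.snd_apply,
        LinearMap.comp_apply, LinearMap.fst_apply]
      rw [hs α σ σc hc, sub_self]
    obtain ⟨h1, h2⟩ := this hp
    refine ⟨h1, ?_⟩
    simpa [sub_eq_zero] using h2
  · rintro ⟨h1, h2⟩
    have : PMinusForms s l T ≤
        (graphJ s k l T).comap (LinearMap.prod (starBForm T) LinearMap.id) := by
      refine Submodule.span_le.2 ?_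
      rintro _ ⟨α, σc, hα, rfl⟩
      obtain ⟨σ, hc⟩ := exists_isCompl (l := k) (by omega) σc
      have h3 : (starBForm T (seqSign (Fin.append σ σc) • (lamPow T α • whitney T σc)),
          seqSign (Fin.append σ σc) • (lamPow T α • whitney T σc)) ∈ graphJ s k l T :=
        Submodule.subset_span ⟨α, σ, σc, hα, hc.symm, by rw [hs α σ σc hc.symm]⟩
      -- Multiplying by the sign once more removes it from the second component.
      have h4 := Submodule.smul_mem _ (seqSign (Fin.append σ σc)) h3
      rw [Prod.smul_mk, map_smul, smul_smul, smul_smul, seqSign_mul_self, one_smul, one_smul] at h4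
      exact h4
    have h3 : (starBForm T p.2, p.2) ∈ graphJ s k l T := this h1
    rwa [← h2] at h3

/-- The two signs cancel, and `λ_σ` and `λ_{σᶜ}` multiply to the product of all coordinates. This is
the source of injectivity. -/
lemma starBForm_starAForm {r : ℕ} {ω : Form T k} (hω : ω ∈ PForms r k T) :
    starBForm T (starAForm T ω) = bubble T • ω := by
  induction hω using Submodule.span_induction with
  | mem ω h =>
    obtain ⟨α, σ, -, rfl⟩ := h
    obtain ⟨ρ, hc⟩ := exists_isCompl (l := l + 1) rfl σ
    rw [starAForm_smul, starAForm_dlamWedge T σ.injective ρ.injective hc, starBForm_smul, map_smul,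
      starBForm_smul, starBForm_whitney T σ.injective ρ.injective hc, smul_comm (lamProd T σ),
      smul_smul, seqSign_mul_self, one_smul,
      ← lamProd_mul_lamProd T σ.injective ρ.injective hc]
    funext x
    simp only [Pi.smul_apply', Pi.mul_apply, smul_smul]
    congr 1; ring
  | zero => simp
  | add ω η _ _ h1 h2 => rw [map_add, map_add, h1, h2, smul_add]
  | smul c ω _ h => rw [map_smul, map_smul, h, smul_comm]

lemma starAForm_starBForm {s : ℕ} {η : Form T l} (hη : η ∈ PMinusForms s l T) :
    starAForm T (starBForm T η) = bubble T • η := by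
  induction hη using Submodule.span_induction with
  | mem ω h =>
    obtain ⟨α, ρ, -, rfl⟩ := h
    obtain ⟨σ, hc⟩ := exists_isCompl (l := k) (by omega) ρ
    replace hc := hc.symm
    rw [starBForm_smul, starBForm_whitney T σ.injective ρ.injective hc, starAForm_smul, map_smul,
      starAForm_smul, starAForm_dlamWedge T σ.injective ρ.injective hc, smul_comm (lamProd T ρ),
      smul_smul, seqSign_mul_self, one_smul,
      ← lamProd_mul_lamProd T σ.injective ρ.injective hc]
    funext x
    simp only [Pi.smul_apply', Pi.mul_apply, smul_smul]
    congr 1; ring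
  | zero => simp
  | add ω η _ _ h1 h2 => rw [map_add, map_add, h1, h2, smul_add]
  | smul c ω _ h => rw [map_smul, map_smul, h, smul_comm]

lemma lamPow_smul_lamProd_smul {n m k : ℕ} (T : Affine.Simplex ℝ E n) (α : Fin (n + 1) → ℕ)
    (τ : Fin m → Fin (n + 1)) (ω : Form T k) :
    lamPow T α • lamProd T τ • ω = lamPow T (α + countIndex τ) • ω := by
  rw [lamPow_add, lamPow_countIndex]
  funext x
  simp [smul_smul]

lemma exists_eq_add_countIndex {N m : ℕ} (τ : Fin m ↪o Fin N) (α : Fin N → ℕ)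
    (h : ∀ i ∈ Set.range τ, α i ≠ 0) : ∃ β : Fin N → ℕ, α = β + countIndex τ := by
  refine ⟨fun i => α i - countIndex τ i, funext fun i => ?_⟩
  have : countIndex τ i ≤ α i := by
    by_cases hi : i ∈ Set.range τ
    · exact (countIndex_le_one τ.injective i).trans (Nat.one_le_iff_ne_zero.2 (h i hi))
    · rw [← countIndex_ne_zero_iff, not_not] at hi
      omega
  simp only [Pi.add_apply]
  omega

/-- The factor `λ_σ` contributes exactly the indices missing from `σᶜ`. Conversely, the support
condition allows this factor to be split off from `λ^α`. -/
lemma map_starAForm (r : ℕ) :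
    (PForms r k T).map (starAForm T) = PMinusInt (r + k + 1) l T := by
  apply le_antisymm
  · rw [Submodule.map_le_iff_le_comap]
    refine Submodule.span_le.2 ?_
    rintro _ ⟨α, σ, hα, rfl⟩
    obtain ⟨ρ, hc⟩ := exists_isCompl (l := l + 1) rfl σ
    change starAForm T _ ∈ PMinusInt (r + k + 1) l T
    rw [starAForm_smul, starAForm_dlamWedge T σ.injective ρ.injective hc, smul_comm,
      lamPow_smul_lamProd_smul]
    refine Submodule.smul_mem _ _ (Submodule.subset_span ⟨_, ρ, ?_, fun i => ?_, rfl⟩)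
    · simp only [Pi.add_apply, Finset.sum_add_distrib, hα, sum_countIndex]
    · by_cases hi : i ∈ Set.range σ
      · left
        have := (countIndex_ne_zero_iff σ i).2 hi
        simp only [Pi.add_apply]
        omega
      · right
        rwa [← hc.compl_eq]
  · refine Submodule.span_le.2 ?_
    rintro _ ⟨α, ρ, hα, hs, rfl⟩
    obtain ⟨σ, hc⟩ := exists_isCompl (l := k) (by omega) ρ
    replace hc := hc.symm
    obtain ⟨β, rfl⟩ := exists_eq_add_countIndex σ α fun i hi =>
      (hs i).resolve_right (Set.disjoint_left.1 hc.disjoint hi)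
    refine ⟨seqSign (Fin.append σ ρ) • (lamPow T β • dlamWedge T σ),
      Submodule.smul_mem _ _ (Submodule.subset_span ⟨β, σ, ?_, rfl⟩), ?_⟩
    · simp only [Pi.add_apply, Finset.sum_add_distrib, sum_countIndex] at hα
      omega
    · rw [map_smul, starAForm_smul, starAForm_dlamWedge T σ.injective ρ.injective hc,
        smul_comm (lamPow T β), smul_smul, seqSign_mul_self, one_smul, lamPow_smul_lamProd_smul]

lemma map_starBForm (s : ℕ) :
    (PMinusForms s l T).map (starBForm T) = PInt (s + l) k T := by
  apply le_antisymm
  · rw [Submodule.map_le_iff_le_comap]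
    refine Submodule.span_le.2 ?_
    rintro _ ⟨α, ρ, hα, rfl⟩
    obtain ⟨σ, hc⟩ := exists_isCompl (l := k) (by omega) ρ
    replace hc := hc.symm
    change starBForm T _ ∈ PInt (s + l) k T
    rw [starBForm_smul, starBForm_whitney T σ.injective ρ.injective hc, smul_comm,
      lamPow_smul_lamProd_smul]
    refine Submodule.smul_mem _ _ (Submodule.subset_span ⟨_, σ, ?_, fun i => ?_, rfl⟩)
    · simp only [Pi.add_apply, Finset.sum_add_distrib, sum_countIndex]
      omega
    · by_cases hi : i ∈ Set.range σ
      · exact Or.inr hi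
      · left
        rw [← Set.mem_compl_iff, hc.compl_eq] at hi
        have := (countIndex_ne_zero_iff ρ i).2 hi
        simp only [Pi.add_apply]
        omega
  · refine Submodule.span_le.2 ?_
    rintro _ ⟨α, σ, hα, hs, rfl⟩
    obtain ⟨ρ, hc⟩ := exists_isCompl (l := l + 1) rfl σ
    obtain ⟨β, rfl⟩ := exists_eq_add_countIndex ρ α fun i hi =>
      (hs i).resolve_right (Set.disjoint_right.1 hc.disjoint hi)
    refine ⟨seqSign (Fin.append σ ρ) • (lamPow T β • whitney T ρ),
      Submodule.smul_mem _ _ (Submodule.subset_span ⟨β, ρ, ?_, rfl⟩), ?_⟩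
    · simp only [Pi.add_apply, Finset.sum_add_distrib, sum_countIndex] at hα
      omega
    · rw [map_smul, starBForm_smul, starBForm_whitney T σ.injective ρ.injective hc,
        smul_comm (lamPow T β), smul_smul, seqSign_mul_self, one_smul, lamPow_smul_lamProd_smul]

lemma image_graphI {r : ℕ} {Q : Set (Form T k)} (hQ : Q ⊆ PForms r k T) :
    image (graphI r k l T) Q = starAForm T '' Q := by
  ext η
  constructor
  · rintro ⟨ω, hω, h⟩
    exact ⟨ω, hω, ((mem_graphI_iff T r _).1 h).2.symm⟩
  · rintro ⟨ω, hω, rfl⟩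
    exact ⟨ω, hω, (mem_graphI_iff T r _).2 ⟨hQ hω, rfl⟩⟩

lemma preimage_graphJ {s : ℕ} {Q : Set (Form T l)} (hQ : Q ⊆ PMinusForms s l T) :
    preimage (graphJ s k l T) Q = starBForm T '' Q := by
  ext η
  constructor
  · rintro ⟨ω, hω, h⟩
    exact ⟨ω, hω, ((mem_graphJ_iff T s _).1 h).2.symm⟩
  · rintro ⟨ω, hω, rfl⟩
    exact ⟨ω, hω, (mem_graphJ_iff T s _).2 ⟨hQ hω, rfl⟩⟩

lemma IsBasisOf.subset {V : Type*} [AddCommGroup V] [Module ℂ V] {Q : Set V}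
    {U : Submodule ℂ V} (hQ : IsBasisOf Q U) : Q ⊆ U := by
  rw [← hQ.2]; exact Submodule.subset_span

lemma isBasisOf_image_graphI {r : ℕ} {Q : Set (Form T k)} (hQ : IsBasisOf Q (PForms r k T)) :
    IsBasisOf (image (graphI r k l T) Q) (PMinusInt (r + k + 1) l T) := by
  rw [image_graphI T hQ.subset, ← map_starAForm]
  refine hQ.image_linear _ fun ω hω h0 => ?_
  refine eq_zero_of_bubble_smul_eq_zero T (pForms_le_contForms T r k hω) ?_
  rw [← starBForm_starAForm T hω, h0, map_zero]

lemma isBasisOf_preimage_graphJ {s : ℕ} {Q : Set (Form T l)}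
    (hQ : IsBasisOf Q (PMinusForms s l T)) :
    IsBasisOf (preimage (graphJ s k l T) Q) (PInt (s + l) k T) := by
  rw [preimage_graphJ T hQ.subset, ← map_starBForm]
  refine hQ.image_linear _ fun ω hω h0 => ?_
  refine eq_zero_of_bubble_smul_eq_zero T (pMinusForms_le_contForms T s l hω) ?_
  rw [← starAForm_starBForm T hω, h0, map_zero]

end Isomorphisms

/-! ### Extension operators -/

section Extension

lemma wedge_comp_perm {M : Type*} [AddCommGroup M] [Module ℝ M] {k : ℕ} (g : Fin k → M →ₗ[ℝ] ℝ)
    (p : Equiv.Perm (Fin k)) :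
    wedge (fun j => g (p j)) = ((p.sign : ℤ) : ℂ) • wedge g := by
  ext w
  rw [AlternatingMap.smul_apply, wedge_apply, wedge_apply]
  have := Matrix.det_permute' p (Matrix.of fun j i => g i (w j))
  change ((((Matrix.of fun j i => g i (w j)).submatrix id p).det : ℝ) : ℂ) = _
  rw [this]
  simp

lemma wedge_eq_zero_of_eq {M : Type*} [AddCommGroup M] [Module ℝ M] {k : ℕ}
    (g : Fin k → M →ₗ[ℝ] ℝ) {i j : Fin k} (hij : i ≠ j) (h : g i = g j) : wedge g = 0 := by
  ext w
  rw [wedge_apply, Matrix.det_zero_of_column_eq hij]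
  · simp
  · intro r; simp [h]

variable {n m : ℕ} (T : Affine.Simplex ℝ E n) (ι : Fin (m + 1) ↪o Fin (n + 1))

lemma sum_extend {f : Fin (m + 1) → Fin (n + 1)} (hf : Function.Injective f)
    (α : Fin (m + 1) → ℕ) : ∑ i, Function.extend f α 0 i = ∑ j, α j := by
  rw [← Finset.sum_subset (Finset.subset_univ (Finset.univ.image f)),
    Finset.sum_image fun a _ b _ h => hf h]
  · simp [hf.extend_apply]
  · intro j _ hj
    rw [Function.extend_apply' _ _ _ (by simpa using hj)]
    rfl

lemma lamPow_extend {f : Fin (m + 1) → Fin (n + 1)} (hf : Function.Injective f)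
    (α : Fin (m + 1) → ℕ) (x : Body T) :
    lamPow T (Function.extend f α 0) x = ∏ j, (lam T (f j) x : ℂ) ^ α j := by
  rw [lamPow, ← Finset.prod_subset (Finset.subset_univ (Finset.univ.image f)),
    Finset.prod_image fun a _ b _ h => hf h]
  · simp [hf.extend_apply]
  · intro j _ hj
    rw [Function.extend_apply' _ _ _ (by simpa using hj)]
    simp

lemma mem_graphExtMinus {r k : ℕ} {α : Fin (m + 1) → ℕ} (hα : ∑ i, α i + 1 = r)
    (f : Fin (k + 1) → Fin (m + 1)) :
    (lamPow (face T ι) α • whitney (face T ι) f,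
      lamPow T (Function.extend ι α 0) • whitney T (ι ∘ f)) ∈ graphExtMinus r k T ι := by
  refine mem_of_mem_ascending (fun f => (lamPow (face T ι) α • whitney (face T ι) f,
      lamPow T (Function.extend ι α 0) • whitney T (ι ∘ f))) (fun f p => ?_) (fun f hf => ?_) f
      fun ρ _ => Submodule.subset_span ⟨α, ρ, hα, rfl⟩
  · rw [whitney_comp_perm, ← Function.comp_assoc, whitney_comp_perm, smul_comm, Prod.smul_mk,
      smul_comm (lamPow T _)]
  · rw [whitney_of_not_injective _ f hf,
      whitney_of_not_injective _ (ι ∘ f) (fun h => hf h.of_comp)]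
    simp

lemma mem_graphExt {r k : ℕ} {α : Fin (m + 1) → ℕ} (hα : ∑ i, α i = r)
    (f : Fin k → Fin (m + 1)) :
    (lamPow (face T ι) α • dlamWedge (face T ι) f,
      lamPow T (Function.extend ι α 0) •
        constWedge T fun j => Psi T ι (Function.extend ι α 0) (ι (f j))) ∈ graphExt r k T ι := by
  refine mem_of_mem_ascending (fun f => (lamPow (face T ι) α • dlamWedge (face T ι) f,
      lamPow T (Function.extend ι α 0) •
        constWedge T fun j => Psi T ι (Function.extend ι α 0) (ι (f j)))) (fun f p => ?_)
      (fun f hf => ?_) f fun ρ _ => Submodule.subset_span ⟨α, ρ, hα, rfl⟩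
  · have : (constWedge T fun j => Psi T ι (Function.extend ι α 0) (ι ((f ∘ p) j))) =
        ((p.sign : ℤ) : ℂ) • constWedge T fun j => Psi T ι (Function.extend ι α 0) (ι (f j)) := by
      funext x
      exact wedge_comp_perm (fun j => Psi T ι (Function.extend ι α 0) (ι (f j))) p
    rw [dlamWedge_comp_perm, this, smul_comm, Prod.smul_mk, smul_comm (lamPow T _)]
  · have : (constWedge T fun j => Psi T ι (Function.extend ι α 0) (ι (f j))) = 0 := by
      rw [Function.not_injective_iff] at hf
      obtain ⟨i, j, hij, hne⟩ := hf
      funext x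
      exact wedge_eq_zero_of_eq _ hne (by rw [hij])
    rw [dlamWedge_of_not_injective _ f hf, this]
    simp

lemma pull_of_mem_graphExtMinus {r k : ℕ} {p : Form (face T ι) k × Form T k}
    (hp : p ∈ graphExtMinus r k T ι) : pull (face T ι) T ι k p.2 = p.1 := by
  have : graphExtMinus r k T ι ≤ LinearMap.ker
      (pull (face T ι) T ι k ∘ₗ LinearMap.snd ℂ _ _ - LinearMap.fst ℂ _ _) := by
    refine Submodule.span_le.2 ?_
    rintro _ ⟨α, ρ, hα, rfl⟩
    have h := pull_whitney (face T ι) T (f := ι) ι.injective ρ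
    simp only [SetLike.mem_coe, LinearMap.mem_ker, LinearMap.sub_apply, LinearMap.comp_apply,
      LinearMap.snd_apply, LinearMap.fst_apply]
    rw [pull_smul, lamPow_comp_bodyMap _ _ ι.injective, sub_eq_zero]
    exact congrArg _ h
  simpa [sub_eq_zero] using this hp

/-- The correction term in `Ψ` is a multiple of the sum of all `dλ_j` of the face, which vanishes on
the face. -/
lemma Psi_comp_tanMap (β : Fin (n + 1) → ℕ) (j : Fin (m + 1)) :
    Psi T ι β (ι j) ∘ₗ tanMap (face T ι) T ι = dlam (face T ι) j := by
  have h1 := dlam_comp_tanMap (face T ι) T (f := ι) ι.injective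
  have : (∑ j, dlam T (ι j)) ∘ₗ tanMap (face T ι) T ι = 0 := by
    have h2 : ∀ j w, dlam T (ι j) (tanMap (face T ι) T ι w) = dlam (face T ι) j w :=
      fun j w => LinearMap.congr_fun (h1 j) w
    ext w
    simpa [h2] using sum_dlam (face T ι) w
  rw [Psi, LinearMap.sub_comp, LinearMap.smul_comp, this, h1, smul_zero, sub_zero]

lemma pull_of_mem_graphExt {r k : ℕ} {p : Form (face T ι) k × Form T k}
    (hp : p ∈ graphExt r k T ι) : pull (face T ι) T ι k p.2 = p.1 := by
  have : graphExt r k T ι ≤ LinearMap.ker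
      (pull (face T ι) T ι k ∘ₗ LinearMap.snd ℂ _ _ - LinearMap.fst ℂ _ _) := by
    refine Submodule.span_le.2 ?_
    rintro _ ⟨α, σ, hα, rfl⟩
    simp only [SetLike.mem_coe, LinearMap.mem_ker, LinearMap.sub_apply, LinearMap.comp_apply,
      LinearMap.snd_apply, LinearMap.fst_apply]
    rw [pull_smul, lamPow_comp_bodyMap _ _ ι.injective, sub_eq_zero, pull_constWedge]
    simp only [Psi_comp_tanMap]
    rfl
  simpa [sub_eq_zero] using this hp

/-! #### The extension operator on trimmed spaces is single-valued -/

lemma sum_face_pos {x : Body T} (hx : ∀ i, 0 < lam T i x) : 0 < ∑ j, lam T (ι j) x :=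
  Finset.sum_pos (fun _ _ => hx _) Finset.univ_nonempty

/-- The central projection of an interior point to a face. -/
def projFace (x : Body T) (hx : ∀ i, 0 < lam T i x) : Body (face T ι) :=
  ⟨pt (face T ι) fun j => lam T (ι j) x / ∑ j, lam T (ι j) x, pt_mem_body _
    (by rw [← Finset.sum_div]; exact div_self (sum_face_pos T ι hx).ne')
    fun j => (div_pos (hx _) (sum_face_pos T ι hx)).le⟩

lemma lam_projFace (x : Body T) (hx : ∀ i, 0 < lam T i x) (j : Fin (m + 1)) :
    lam (face T ι) j (projFace T ι x hx) = lam T (ι j) x / ∑ j, lam T (ι j) x :=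
  lam_pt _ (by rw [← Finset.sum_div]; exact div_self (sum_face_pos T ι hx).ne') j

/-- The rescaled derivative of the central projection to a face. -/
def projTan (x : Body T) : Tangent T →ₗ[ℝ] Tangent (face T ι) :=
  vec (face T ι) ∘ₗ LinearMap.pi fun j =>
    dlam T (ι j) - (lam T (ι j) x / ∑ j, lam T (ι j) x) • ∑ i, dlam T (ι i)

lemma dlam_projTan (x : Body T) (hx : ∀ i, 0 < lam T i x) (w : Tangent T) (j : Fin (m + 1)) :
    dlam (face T ι) j (projTan T ι x w) =
      dlam T (ι j) w - (lam T (ι j) x / ∑ j, lam T (ι j) x) * ∑ i, dlam T (ι i) w := by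
  rw [projTan, LinearMap.comp_apply, dlam_vec]
  · simp
  · simp only [LinearMap.pi_apply, LinearMap.sub_apply, LinearMap.smul_apply, smul_eq_mul,
      Finset.sum_sub_distrib, ← Finset.sum_mul, ← Finset.sum_div]
    rw [div_self (sum_face_pos T ι hx).ne']
    simp

/-- In the determinant of `whitney_apply`, `projTan` alters the tangent rows only by multiples of
the point row, which changes nothing. The point row is divided by the sum of the face coordinates,
which accounts for the scalar. -/
lemma whitney_face {k : ℕ} (ρ : Fin (k + 1) → Fin (m + 1)) (x : Body T)
    (hx : ∀ i, 0 < lam T i x) :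
    whitney T (ι ∘ ρ) x = ((∑ j, lam T (ι j) x : ℝ) : ℂ) •
      (whitney (face T ι) ρ (projFace T ι x hx)).compLinearMap (projTan T ι x) := by
  ext w
  rw [AlternatingMap.smul_apply, AlternatingMap.compLinearMap_apply, whitney_apply, whitney_apply,
    smul_eq_mul, ← Complex.ofReal_mul]
  congr 1
  set t := ∑ j, lam T (ι j) x with ht
  have ht0 : t ≠ 0 := (sum_face_pos T ι hx).ne'
  let A : Matrix (Fin (k + 1)) (Fin (k + 1)) ℝ := Matrix.of fun r c =>
    (Fin.cons (fun j => lam T (ι j) x / t) (fun r j => dlam T (ι j) (w r)) :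
      Fin (k + 1) → Fin (m + 1) → ℝ) r (ρ c)
  have h1 : Matrix.det (Matrix.of fun r c =>
      (Fin.cons (bary (face T ι) (projFace T ι x hx))
        (fun j => tanCoord (face T ι) (projTan T ι x (w j))) :
          Fin (k + 1) → Fin (m + 1) → ℝ) r (ρ c)) = A.det := by
    refine Matrix.det_eq_of_forall_row_eq_smul_add_const
      (Fin.cons 0 fun r => -∑ i, dlam T (ι i) (w r)) 0 (by simp) fun r c => ?_
    refine Fin.cases ?_ (fun r => ?_) r
    · simp [A, lam_projFace, ht]
    · simp only [Matrix.of_apply, Fin.cons_succ, tanCoord_apply, dlam_projTan T ι x hx, A,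
        Fin.cons_zero, ht]
      ring
  have h2 := Matrix.det_mul_column (Fin.cons t fun _ => 1) A
  rw [Fin.prod_univ_succ] at h2
  simp only [Fin.cons_zero, Fin.cons_succ, Finset.prod_const_one, mul_one] at h2
  rw [h1, ← h2]
  congr 1
  ext r c
  refine Fin.cases ?_ (fun r => ?_) r
  · simp [A]
    field_simp
  · simp [A]

lemma lamPow_face (α : Fin (m + 1) → ℕ) (x : Body T) (hx : ∀ i, 0 < lam T i x) :
    lamPow T (Function.extend ι α 0) x = ((∑ j, lam T (ι j) x : ℝ) : ℂ) ^ (∑ j, α j) *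
      lamPow (face T ι) α (projFace T ι x hx) := by
  have ht0 : ((∑ j, lam T (ι j) x : ℝ) : ℂ) ≠ 0 := by
    exact_mod_cast (sum_face_pos T ι hx).ne'
  rw [lamPow_extend T ι.injective, lamPow, ← Finset.prod_pow_eq_pow_sum, ← Finset.prod_mul_distrib]
  refine Finset.prod_congr rfl fun j _ => ?_
  rw [lam_projFace, ← mul_pow, Complex.ofReal_div, mul_div_cancel₀ _ ht0]

/-- The monomial contributes the power `r - 1` of the sum of the face coordinates and the Whitney
form one more. Since the right-hand side involves only `p.1`, the extension is single-valued at
interior points. -/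
lemma apply_of_mem_graphExtMinus {r k : ℕ} {p : Form (face T ι) k × Form T k}
    (hp : p ∈ graphExtMinus r k T ι) (x : Body T) (hx : ∀ i, 0 < lam T i x) :
    p.2 x = ((∑ j, lam T (ι j) x : ℝ) : ℂ) ^ r •
      (p.1 (projFace T ι x hx)).compLinearMap (projTan T ι x) := by
  induction hp using Submodule.span_induction with
  | mem p h =>
    obtain ⟨α, ρ, hα, rfl⟩ := h
    simp only [Pi.smul_apply']
    have h := whitney_face T ι ρ x hx
    rw [lamPow_face T ι α x hx]
    change _ • whitney T (ι ∘ ρ) x = _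
    rw [h, ← hα]
    ext w
    simp only [AlternatingMap.smul_apply, AlternatingMap.compLinearMap_apply, smul_eq_mul]
    ring
  | zero => ext w; simp
  | add p q _ _ h1 h2 =>
    ext w
    simp [h1, h2]
  | smul c p _ h =>
    ext w
    simp only [Prod.smul_snd, Prod.smul_fst, Pi.smul_apply, h, AlternatingMap.smul_apply,
      AlternatingMap.compLinearMap_apply]
    exact smul_comm _ _ _

lemma snd_mem_of_mem_graphExtMinus {r k : ℕ} {p : Form (face T ι) k × Form T k}
    (hp : p ∈ graphExtMinus r k T ι) : p.2 ∈ PMinusForms r k T := by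
  have : graphExtMinus r k T ι ≤ (PMinusForms r k T).comap (LinearMap.snd ℂ _ _) := by
    refine Submodule.span_le.2 ?_
    rintro _ ⟨α, ρ, hα, rfl⟩
    refine lamPow_smul_whitney_mem T ?_ _
    rwa [sum_extend ι.injective]
  exact this hp

lemma eq_zero_of_mem_graphExtMinus {r k : ℕ} {η : Form T k}
    (h : (0, η) ∈ graphExtMinus r k T ι) : η = 0 := by
  refine eq_zero_of_interior T
    (pMinusForms_le_contForms T r k (snd_mem_of_mem_graphExtMinus T ι h)) fun x hx => ?_
  refine (apply_of_mem_graphExtMinus T ι h x hx).trans ?_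
  ext w
  simp

/-! #### The extension operator on full spaces is single-valued -/

/-- The coordinates satisfy `∑ λ_i = 1`, so independence needs a common degree. By homogeneity a
relation on the simplex holds on the positive orthant, a product of infinite sets, where a
polynomial that vanishes is zero. -/
lemma coeff_eq_zero_of_sum_lamPow {k r : ℕ} {n : ℕ} (T : Affine.Simplex ℝ E n)
    (a : (Fin (n + 1) → ℕ) → (Tangent T) [⋀^Fin k]→ₗ[ℝ] ℂ)
    (h : ∀ x : Body T, ∑ α ∈ Finset.univ.piAntidiag r, lamPow T α x • a α = 0)
    (α : Fin (n + 1) → ℕ) (hα : ∑ i, α i = r) : a α = 0 := by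
  ext w
  let S : Finset (Fin (n + 1) → ℕ) := Finset.univ.piAntidiag r
  let e : (Fin (n + 1) → ℕ) → (Fin (n + 1) →₀ ℕ) := fun β => Finsupp.equivFunOnFinite.symm β
  let P : MvPolynomial (Fin (n + 1)) ℂ := ∑ β ∈ S, MvPolynomial.monomial (e β) (a β w)
  have hP : P = 0 := by
    refine MvPolynomial.funext_set (fun _ => (fun t : ℝ => (t : ℂ)) '' Set.Ioi 0)
      (fun _ => (Set.Ioi_infinite 0).image Complex.ofReal_injective.injOn) fun z hz => ?_
    choose y hy hyz using fun i => hz i trivial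
    have hs : 0 < ∑ i, y i := Finset.sum_pos (fun i _ => hy i) Finset.univ_nonempty
    have h1 : ∑ i, y i / ∑ i, y i = 1 := by
      rw [← Finset.sum_div]; exact div_self hs.ne'
    have h2 := congrArg (fun A => A w)
      (h ⟨pt T fun i => y i / ∑ i, y i, pt_mem_body T h1 fun i => (div_pos (hy i) hs).le⟩)
    simp only [alternatingMap_sum_apply, AlternatingMap.smul_apply, AlternatingMap.zero_apply,
      lamPow, lam_pt T h1, smul_eq_mul] at h2
    have hs' : ((∑ i, y i : ℝ) : ℂ) ≠ 0 := by exact_mod_cast hs.ne'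
    rw [map_zero]
    simp only [P, map_sum, MvPolynomial.eval_monomial]
    have h3 := congrArg (((∑ i, y i : ℝ) : ℂ) ^ r * ·) h2
    simp only [mul_zero, Finset.mul_sum] at h3
    rw [← h3]
    refine Finset.sum_congr rfl fun β hβ => ?_
    have hβ' : ∑ i, β i = r := by
      have := hβ
      simp only [Finset.mem_piAntidiag] at this
      exact this.1
    rw [Finsupp.prod_fintype _ _ (by simp), ← hβ', ← Finset.prod_pow_eq_pow_sum, ← mul_assoc,
      ← Finset.prod_mul_distrib, mul_comm]
    congr 1
    refine Finset.prod_congr rfl fun i _ => ?_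
    rw [← mul_pow, Complex.ofReal_div, mul_div_cancel₀ _ hs', ← hyz]
    rfl
  have hc := congrArg (MvPolynomial.coeff (e α)) hP
  simp only [P, MvPolynomial.coeff_sum, MvPolynomial.coeff_monomial, MvPolynomial.coeff_zero] at hc
  rw [Finset.sum_eq_single α] at hc
  · simpa using hc
  · intro β _ hβ
    rw [if_neg]
    exact fun h => hβ (Finsupp.equivFunOnFinite.symm.injective h)
  · intro hα'
    exact absurd (by simp [S, hα]) hα'

/-- The linear map of tangent spaces that induces `Ψ`. -/
def psiTan (α : Fin (m + 1) → ℕ) : Tangent T →ₗ[ℝ] Tangent (face T ι) :=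
  vec (face T ι) ∘ₗ LinearMap.pi fun j => Psi T ι (Function.extend ι α 0) (ι j)

/-- The weights `α_j / |α|` sum to one, so the `Ψ` over the face sum to zero and define a tangent
vector of the face. This fails for `|α| = 0`. -/
lemma dlam_comp_psiTan {α : Fin (m + 1) → ℕ} (hα : ∑ i, α i ≠ 0) (j : Fin (m + 1)) :
    dlam (face T ι) j ∘ₗ psiTan T ι α = Psi T ι (Function.extend ι α 0) (ι j) := by
  ext w
  rw [psiTan, LinearMap.comp_apply, LinearMap.comp_apply, dlam_vec]
  · rfl
  · have h0 : ((∑ i, α i : ℕ) : ℝ) ≠ 0 := by exact_mod_cast hα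
    simp only [LinearMap.pi_apply, Psi, LinearMap.sub_apply, LinearMap.smul_apply, smul_eq_mul,
      Finset.sum_sub_distrib, ← Finset.sum_mul, ← Finset.sum_div, sum_extend ι.injective,
      ι.injective.extend_apply, ← Nat.cast_sum]
    rw [div_self h0]
    simp

/-- As `Ψ` depends on `α`, no single tangent map induces the extension. Each coefficient of `λ^α` is
instead pulled back along its own map, and uniqueness of the coefficients then gives
single-valuedness. -/
lemma exists_coeff_of_mem_graphExt {r k : ℕ} (hr : r ≠ 0) {p : Form (face T ι) k × Form T k}
    (hp : p ∈ graphExt r k T ι) :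
    ∃ a : (Fin (m + 1) → ℕ) → (Tangent (face T ι)) [⋀^Fin k]→ₗ[ℝ] ℂ,
      (∀ x, p.1 x = ∑ α ∈ Finset.univ.piAntidiag r, lamPow (face T ι) α x • a α) ∧
      ∀ x, p.2 x = ∑ α ∈ Finset.univ.piAntidiag r, lamPow T (Function.extend ι α 0) x •
        (a α).compLinearMap (psiTan T ι α) := by
  induction hp using Submodule.span_induction with
  | mem p h =>
    classical
    obtain ⟨α, σ, hα, rfl⟩ := h
    have hm : α ∈ Finset.univ.piAntidiag r := by simp [hα]
    refine ⟨Pi.single α (wedge fun j => dlam (face T ι) (σ j)), fun x => ?_, fun x => ?_⟩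
    · rw [Finset.sum_eq_single_of_mem α hm]
      · simp; rfl
      · intro β _ hβ
        simp [hβ]
    · rw [Finset.sum_eq_single_of_mem α hm]
      · simp only [Pi.smul_apply', Pi.single_eq_same, wedge_compLinearMap,
          dlam_comp_psiTan T ι (hα.trans_ne hr)]
        rfl
      · intro β _ hβ
        ext w
        simp [hβ]
  | zero => exact ⟨0, fun x => by simp, fun x => by ext w; simp⟩
  | add p q _ _ h1 h2 =>
    obtain ⟨a, ha, ha'⟩ := h1
    obtain ⟨b, hb, hb'⟩ := h2
    refine ⟨a + b, fun x => ?_, fun x => ?_⟩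
    · simp only [Prod.fst_add, Pi.add_apply, ha, hb, smul_add, Finset.sum_add_distrib]
    · ext w
      simp only [Prod.snd_add, Pi.add_apply, ha', hb', AlternatingMap.add_apply,
        alternatingMap_sum_apply, AlternatingMap.smul_apply, AlternatingMap.compLinearMap_apply,
        smul_add, Finset.sum_add_distrib]
  | smul c p _ h =>
    obtain ⟨a, ha, ha'⟩ := h
    refine ⟨c • a, fun x => ?_, fun x => ?_⟩
    · simp only [Prod.smul_fst, Pi.smul_apply, ha, Finset.smul_sum, smul_comm c]
    · ext w
      simp only [Prod.smul_snd, Pi.smul_apply, ha', AlternatingMap.smul_apply,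
        alternatingMap_sum_apply, AlternatingMap.compLinearMap_apply, Finset.smul_sum, smul_comm c]

lemma eq_zero_of_mem_graphExt {r k : ℕ} (hr : r ≠ 0) {η : Form T k}
    (h : (0, η) ∈ graphExt r k T ι) : η = 0 := by
  obtain ⟨a, h1, h2⟩ := exists_coeff_of_mem_graphExt T ι hr h
  have ha := coeff_eq_zero_of_sum_lamPow (face T ι) a fun x => (h1 x).symm
  funext x
  refine (h2 x).trans (Finset.sum_eq_zero fun α hα => ?_)
  rw [ha α (by simpa using hα)]
  ext w
  simp

/-! #### Traces of extensions -/

/-- Extensions from a face of forms with vanishing trace have vanishing trace on all faces that do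
not contain that face. -/
lemma exists_extMinus {r k : ℕ} {ω : Form (face T ι) k} (hω : ω ∈ PMinusInt r k (face T ι)) :
    ∃ η ∈ PMinusForms r k T, (ω, η) ∈ graphExtMinus r k T ι ∧
      ∀ (m' : ℕ) (ι' : Fin (m' + 1) ↪o Fin (n + 1)), ¬ Set.range ι ⊆ Set.range ι' →
        pull (face T ι') T ι' k η = 0 := by
  induction hω using Submodule.span_induction with
  | mem ω h =>
    obtain ⟨α, ρ, hα, hs, rfl⟩ := h
    have hg := mem_graphExtMinus T ι hα ρ
    refine ⟨_, snd_mem_of_mem_graphExtMinus T ι hg, hg, fun m' ι' h => ?_⟩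
    obtain ⟨_, ⟨j, rfl⟩, hj⟩ := Set.not_subset.1 h
    rw [pull_smul]
    -- A vertex missing from the other face kills the monomial or the Whitney form, according to
    -- where it occurs.
    rcases hs j with h0 | ⟨i, rfl⟩
    · rw [lamPow_comp_bodyMap_eq_zero _ _ _ _ hj (by rwa [ι.injective.extend_apply]), zero_smul]
    · rw [pull_whitney_eq_zero _ _ _ i hj, smul_zero]
  | zero => exact ⟨0, zero_mem _, zero_mem _, fun m' ι' _ => map_zero _⟩
  | add p q _ _ h1 h2 =>
    obtain ⟨a, ha, ha', ha2⟩ := h1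
    obtain ⟨b, hb, hb', hb2⟩ := h2
    exact ⟨a + b, add_mem ha hb, add_mem ha' hb', fun m' ι' h => by
      rw [map_add, ha2 m' ι' h, hb2 m' ι' h, add_zero]⟩
  | smul c p _ h =>
    obtain ⟨a, ha, ha', ha2⟩ := h
    exact ⟨c • a, Submodule.smul_mem _ _ ha, Submodule.smul_mem _ c ha', fun m' ι' h => by
      rw [map_smul, ha2 m' ι' h, smul_zero]⟩

/-- The expansion of `Ψ` in the differentials of the barycentric coordinates, without those of the
face which do not belong to the leading term. -/
lemma Psi_eq_sum (β : Fin (n + 1) → ℕ) (i : Fin (n + 1)) :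
    Psi T ι β i = ∑ a, ((if a = i then 1 else 0) +
      if a ∈ Finset.univ.image ι then 0 else (β i : ℝ) / ((∑ j, β j : ℕ) : ℝ)) • dlam T a := by
  have h1 := sum_dlam_eq_zero T
  rw [← Finset.sum_add_sum_compl (Finset.univ.image ι),
    Finset.sum_image fun a _ b _ h => ι.injective h] at h1
  have h2 : ∑ j, dlam T (ι j) = -∑ a ∈ (Finset.univ.image ι)ᶜ, dlam T a :=
    eq_neg_of_add_eq_zero_left h1
  simp only [add_smul, Finset.sum_add_distrib, ite_smul, one_smul, zero_smul]
  rw [Psi, h2, smul_neg, sub_neg_eq_add, Finset.smul_sum, Finset.sum_ite_eq' Finset.univ i,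
    if_pos (Finset.mem_univ i)]
  congr 1
  generalize (β i : ℝ) / ((∑ j, β j : ℕ) : ℝ) = c
  have h3 : ∑ a ∈ Finset.univ.image ι, (if a ∈ Finset.univ.image ι then 0 else c • dlam T a) = 0 :=
    Finset.sum_eq_zero fun a ha => if_pos ha
  rw [← Finset.sum_add_sum_compl (Finset.univ.image ι) fun a =>
    if a ∈ Finset.univ.image ι then 0 else c • dlam T a, h3, zero_add]
  exact Finset.sum_congr rfl fun a ha => (if_neg (Finset.mem_compl.1 ha)).symm

lemma constWedge_Psi {k : ℕ} (β : Fin (n + 1) → ℕ) (f : Fin k → Fin (n + 1)) :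
    (constWedge T fun j => Psi T ι β (f j)) = ∑ g : Fin k → Fin (n + 1),
      ((∏ j, ((if g j = f j then 1 else 0) + if g j ∈ Finset.univ.image ι then 0 else
        (β (f j) : ℝ) / ((∑ j, β j : ℕ) : ℝ)) : ℝ) : ℂ) • dlamWedge T g := by
  funext x
  simp only [constWedge, Psi_eq_sum, wedge_sum_smul, Finset.sum_apply, Pi.smul_apply, dlamWedge]

lemma snd_mem_of_mem_graphExt {r k : ℕ} {p : Form (face T ι) k × Form T k}
    (hp : p ∈ graphExt r k T ι) : p.2 ∈ PForms r k T := by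
  have : graphExt r k T ι ≤ (PForms r k T).comap (LinearMap.snd ℂ _ _) := by
    refine Submodule.span_le.2 ?_
    rintro _ ⟨α, ρ, hα, rfl⟩
    change lamPow T _ • constWedge T _ ∈ PForms r k T
    rw [constWedge_Psi, Finset.smul_sum]
    refine Submodule.sum_mem _ fun g _ => ?_
    rw [smul_comm]
    refine Submodule.smul_mem _ _ (lamPow_smul_dlamWedge_mem T ?_ _)
    rwa [sum_extend ι.injective]
  exact this hp

/-- Let `j` be a vertex missing from the other face. If `α j ≠ 0`, the monomial vanishes there. If
`α j = 0`, then `j` occurs in `σ` and its `Ψ` has no correction term, so it is `dλ_j` and vanishes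
too. -/
lemma exists_ext {r k : ℕ} {ω : Form (face T ι) k} (hω : ω ∈ PInt r k (face T ι)) :
    ∃ η ∈ PForms r k T, (ω, η) ∈ graphExt r k T ι ∧
      ∀ (m' : ℕ) (ι' : Fin (m' + 1) ↪o Fin (n + 1)), ¬ Set.range ι ⊆ Set.range ι' →
        pull (face T ι') T ι' k η = 0 := by
  induction hω using Submodule.span_induction with
  | mem ω h =>
    obtain ⟨α, σ, hα, hs, rfl⟩ := h
    have hg := mem_graphExt T ι hα σ
    refine ⟨_, snd_mem_of_mem_graphExt T ι hg, hg, fun m' ι' h => ?_⟩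
    obtain ⟨_, ⟨j, rfl⟩, hj⟩ := Set.not_subset.1 h
    rw [pull_smul]
    by_cases h0 : α j = 0
    · obtain ⟨i, rfl⟩ := (hs j).resolve_left (not_not.2 h0)
      rw [pull_constWedge_eq_zero _ _ _ i, smul_zero]
      rw [Psi, ι.injective.extend_apply, h0]
      simp only [CharP.cast_eq_zero, zero_div, zero_smul, sub_zero]
      exact dlam_comp_tanMap_of_notMem _ _ hj
    · rw [lamPow_comp_bodyMap_eq_zero _ _ _ _ hj (by rwa [ι.injective.extend_apply]), zero_smul]
  | zero => exact ⟨0, zero_mem _, zero_mem _, fun m' ι' _ => map_zero _⟩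
  | add p q _ _ h1 h2 =>
    obtain ⟨a, ha, ha', ha2⟩ := h1
    obtain ⟨b, hb, hb', hb2⟩ := h2
    exact ⟨a + b, add_mem ha hb, add_mem ha' hb', fun m' ι' h => by
      rw [map_add, ha2 m' ι' h, hb2 m' ι' h, add_zero]⟩
  | smul c p _ h =>
    obtain ⟨a, ha, ha', ha2⟩ := h
    exact ⟨c • a, Submodule.smul_mem _ _ ha, Submodule.smul_mem _ c ha', fun m' ι' h => by
      rw [map_smul, ha2 m' ι' h, smul_zero]⟩

end Extension

/-! ### Geometric decomposition -/

section Decomposition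

/-- Apply `L i` to a vanishing sum: components with smaller `d` vanish by induction, all others
except the `i`-th are killed, and `L i` is injective on `W i`. -/
lemma iSupIndep_of_triangular {I V : Type*} [AddCommGroup V] [Module ℂ V] {V' : I → Type*}
    [∀ i, AddCommGroup (V' i)] [∀ i, Module ℂ (V' i)] (d : I → ℕ) (W : I → Submodule ℂ V)
    (L : ∀ i, V →ₗ[ℂ] V' i) (hinj : ∀ i, ∀ v ∈ W i, L i v = 0 → v = 0)
    (hzero : ∀ i j, j ≠ i → d i ≤ d j → ∀ v ∈ W j, L i v = 0) : iSupIndep W := by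
  classical
  refine iSupIndep_of_dfinsupp_lsum_injective W ?_
  refine (injective_iff_map_eq_zero (DFinsupp.lsum ℕ fun i => (W i).subtype)).2 fun f hf => ?_
  have hf' : ∑ j ∈ f.support, (f j : V) = 0 := by
    rw [DFinsupp.lsum_apply_apply, DFinsupp.sumAddHom_apply] at hf
    exact hf
  have key : ∀ N, ∀ i, d i = N → (f i : V) = 0 := by
    intro N
    induction N using Nat.strong_induction_on with
    | _ N ih =>
      intro i hi
      refine hinj i _ (f i).2 ?_
      have h := congrArg (L i) hf'
      rw [map_sum, map_zero] at h
      by_cases hs : i ∈ f.support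
      · rwa [Finset.sum_eq_single_of_mem i hs] at h
        intro j _ hj
        by_cases hd : d j < d i
        · rw [ih (d j) (hi ▸ hd) j rfl, map_zero]
        · exact hzero i j hj (not_lt.1 hd) _ (f j).2
      · rw [DFinsupp.notMem_support_iff.1 hs]
        simp
  ext i
  simpa using key _ i rfl

variable {n k : ℕ} (T : Affine.Simplex ℝ E n)

/-- A family of bases on the faces yields a basis of the direct sum of the extensions. -/
lemma isBasisOf_iUnion_image
    (D : ∀ (m : ℕ) (ι : Fin (m + 1) ↪o Fin (n + 1)), Submodule ℂ (Form (face T ι) k × Form T k))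
    (V : ∀ (m : ℕ) (ι : Fin (m + 1) ↪o Fin (n + 1)), Submodule ℂ (Form (face T ι) k))
    (Q : ∀ (m : ℕ) (ι : Fin (m + 1) ↪o Fin (n + 1)), Set (Form (face T ι) k))
    (U : Submodule ℂ (Form T k)) (hQ : ∀ m ι, IsBasisOf (Q m ι) (V m ι))
    (hD : ∀ m ι η, (0, η) ∈ D m ι → η = 0)
    (htr : ∀ m ι, ∀ p ∈ D m ι, pull (face T ι) T ι k p.2 = p.1)
    (hext : ∀ m ι, ∀ ω ∈ V m ι, ∃ η ∈ U, (ω, η) ∈ D m ι ∧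
      ∀ (m' : ℕ) (ι' : Fin (m' + 1) ↪o Fin (n + 1)), ¬ Set.range ι ⊆ Set.range ι' →
        pull (face T ι') T ι' k η = 0)
    (hspan : U ≤ Submodule.span ℂ (⋃ (m : ℕ) (ι : Fin (m + 1) ↪o Fin (n + 1)),
      image (D m ι) (V m ι : Set (Form (face T ι) k)))) :
    IsBasisOf (⋃ (m : ℕ) (ι : Fin (m + 1) ↪o Fin (n + 1)), image (D m ι) (Q m ι)) U := by
  have huniq : ∀ m ι ω η η', (ω, η) ∈ D m ι → (ω, η') ∈ D m ι → η = η' := by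
    intro m ι ω η η' h h'
    have := (D m ι).sub_mem h h'
    rw [Prod.mk_sub_mk, sub_self] at this
    exact sub_eq_zero.1 (hD m ι _ this)
  let I := Σ m : ℕ, Fin (m + 1) ↪o Fin (n + 1)
  let W : I → Submodule ℂ (Form T k) := fun i =>
    ((D i.1 i.2) ⊓ (V i.1 i.2).comap (LinearMap.fst ℂ _ _)).map (LinearMap.snd ℂ _ _)
  have hW : ∀ i : I, ∀ η ∈ W i, ∃ ω ∈ V i.1 i.2, (ω, η) ∈ D i.1 i.2 := by
    rintro i _ ⟨⟨ω, η⟩, ⟨h1, h2⟩, rfl⟩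
    exact ⟨ω, h2, h1⟩
  have hXW : ∀ i : I, image (D i.1 i.2) (Q i.1 i.2) ⊆ W i := by
    rintro i η ⟨ω, hω, h⟩
    exact ⟨(ω, η), ⟨h, (hQ i.1 i.2).subset hω⟩, rfl⟩
  have hind : iSupIndep W := by
    refine iSupIndep_of_triangular (V' := fun i : I => Form (face T i.2) k) (fun i => i.1) W
      (fun i => pull (face T i.2) T i.2 k) (fun i η hη h0 => ?_) (fun i j hij hd η hη => ?_)
    · obtain ⟨ω, -, h⟩ := hW i η hη
      have := htr i.1 i.2 _ h
      rw [h0] at this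
      change 0 = ω at this
      subst this
      exact hD i.1 i.2 _ h
    · obtain ⟨ω, hω, h⟩ := hW j η hη
      obtain ⟨η', -, h', hz⟩ := hext j.1 j.2 ω hω
      obtain rfl := huniq _ _ _ _ _ h h'
      -- A face contained in another one of no larger dimension is equal to it.
      refine hz i.1 i.2 fun hsub => hij ?_
      obtain ⟨m, ι⟩ := i
      obtain ⟨m', ι'⟩ := j
      have h1 : (Finset.univ.image ι') ⊆ Finset.univ.image ι := by
        intro a ha
        have : a ∈ Set.range ι' := by simpa using ha
        simpa using hsub this
      have h2 := Finset.card_le_card h1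
      rw [Finset.card_image_of_injective _ ι.injective,
        Finset.card_image_of_injective _ ι'.injective] at h2
      simp only [Finset.card_univ, Fintype.card_fin] at h2
      obtain rfl : m = m' := by simp only at hd; omega
      have h3 := Finset.eq_of_subset_of_card_le h1 (by
        rw [Finset.card_image_of_injective _ ι.injective,
          Finset.card_image_of_injective _ ι'.injective])
      have : ι' = ι := by
        apply OrderEmbedding.range_inj.1
        have := congrArg (fun s : Finset (Fin (n + 1)) => (s : Set (Fin (n + 1)))) h3
        simpa using this
      rw [this]
  constructor
  · have e : (⋃ (m : ℕ) (ι : Fin (m + 1) ↪o Fin (n + 1)), image (D m ι) (Q m ι)) =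
        ⋃ i : I, image (D i.1 i.2) (Q i.1 i.2) := by
      rw [Set.iUnion_sigma]
    rw [e]
    refine linearIndepOn_id_iUnion_finite (fun i => ?_) fun i t _ hi => ?_
    · have hmem : ∀ η : image (D i.1 i.2) (Q i.1 i.2),
          pull (face T i.2) T i.2 k η ∈ Q i.1 i.2 ∧
            (pull (face T i.2) T i.2 k η, (η : Form T k)) ∈ D i.1 i.2 := by
        rintro ⟨η, ω, hω, h⟩
        have := htr i.1 i.2 _ h
        change pull (face T i.2) T i.2 k η = ω at this
        simp only [this]
        exact ⟨hω, h⟩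
      -- The trace recovers the original basis elements, so independence lifts from the face.
      refine LinearIndependent.of_comp (pull (face T i.2) T i.2 k) ?_
      refine LinearIndependent.comp (hQ i.1 i.2).1
        (fun η : image (D i.1 i.2) (Q i.1 i.2) => (⟨_, (hmem η).1⟩ : Q i.1 i.2)) ?_
      intro η η' h
      have h' := congrArg Subtype.val h
      have h1 := (hmem η).2
      have h2 := (hmem η').2
      simp only at h'
      rw [← h'] at h2
      exact Subtype.ext (huniq _ _ _ _ _ h1 h2)
    · refine (hind.disjoint_biSup hi).mono (Submodule.span_le.2 (hXW i)) ?_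
      exact iSup₂_mono fun j _ => Submodule.span_le.2 (hXW j)
  · apply le_antisymm
    · refine Submodule.span_le.2 ?_
      intro η hη
      simp only [Set.mem_iUnion] at hη
      obtain ⟨m, ι, ω, hω, h⟩ := hη
      obtain ⟨η', hU, h', -⟩ := hext m ι ω ((hQ m ι).subset hω)
      rwa [huniq _ _ _ _ _ h h']
    · refine hspan.trans (Submodule.span_le.2 ?_)
      intro η hη
      simp only [Set.mem_iUnion] at hη
      obtain ⟨m, ι, ω, hω, h⟩ := hη
      -- Extending a linear expansion of `ω` in `Q` gives some extension in the span; by uniqueness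
      -- it is the given one.
      have hex : ∃ η' ∈ Submodule.span ℂ (image (D m ι) (Q m ι)), (ω, η') ∈ D m ι := by
        have hω' : ω ∈ Submodule.span ℂ (Q m ι) := by rw [(hQ m ι).2]; exact hω
        clear h hω
        induction hω' using Submodule.span_induction with
        | mem ω hω =>
          obtain ⟨η', -, h', -⟩ := hext m ι ω ((hQ m ι).subset hω)
          exact ⟨η', Submodule.subset_span ⟨ω, hω, h'⟩, h'⟩
        | zero => exact ⟨0, zero_mem _, zero_mem _⟩
        | add ω ω' _ _ h1 h2 =>
          obtain ⟨a, ha, ha'⟩ := h1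
          obtain ⟨b, hb, hb'⟩ := h2
          exact ⟨a + b, add_mem ha hb, add_mem ha' hb'⟩
        | smul c ω _ h1 =>
          obtain ⟨a, ha, ha'⟩ := h1
          exact ⟨c • a, Submodule.smul_mem _ _ ha, Submodule.smul_mem _ c ha'⟩
      obtain ⟨η', h1, h2⟩ := hex
      rw [huniq _ _ _ _ _ h h2]
      refine Submodule.span_mono ?_ h1
      exact Set.subset_iUnion₂ (s := fun (m : ℕ) (ι : Fin (m + 1) ↪o Fin (n + 1)) =>
        image (D m ι) (Q m ι)) m ι

/-! #### Spanning -/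

lemma exists_face {s : Finset (Fin (n + 1))} (hs : s.Nonempty) :
    ∃ (m : ℕ) (ι : Fin (m + 1) ↪o Fin (n + 1)), Set.range ι = s := by
  have hc : s.card = (s.card - 1) + 1 := (Nat.succ_pred_eq_of_pos hs.card_pos).symm
  exact ⟨s.card - 1, s.orderEmbOfFin hc, s.range_orderEmbOfFin hc⟩

lemma exists_lift {k m N : ℕ} (ι : Fin m ↪o Fin N) (f : Fin k → Fin N)
    (h : ∀ j, f j ∈ Set.range ι) : ∃ g : Fin k → Fin m, ∀ j, ι (g j) = f j :=
  ⟨fun j => (h j).choose, fun j => (h j).choose_spec⟩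

lemma extend_comp_eq {m N : ℕ} (ι : Fin m ↪o Fin N) (α : Fin N → ℕ)
    (h : ∀ i, α i ≠ 0 → i ∈ Set.range ι) : Function.extend ι (α ∘ ι) 0 = α := by
  funext i
  by_cases hi : i ∈ Set.range ι
  · obtain ⟨j, rfl⟩ := hi
    rw [ι.injective.extend_apply]; rfl
  · rw [Function.extend_apply' _ _ _ (by simpa using hi)]
    by_contra h0
    exact hi (h i (Ne.symm h0))

lemma lamPow_smul_whitney_mem_int {r : ℕ} {α : Fin (n + 1) → ℕ} (hα : ∑ i, α i + 1 = r)
    (f : Fin (k + 1) → Fin (n + 1)) (hs : ∀ i, α i ≠ 0 ∨ i ∈ Set.range f) :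
    lamPow T α • whitney T f ∈ PMinusInt r k T := by
  refine mem_of_mem_ascending (fun f => lamPow T α • whitney T f) (fun f p => ?_)
    (fun f hf => ?_) f fun σ h => Submodule.subset_span ⟨α, σ, hα, by rwa [h], rfl⟩
  · rw [whitney_comp_perm, smul_comm]
  · rw [whitney_of_not_injective T f hf, smul_zero]

lemma lamPow_smul_dlamWedge_mem_int {r : ℕ} {α : Fin (n + 1) → ℕ} (hα : ∑ i, α i = r)
    (f : Fin k → Fin (n + 1)) (hs : ∀ i, α i ≠ 0 ∨ i ∈ Set.range f) :
    lamPow T α • dlamWedge T f ∈ PInt r k T := by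
  refine mem_of_mem_ascending (fun f => lamPow T α • dlamWedge T f) (fun f p => ?_)
    (fun f hf => ?_) f fun σ h => Submodule.subset_span ⟨α, σ, hα, by rwa [h], rfl⟩
  · rw [dlamWedge_comp_perm, smul_comm]
  · rw [dlamWedge_of_not_injective T f hf, smul_zero]

/-- Each generator `λ^α φ_ρ` is already an extension, from the face whose vertices occur in `α` or
`ρ`. -/
lemma pMinusForms_le_span (r : ℕ) : PMinusForms r k T ≤ Submodule.span ℂ
    (⋃ (m : ℕ) (ι : Fin (m + 1) ↪o Fin (n + 1)), image (graphExtMinus r k T ι)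
      (PMinusInt r k (face T ι) : Set (Form (face T ι) k))) := by
  classical
  refine Submodule.span_le.2 ?_
  rintro _ ⟨α, ρ, hα, rfl⟩
  have hne : (Finset.univ.filter fun i => α i ≠ 0 ∨ i ∈ Set.range ρ).Nonempty :=
    ⟨ρ 0, by simp⟩
  obtain ⟨m, ι, hι⟩ := exists_face hne
  have hι' : ∀ i, i ∈ Set.range ι ↔ α i ≠ 0 ∨ i ∈ Set.range ρ := fun i => by
    rw [hι]; simp
  obtain ⟨g, hg⟩ := exists_lift ι ρ fun j => (hι' _).2 (Or.inr ⟨j, rfl⟩)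
  have he := extend_comp_eq ι α fun i hi => (hι' i).2 (Or.inl hi)
  have hα' : ∑ i, (α ∘ ι) i + 1 = r := by rw [← sum_extend ι.injective, he, hα]
  refine Submodule.subset_span ?_
  simp only [Set.mem_iUnion]
  refine ⟨m, ι, lamPow (face T ι) (α ∘ ι) • whitney (face T ι) g, ?_, ?_⟩
  · refine lamPow_smul_whitney_mem_int _ hα' g fun i => ?_
    rcases (hι' (ι i)).1 ⟨i, rfl⟩ with h | ⟨j, hj⟩
    · exact Or.inl h
    · exact Or.inr ⟨j, ι.injective ((hg j).trans hj)⟩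
  · have := mem_graphExtMinus T ι hα' g
    have hρ : (ι ∘ g) = ρ := funext hg
    rwa [he, hρ] at this

/-- Extending from the support face replaces `dλ_f` by a product of `Ψ`. Its expansion is `dλ_f`
plus terms of strictly larger support with the same `α`, so induction runs on the number of vertices
outside the support. -/
lemma pForms_le_span {r : ℕ} (hr : r ≠ 0) : PForms r k T ≤ Submodule.span ℂ
    (⋃ (m : ℕ) (ι : Fin (m + 1) ↪o Fin (n + 1)), image (graphExt r k T ι)
      (PInt r k (face T ι) : Set (Form (face T ι) k))) := by
  classical
  set Y := Submodule.span ℂ (⋃ (m : ℕ) (ι : Fin (m + 1) ↪o Fin (n + 1)), image (graphExt r k T ι)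
      (PInt r k (face T ι) : Set (Form (face T ι) k))) with hY
  let supp : (Fin (n + 1) → ℕ) → (Fin k → Fin (n + 1)) → Finset (Fin (n + 1)) :=
    fun α f => Finset.univ.filter fun i => α i ≠ 0 ∨ i ∈ Set.range f
  have key : ∀ N, ∀ (α : Fin (n + 1) → ℕ) (f : Fin k → Fin (n + 1)), ∑ i, α i = r →
      n + 1 - (supp α f).card = N → lamPow T α • dlamWedge T f ∈ Y := by
    intro N
    induction N using Nat.strong_induction_on with
    | _ N ih =>
    intro α f hα hN
    have hne : (supp α f).Nonempty := by
      have : ∑ i, α i ≠ 0 := hα.trans_ne hr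
      obtain ⟨i, -, hi⟩ := Finset.exists_ne_zero_of_sum_ne_zero this
      exact ⟨i, by simp [supp, hi]⟩
    obtain ⟨m, ι, hι⟩ := exists_face hne
    have hι' : ∀ i, i ∈ Set.range ι ↔ α i ≠ 0 ∨ i ∈ Set.range f := fun i => by
      rw [hι]; simp [supp]
    have hι2 : ∀ i, i ∈ Finset.univ.image ι ↔ α i ≠ 0 ∨ i ∈ Set.range f := fun i => by
      rw [← hι']; simp
    obtain ⟨g, hg⟩ := exists_lift ι f fun j => (hι' _).2 (Or.inr ⟨j, rfl⟩)
    have he := extend_comp_eq ι α fun i hi => (hι' i).2 (Or.inl hi)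
    have hα' : ∑ i, (α ∘ ι) i = r := by rw [← sum_extend ι.injective, he, hα]
    have h1 : lamPow T α • (constWedge T fun j => Psi T ι α (f j)) ∈ Y := by
      refine Submodule.subset_span ?_
      simp only [Set.mem_iUnion]
      refine ⟨m, ι, lamPow (face T ι) (α ∘ ι) • dlamWedge (face T ι) g, ?_, ?_⟩
      · refine lamPow_smul_dlamWedge_mem_int _ hα' g fun i => ?_
        rcases (hι' (ι i)).1 ⟨i, rfl⟩ with h | ⟨j, hj⟩
        · exact Or.inl h
        · exact Or.inr ⟨j, ι.injective ((hg j).trans hj)⟩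
      · have := mem_graphExt T ι hα' g
        simp only [he, hg] at this
        exact this
    rw [constWedge_Psi, ← Finset.add_sum_erase _ _ (Finset.mem_univ f), smul_add] at h1
    -- The leading term has coefficient one, as every `f j` lies in the support face.
    have h2 : (∏ j, ((if f j = f j then 1 else 0) + if f j ∈ Finset.univ.image ι then 0 else
        (α (f j) : ℝ) / ((∑ j, α j : ℕ) : ℝ)) : ℝ) = 1 := by
      refine Finset.prod_eq_one fun j _ => ?_
      rw [if_pos rfl, if_pos ((hι2 _).2 (Or.inr ⟨j, rfl⟩)), add_zero]
    rw [h2, Complex.ofReal_one, one_smul] at h1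
    refine (Submodule.add_mem_iff_left _ ?_).1 h1
    rw [Finset.smul_sum]
    refine Submodule.sum_mem _ fun f' hf' => ?_
    rw [smul_comm]
    by_cases h0 : (∏ j, ((if f' j = f j then 1 else 0) + if f' j ∈ Finset.univ.image ι then 0 else
        (α (f j) : ℝ) / ((∑ j, α j : ℕ) : ℝ)) : ℝ) = 0
    · rw [h0, Complex.ofReal_zero, zero_smul]
      exact zero_mem _
    · refine Submodule.smul_mem _ _ (ih _ ?_ α f' hα rfl)
      replace h0 := Finset.prod_ne_zero_iff.1 h0
      -- A surviving term may change an index only to a vertex outside the face, and only if `α`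
      -- charges the old index. So the support keeps the old vertices and gains a new one.
      have h3 : ∀ j, f' j ≠ f j → f' j ∉ Finset.univ.image ι ∧ α (f j) ≠ 0 := by
        intro j hj
        have := h0 j (Finset.mem_univ j)
        rw [if_neg hj, zero_add] at this
        by_cases hm : f' j ∈ Finset.univ.image ι
        · rw [if_pos hm] at this; exact absurd rfl this
        · rw [if_neg hm] at this
          refine ⟨hm, fun h => this ?_⟩
          rw [h]; simp
      obtain ⟨j, hj⟩ : ∃ j, f' j ≠ f j := by
        by_contra! H
        exact (Finset.mem_erase.1 hf').1 (funext H)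
      have hsub : supp α f ⊂ supp α f' := by
        rw [Finset.ssubset_iff_of_subset]
        · refine ⟨f' j, by simp [supp], ?_⟩
          have := (h3 j hj).1
          rw [hι2] at this
          simpa [supp] using this
        · intro i hi
          simp only [supp, Finset.mem_filter, Finset.mem_univ, true_and] at hi ⊢
          rcases hi with h | ⟨a, rfl⟩
          · exact Or.inl h
          · by_cases ha : f' a = f a
            · exact Or.inr ⟨a, ha⟩
            · exact Or.inl (h3 a ha).2
      have hlt := Finset.card_lt_card hsub
      have hle := Finset.card_le_univ (supp α f')
      rw [Fintype.card_fin] at hle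
      omega
  refine Submodule.span_le.2 ?_
  rintro _ ⟨α, σ, hα, rfl⟩
  exact key _ α σ hα rfl

end Decomposition

/-! ### The recursively constructed sets are bases -/

section Recursion

lemma isBasisOf_empty {V : Type*} [AddCommGroup V] [Module ℂ V] :
    IsBasisOf (∅ : Set V) (⊥ : Submodule ℂ V) :=
  ⟨linearIndepOn_empty _ _, Submodule.span_empty⟩

/-- The `dλ_i` sum to zero. This covers form degree `n + 1`, where `PInt` has formal generators
although no complementary sequence exists. -/
lemma dlamWedge_eq_zero_of_card {n : ℕ} (T : Affine.Simplex ℝ E n)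
    (σ : Fin (n + 1) ↪o Fin (n + 1)) : dlamWedge T σ = 0 := by
  funext x
  ext w
  rw [dlamWedge, constWedge, wedge_dlam_apply]
  have : Matrix.det (Matrix.of fun r c => tanCoord T (w r) (σ c)) = 0 := by
    rw [← Matrix.exists_mulVec_eq_zero_iff]
    refine ⟨fun _ => 1, fun h => ?_, ?_⟩
    · simpa using congrFun h 0
    · ext r
      simp only [Matrix.mulVec, dotProduct, Matrix.of_apply, mul_one, Pi.zero_apply]
      have hb : Function.Bijective σ := Finite.injective_iff_bijective.1 σ.injective
      rw [hb.sum_comp (fun i => tanCoord T (w r) i)]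
      exact sum_dlam T (w r)
  rw [this]
  simp

variable (B : ∀ (n k : ℕ) (T : Affine.Simplex ℝ E n), Set (Form T k))

lemma basisPMinus0_eq {k l : ℕ} (s : ℕ) (T : Affine.Simplex ℝ E (l + k)) :
    basisPMinus0 B (s + l + 1) (l + k) k T = image (graphI s l k T) (basisP B s (l + k) l T) := by
  rw [basisPMinus0]
  ext η
  simp only [Set.mem_iUnion]
  constructor
  · rintro ⟨l', s', hl, hs, h⟩
    obtain rfl : l' = l := by omega
    obtain rfl : s' = s := by omega
    exact h
  · exact fun h => ⟨l, s, add_comm _ _, rfl, h⟩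

lemma basisP0_eq {k l : ℕ} (s : ℕ) (T : Affine.Simplex ℝ E (k + l)) :
    basisP0 B (s + l) (k + l) k T = preimage (graphJ s k l T) (basisPMinus B s (k + l) l T) := by
  rw [basisP0]
  ext η
  simp only [Set.mem_iUnion]
  constructor
  · rintro ⟨l', s', hl, hs, h⟩
    obtain rfl : l' = l := by omega
    obtain rfl : s' = s := by omega
    exact h
  · exact fun h => ⟨l, s, rfl, rfl, h⟩

lemma basisPMinus0_eq_empty {r n k : ℕ} (T : Affine.Simplex ℝ E n)
    (h : ¬ ∃ l s, k + l = n ∧ s + l + 1 = r) : basisPMinus0 B r n k T = ∅ := by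
  rw [basisPMinus0, Set.eq_empty_iff_forall_notMem]
  intro η hη
  simp only [Set.mem_iUnion] at hη
  obtain ⟨l, s, hl, hs, -⟩ := hη
  exact h ⟨l, s, hl, hs⟩

lemma basisP0_eq_empty {r n k : ℕ} (T : Affine.Simplex ℝ E n)
    (h : ¬ ∃ l s, k + l = n ∧ s + l = r) : basisP0 B r n k T = ∅ := by
  rw [basisP0, Set.eq_empty_iff_forall_notMem]
  intro η hη
  simp only [Set.mem_iUnion] at hη
  obtain ⟨l, s, hl, hs, -⟩ := hη
  exact h ⟨l, s, hl, hs⟩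

/-- The `n - k` indices outside `ρ` must all occur in `α`, so below that degree there are no
generators, matching the empty set in the recursion. -/
lemma pMinusInt_eq_bot {r n k : ℕ} (T : Affine.Simplex ℝ E n)
    (h : ¬ ∃ l s, k + l = n ∧ s + l + 1 = r) : PMinusInt r k T = ⊥ := by
  rw [PMinusInt, Submodule.span_eq_bot]
  rintro _ ⟨α, ρ, hα, hs, rfl⟩
  exfalso
  have hk : k + 1 ≤ n + 1 := by simpa using Fintype.card_le_of_embedding ρ.toEmbedding
  obtain ⟨σ, hc⟩ := exists_isCompl (l := n - k) (by omega) ρ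
  obtain ⟨β, rfl⟩ := exists_eq_add_countIndex σ α fun i hi =>
    (hs i).resolve_right (Set.disjoint_right.1 hc.disjoint hi)
  simp only [Pi.add_apply, Finset.sum_add_distrib, sum_countIndex] at hα
  exact h ⟨n - k, ∑ i, β i, by omega, hα⟩

lemma pInt_eq_bot {r n k : ℕ} (T : Affine.Simplex ℝ E n)
    (h : ¬ ∃ l s, k + l = n ∧ s + l = r) : PInt r k T = ⊥ := by
  rw [PInt, Submodule.span_eq_bot]
  rintro _ ⟨α, σ, hα, hs, rfl⟩
  have hk : k ≤ n + 1 := by simpa using Fintype.card_le_of_embedding σ.toEmbedding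
  rcases hk.eq_or_lt with rfl | hk
  · rw [dlamWedge_eq_zero_of_card, smul_zero]
  · exfalso
    obtain ⟨ρ, hc⟩ := exists_isCompl (l := n - k + 1) (by omega) σ
    obtain ⟨β, rfl⟩ := exists_eq_add_countIndex ρ α fun i hi =>
      (hs i).resolve_right (Set.disjoint_right.1 hc.disjoint hi)
    simp only [Pi.add_apply, Finset.sum_add_distrib, sum_countIndex] at hα
    exact h ⟨n - k, ∑ i, β i + 1, by omega, by omega⟩

lemma isBasisOf_basisPMinus0 {r n k : ℕ} (T : Affine.Simplex ℝ E n)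
    (h : ∀ l s, k + l = n → s + l + 1 = r → IsBasisOf (basisP B s n l T) (PForms s l T)) :
    IsBasisOf (basisPMinus0 B r n k T) (PMinusInt r k T) := by
  by_cases hex : ∃ l s, k + l = n ∧ s + l + 1 = r
  · obtain ⟨l, s, hl, rfl⟩ := hex
    obtain rfl : n = l + k := by omega
    rw [basisPMinus0_eq]
    exact isBasisOf_image_graphI T (h l s hl rfl)
  · rw [basisPMinus0_eq_empty B T hex, pMinusInt_eq_bot T hex]
    exact isBasisOf_empty

lemma isBasisOf_basisP0 {r n k : ℕ} (T : Affine.Simplex ℝ E n)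
    (h : ∀ l s, k + l = n → s + l = r → IsBasisOf (basisPMinus B s n l T) (PMinusForms s l T)) :
    IsBasisOf (basisP0 B r n k T) (PInt r k T) := by
  by_cases hex : ∃ l s, k + l = n ∧ s + l = r
  · obtain ⟨l, s, rfl, rfl⟩ := hex
    rw [basisP0_eq]
    exact isBasisOf_preimage_graphJ T (h l s rfl rfl)
  · rw [basisP0_eq_empty B T hex, pInt_eq_bot T hex]
    exact isBasisOf_empty

lemma basisP_succ (q n k : ℕ) (T : Affine.Simplex ℝ E n) :
    basisP B (q + 1) n k T = ⋃ (m : ℕ) (ι : Fin (m + 1) ↪o Fin (n + 1)),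
      image (graphExt (q + 1) k T ι) (basisP0 B (q + 1) m k (face T ι)) := by
  rw [basisP]

lemma basisP_zero (n k : ℕ) (T : Affine.Simplex ℝ E n) :
    basisP B 0 n k T = constBasis B n k T := by
  rw [basisP]

lemma basisPMinus_eq (r n k : ℕ) (T : Affine.Simplex ℝ E n) :
    basisPMinus B r n k T = ⋃ (m : ℕ) (ι : Fin (m + 1) ↪o Fin (n + 1)),
      image (graphExtMinus r k T ι) (basisPMinus0 B r m k (face T ι)) := by
  rw [basisPMinus]

/-- If the recursion starts with bases, then it produces bases. -/
theorem isBasisOf_basisP_and_basisPMinus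
    (hC : ∀ (n k : ℕ) (T : Affine.Simplex ℝ E n), IsBasisOf (constBasis B n k T) (PForms 0 k T))
    (r : ℕ) : ∀ (n k : ℕ) (T : Affine.Simplex ℝ E n),
      IsBasisOf (basisP B r n k T) (PForms r k T) ∧
      IsBasisOf (basisPMinus B r n k T) (PMinusForms r k T) := by
  induction r using Nat.strong_induction_on with
  | _ r ih =>
  -- The trimmed case comes first: it uses full spaces of strictly smaller degree, while the full
  -- case uses trimmed spaces up to the same degree (`l = 0`).
  have hminus : ∀ (n k : ℕ) (T : Affine.Simplex ℝ E n),
      IsBasisOf (basisPMinus B r n k T) (PMinusForms r k T) := by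
    intro n k T
    rw [basisPMinus_eq]
    refine isBasisOf_iUnion_image T (fun m ι => graphExtMinus r k T ι)
      (fun m ι => PMinusInt r k (face T ι)) (fun m ι => basisPMinus0 B r m k (face T ι)) _
      (fun m ι => isBasisOf_basisPMinus0 B _ fun l s _ hs => (ih s (by omega) m l _).1)
      (fun m ι η h => eq_zero_of_mem_graphExtMinus T ι h)
      (fun m ι p h => pull_of_mem_graphExtMinus T ι h)
      (fun m ι ω h => exists_extMinus T ι h) (pMinusForms_le_span T r)
  refine fun n k T => ⟨?_, hminus n k T⟩
  rcases r with _ | q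
  · rw [basisP_zero]
    exact hC n k T
  · rw [basisP_succ]
    refine isBasisOf_iUnion_image T (fun m ι => graphExt (q + 1) k T ι)
      (fun m ι => PInt (q + 1) k (face T ι)) (fun m ι => basisP0 B (q + 1) m k (face T ι)) _
      (fun m ι => isBasisOf_basisP0 B _ fun l s _ hs => ?_)
      (fun m ι η h => eq_zero_of_mem_graphExt T ι q.succ_ne_zero h)
      (fun m ι p h => pull_of_mem_graphExt T ι h)
      (fun m ι ω h => exists_ext T ι h) (pForms_le_span T q.succ_ne_zero)
    rcases Nat.lt_or_ge s (q + 1) with h | h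
    · exact (ih s h m l _).2
    · obtain rfl : s = q + 1 := by omega
      exact hminus m l _

end Recursion

/-! ### Equivariance of the recursive construction -/

section Equivariance

-- Pullback of polynomial forms along vertex permutations

section Perm

variable {n : ℕ} (T T' : Affine.Simplex ℝ E n) (π : Equiv.Perm (Fin (n + 1)))

lemma pull_lamPow_smul {k : ℕ} (α : Fin (n + 1) → ℕ) (ω : Form T' k) :
    pull T T' π k (lamPow T' α • ω) = lamPow T (α ∘ π) • pull T T' π k ω := by
  have : α = Function.extend π (α ∘ π) 0 := by
    funext i
    obtain ⟨j, rfl⟩ := π.surjective i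
    rw [π.injective.extend_apply]; rfl
  conv_lhs => rw [this]
  rw [pull_smul, lamPow_comp_bodyMap T T' π.injective]

lemma pull_perm_dlamWedge {k : ℕ} (σ : Fin k → Fin (n + 1)) :
    pull T T' π k (dlamWedge T' σ) = dlamWedge T (π.symm ∘ σ) := by
  rw [← pull_dlamWedge T T' π.injective (π.symm ∘ σ)]
  congr 2
  funext j; simp

lemma pull_perm_whitney {k : ℕ} (ρ : Fin (k + 1) → Fin (n + 1)) :
    pull T T' π k (whitney T' ρ) = whitney T (π.symm ∘ ρ) := by
  rw [← pull_whitney T T' π.injective (π.symm ∘ ρ)]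
  congr 2
  funext j; simp

lemma pull_mem_pForms {r k : ℕ} {ω : Form T' k} (hω : ω ∈ PForms r k T') :
    pull T T' π k ω ∈ PForms r k T := by
  have : PForms r k T' ≤ (PForms r k T).comap (pull T T' π k) := by
    refine Submodule.span_le.2 ?_
    rintro _ ⟨α, σ, hα, rfl⟩
    change pull T T' π k _ ∈ PForms r k T
    rw [pull_lamPow_smul, pull_perm_dlamWedge]
    exact lamPow_smul_dlamWedge_mem T ((Equiv.sum_comp π α).trans hα) _
  exact this hω

lemma pull_mem_pMinusForms {r k : ℕ} {ω : Form T' k} (hω : ω ∈ PMinusForms r k T') :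
    pull T T' π k ω ∈ PMinusForms r k T := by
  have : PMinusForms r k T' ≤ (PMinusForms r k T).comap (pull T T' π k) := by
    refine Submodule.span_le.2 ?_
    rintro _ ⟨α, σ, hα, rfl⟩
    change pull T T' π k _ ∈ PMinusForms r k T
    rw [pull_lamPow_smul, pull_perm_whitney]
    exact lamPow_smul_whitney_mem T ((congrArg (· + 1) (Equiv.sum_comp π α)).trans hα) _
  exact this hω

lemma dlam_tanMap_perm (w : Tangent T) (i : Fin (n + 1)) :
    dlam T' (π i) (tanMap T T' π w) = dlam T i w :=
  LinearMap.congr_fun (dlam_comp_tanMap T T' π.injective i) w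

lemma tanMap_vertex_vsub (i : Fin (n + 1)) (x : Body T) :
    tanMap T T' π (vertexBasis T i -ᵥ (x : Hull T)) =
      vertexBasis T' (π i) -ᵥ (bodyMap T T' π x : Hull T') := by
  refine dlam_ext T' fun j => ?_
  obtain ⟨j, rfl⟩ := π.surjective j
  rw [dlam_tanMap_perm, dlam_vsub, dlam_vsub, lam_bodyMap_apply T T' π.injective, lam_vertex,
    lam_vertex]
  simp

lemma pull_perm_injective (k : ℕ) : Function.Injective (pull T T' π k) := by
  rw [← LinearMap.ker_eq_bot, LinearMap.ker_eq_bot']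
  intro ω h
  funext y
  ext w
  have h1 := congrFun h (bodyMap T' T π.symm y)
  have h2 := congrArg (fun A => A fun j => tanMap T' T π.symm (w j)) h1
  simp only [pull_apply, AlternatingMap.compLinearMap_apply] at h2
  have e1 : bodyMap T T' π (bodyMap T' T π.symm y) = y := by
    refine Subtype.ext (lam_ext T' fun i => ?_)
    obtain ⟨j, rfl⟩ := π.surjective i
    have := lam_bodyMap_apply T' T π.symm.injective y (π j)
    rw [π.symm_apply_apply] at this
    rw [lam_bodyMap_apply T T' π.injective, this]
  have e2 : ∀ v, tanMap T T' π (tanMap T' T π.symm v) = v := by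
    intro v
    refine dlam_ext T' fun i => ?_
    obtain ⟨j, rfl⟩ := π.surjective i
    have := dlam_tanMap_perm T' T π.symm v (π j)
    rw [π.symm_apply_apply] at this
    rw [dlam_tanMap_perm, this]
  simp only [e1, e2] at h2
  exact h2

end Perm

-- Star operators and vertex permutations

section StarPerm

variable {k l : ℕ} (T T' : Affine.Simplex ℝ E (k + l)) (π : Equiv.Perm (Fin (k + l + 1)))

/-- Relabelling the vertices permutes the columns of the determinant; this is the only source of a
sign. -/
lemma volR_perm (f : Fin k → Fin (k + l + 1)) (x : Body T) (w : Fin l → Tangent T) :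
    volR T f x w = ((π.sign : ℤ) : ℂ) *
      volR T' (π ∘ f) (bodyMap T T' π x) (fun j => tanMap T T' π (w j)) := by
  rw [volR_apply, volR_apply]
  have h := Matrix.det_permute' π (Matrix.of (Fin.append (n := l + 1)
      (fun j => Pi.single ((π ∘ f) j) (1 : ℝ))
      (Fin.cons (bary T' (bodyMap T T' π x)) fun j => tanCoord T' (tanMap T T' π (w j)))))
  have h' := congrArg (fun r : ℝ => (r : ℂ)) h
  simp only [Complex.ofReal_mul, Complex.ofReal_intCast] at h'
  rw [← h']
  congr 2
  ext r c
  rw [Matrix.submatrix_apply, Matrix.of_apply, Matrix.of_apply]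
  refine Fin.addCases (m := k) (n := l + 1) (fun r => ?_) (fun r => ?_) r
  · simp [Pi.single_apply]
  · refine Fin.cases ?_ (fun r => ?_) r
    · simp [lam_bodyMap_apply T T' π.injective]
    · simp [dlam_tanMap_perm]

lemma volL_perm (f : Fin l → Fin (k + l + 1)) (x : Body T) (w : Fin k → Tangent T) :
    volL T f x w = ((π.sign : ℤ) : ℂ) *
      volL T' (π ∘ f) (bodyMap T T' π x) (fun j => tanMap T T' π (w j)) := by
  rw [volL_apply, volL_apply]
  have h := Matrix.det_permute' π (Matrix.of (Fin.append (n := l + 1)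
      (fun j => tanCoord T' (tanMap T T' π (w j)))
      (Fin.cons (bary T' (bodyMap T T' π x)) fun j => Pi.single ((π ∘ f) j) (1 : ℝ))))
  have h' := congrArg (fun r : ℝ => (r : ℂ)) h
  simp only [Complex.ofReal_mul, Complex.ofReal_intCast] at h'
  rw [← h']
  congr 2
  ext r c
  rw [Matrix.submatrix_apply, Matrix.of_apply, Matrix.of_apply]
  refine Fin.addCases (m := k) (n := l + 1) (fun r => ?_) (fun r => ?_) r
  · simp [dlam_tanMap_perm]
  · refine Fin.cases ?_ (fun r => ?_) r
    · simp [lam_bodyMap_apply T T' π.injective]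
    · simp [Pi.single_apply]

/-- The defining sum runs over all vertex tuples, so relabelling only reindexes it by `f ↦ π ∘ f`.
-/
lemma starAForm_pull (ω : Form T' k) :
    starAForm T (pull T T' π k ω) = ((π.sign : ℤ) : ℂ) • pull T T' π l (starAForm T' ω) := by
  funext x
  ext w
  change starA T x ((ω (bodyMap T T' π x)).compLinearMap (tanMap T T' π)) w =
    ((π.sign : ℤ) : ℂ) • starA T' (bodyMap T T' π x) (ω (bodyMap T T' π x))
      (fun j => tanMap T T' π (w j))
  simp only [starA_apply, AlternatingMap.smul_apply, alternatingMap_sum_apply, smul_eq_mul,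
    AlternatingMap.compLinearMap_apply, tanMap_vertex_vsub]
  rw [mul_left_comm]
  congr 1
  rw [Finset.mul_sum]
  refine Fintype.sum_equiv (Equiv.arrowCongr (Equiv.refl (Fin k)) π) _ _ fun f => ?_
  rw [volR_perm T T' π, mul_left_comm]
  simp only [Equiv.arrowCongr_apply, Equiv.refl_symm, Equiv.coe_refl, Function.comp_apply, id,
    lam_bodyMap_apply T T' π.injective]
  rfl

lemma starBForm_pull (ω : Form T' l) :
    starBForm T (pull T T' π l ω) = ((π.sign : ℤ) : ℂ) • pull T T' π k (starBForm T' ω) := by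
  funext x
  ext w
  change starB T x ((ω (bodyMap T T' π x)).compLinearMap (tanMap T T' π)) w =
    ((π.sign : ℤ) : ℂ) • starB T' (bodyMap T T' π x) (ω (bodyMap T T' π x))
      (fun j => tanMap T T' π (w j))
  simp only [starB_apply, AlternatingMap.smul_apply, alternatingMap_sum_apply, smul_eq_mul,
    AlternatingMap.compLinearMap_apply, tanMap_vertex_vsub]
  rw [mul_left_comm]
  congr 1
  rw [Finset.mul_sum]
  refine Fintype.sum_equiv (Equiv.arrowCongr (Equiv.refl (Fin l)) π) _ _ fun f => ?_
  rw [volL_perm T T' π, mul_left_comm]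
  simp only [Equiv.arrowCongr_apply, Equiv.refl_symm, Equiv.coe_refl, Function.comp_apply, id,
    lam_bodyMap_apply T T' π.injective]
  rfl

lemma pull_mem_graphI {r : ℕ} {p : Form T' k × Form T' l} (hp : p ∈ graphI r k l T') :
    (pull T T' π k p.1, ((π.sign : ℤ) : ℂ) • pull T T' π l p.2) ∈ graphI r k l T := by
  rw [mem_graphI_iff] at hp ⊢
  exact ⟨pull_mem_pForms T T' π hp.1, by rw [starAForm_pull, hp.2]⟩

lemma pull_mem_graphJ {s : ℕ} {p : Form T' k × Form T' l} (hp : p ∈ graphJ s k l T') :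
    (((π.sign : ℤ) : ℂ) • pull T T' π k p.1, pull T T' π l p.2) ∈ graphJ s k l T := by
  rw [mem_graphJ_iff] at hp ⊢
  exact ⟨pull_mem_pMinusForms T T' π hp.1, by rw [starBForm_pull, hp.2]⟩

end StarPerm

-- Extension operators and vertex permutations

section ExtPerm

variable {n m : ℕ} (T T' : Affine.Simplex ℝ E n) {π : Equiv.Perm (Fin (n + 1))}
  {ι ι' : Fin (m + 1) ↪o Fin (n + 1)} {θ : Equiv.Perm (Fin (m + 1))}

/-- A permutation maps faces to faces but need not respect their vertex orders; `θ` records the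
induced reordering. Hence pullbacks between different simplices are needed even for the symmetries
of one simplex. -/
lemma exists_face_perm (π : Equiv.Perm (Fin (n + 1))) (ι' : Fin (m + 1) ↪o Fin (n + 1)) :
    ∃ (ι : Fin (m + 1) ↪o Fin (n + 1)) (θ : Equiv.Perm (Fin (m + 1))),
      ∀ j, ι' (θ j) = π (ι j) := by
  classical
  have hc : (Finset.univ.image (π.symm ∘ ι')).card = m + 1 := by
    rw [Finset.card_image_of_injective _ (π.symm.injective.comp ι'.injective)]
    simp
  let ι := (Finset.univ.image (π.symm ∘ ι')).orderEmbOfFin hc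
  have hι : ∀ j, π (ι j) ∈ Set.range ι' := by
    intro j
    have : ι j ∈ Finset.univ.image (π.symm ∘ ι') := Finset.orderEmbOfFin_mem _ hc j
    obtain ⟨a, -, ha⟩ := Finset.mem_image.1 this
    exact ⟨a, by rw [← ha]; simp⟩
  obtain ⟨g, hg⟩ := exists_lift ι' (π ∘ ι) hι
  have hinj : Function.Injective g := by
    intro a b hab
    have h1 := hg a
    rw [hab, hg b] at h1
    exact ι.injective (π.injective h1.symm)
  exact ⟨ι, Equiv.ofBijective g (Finite.injective_iff_bijective.1 hinj), hg⟩

lemma symm_face_perm (h : ∀ j, ι' (θ j) = π (ι j)) (j : Fin (m + 1)) :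
    π.symm (ι' j) = ι (θ.symm j) := by
  rw [Equiv.symm_apply_eq, ← h, θ.apply_symm_apply]

lemma extend_comp_perm (h : ∀ j, ι' (θ j) = π (ι j)) (α : Fin (m + 1) → ℕ) :
    Function.extend ι' α 0 ∘ π = Function.extend ι (α ∘ θ) 0 := by
  funext i
  by_cases hi : i ∈ Set.range ι
  · obtain ⟨j, rfl⟩ := hi
    rw [Function.comp_apply, ← h, ι'.injective.extend_apply, ι.injective.extend_apply]
    rfl
  · rw [Function.extend_apply' _ _ _ (by simpa using hi), Function.comp_apply,
      Function.extend_apply']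
    · rfl
    · rintro ⟨j, hj⟩
      refine hi ⟨θ.symm j, ?_⟩
      rw [← symm_face_perm h, hj, π.symm_apply_apply]

lemma pull_mem_graphExtMinus (h : ∀ j, ι' (θ j) = π (ι j)) {r k : ℕ}
    {p : Form (face T' ι') k × Form T' k} (hp : p ∈ graphExtMinus r k T' ι') :
    (pull (face T ι) (face T' ι') θ k p.1, pull T T' π k p.2) ∈ graphExtMinus r k T ι := by
  have : graphExtMinus r k T' ι' ≤ (graphExtMinus r k T ι).comap
      ((pull (face T ι) (face T' ι') θ k).prodMap (pull T T' π k)) := by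
    refine Submodule.span_le.2 ?_
    rintro _ ⟨α, ρ, hα, rfl⟩
    change (pull (face T ι) (face T' ι') θ k (lamPow (face T' ι') _ • _),
      pull T T' π k (lamPow T' _ • _)) ∈
      graphExtMinus r k T ι
    rw [pull_lamPow_smul, pull_lamPow_smul, pull_perm_whitney, pull_perm_whitney,
      extend_comp_perm h]
    have hα' : ∑ i, (α ∘ θ) i + 1 = r := (congrArg (· + 1) (Equiv.sum_comp θ α)).trans hα
    convert mem_graphExtMinus T ι hα' (θ.symm ∘ ρ) using 4
    funext j
    exact symm_face_perm h (ρ j)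
  exact this hp

lemma Psi_comp_tanMap_perm (h : ∀ j, ι' (θ j) = π (ι j)) (β : Fin (n + 1) → ℕ)
    (i : Fin (n + 1)) :
    Psi T' ι' β i ∘ₗ tanMap T T' π = Psi T ι (β ∘ π) (π.symm i) := by
  have h1 : ∀ i, dlam T' i ∘ₗ tanMap T T' π = dlam T (π.symm i) := by
    intro i
    have := dlam_comp_tanMap T T' π.injective (π.symm i)
    rwa [π.apply_symm_apply] at this
  have h2 : (∑ j, dlam T' (ι' j)) ∘ₗ tanMap T T' π = ∑ j, dlam T (ι j) := by
    ext w
    have h3 : ∀ j, dlam T' (ι' j) (tanMap T T' π w) = dlam T (ι (θ.symm j)) w := by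
      intro j
      rw [← symm_face_perm h]
      exact LinearMap.congr_fun (h1 _) w
    simp only [LinearMap.comp_apply, LinearMap.sum_apply, h3]
    exact θ.symm.sum_comp (fun j => dlam T (ι j) w)
  rw [Psi, Psi, LinearMap.sub_comp, LinearMap.smul_comp, h2, h1, Function.comp_apply,
    π.apply_symm_apply]
  have h4 : ∑ j, (β ∘ π) j = ∑ j, β j := Equiv.sum_comp π β
  rw [h4]

lemma pull_mem_graphExt (h : ∀ j, ι' (θ j) = π (ι j)) {r k : ℕ}
    {p : Form (face T' ι') k × Form T' k} (hp : p ∈ graphExt r k T' ι') :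
    (pull (face T ι) (face T' ι') θ k p.1, pull T T' π k p.2) ∈ graphExt r k T ι := by
  have : graphExt r k T' ι' ≤ (graphExt r k T ι).comap
      ((pull (face T ι) (face T' ι') θ k).prodMap (pull T T' π k)) := by
    refine Submodule.span_le.2 ?_
    rintro _ ⟨α, σ, hα, rfl⟩
    change (pull (face T ι) (face T' ι') θ k (lamPow (face T' ι') _ • _),
      pull T T' π k (lamPow T' _ • _)) ∈
      graphExt r k T ι
    rw [pull_lamPow_smul, pull_lamPow_smul, pull_perm_dlamWedge, pull_constWedge]
    simp only [Psi_comp_tanMap_perm T T' h, extend_comp_perm h, symm_face_perm h]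
    exact mem_graphExt T ι ((Equiv.sum_comp θ α).trans hα) (θ.symm ∘ σ)
  exact this hp

end ExtPerm

-- Covariant families and their propagation through the recursion

/-- Families of sets of forms which are permuted up to nonzero factors by the pullbacks along
affine isomorphisms of simplices. -/
def IsCovariant {n k : ℕ} (Q : ∀ T : Affine.Simplex ℝ E n, Set (Form T k)) : Prop :=
  ∀ (T T' : Affine.Simplex ℝ E n) (π : Equiv.Perm (Fin (n + 1))), ∀ ω ∈ Q T',
    ∃ c : ℂ, c ≠ 0 ∧ ∃ ω' ∈ Q T, pull T T' π k ω = c • ω'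

lemma exists_smul_mem_image {V W : Type*} [AddCommGroup V] [Module ℂ V] [AddCommGroup W]
    [Module ℂ W] {G : Submodule ℂ (V × W)} {Q : Set V} {v : V} {w : W} {b : ℂ} (hb : b ≠ 0)
    (h : (v, b • w) ∈ G) (hv : ∃ c : ℂ, c ≠ 0 ∧ ∃ v' ∈ Q, v = c • v') :
    ∃ c : ℂ, c ≠ 0 ∧ ∃ w' ∈ image G Q, w = c • w' := by
  obtain ⟨c, hc, v', hv', rfl⟩ := hv
  refine ⟨b⁻¹ * c, mul_ne_zero (inv_ne_zero hb) hc, (c⁻¹ * b) • w, ⟨v', hv', ?_⟩, ?_⟩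
  · have := G.smul_mem c⁻¹ h
    rwa [Prod.smul_mk, smul_smul, smul_smul, inv_mul_cancel₀ hc, one_smul] at this
  · rw [smul_smul]
    have : b⁻¹ * c * (c⁻¹ * b) = 1 := by field_simp
    rw [this, one_smul]

lemma exists_smul_mem_preimage {V W : Type*} [AddCommGroup V] [Module ℂ V] [AddCommGroup W]
    [Module ℂ W] {G : Submodule ℂ (V × W)} {Q : Set W} {v : V} {w : W} {b : ℂ} (hb : b ≠ 0)
    (h : (b • v, w) ∈ G) (hw : ∃ c : ℂ, c ≠ 0 ∧ ∃ w' ∈ Q, w = c • w') :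
    ∃ c : ℂ, c ≠ 0 ∧ ∃ v' ∈ preimage G Q, v = c • v' := by
  obtain ⟨c, hc, w', hw', rfl⟩ := hw
  refine ⟨b⁻¹ * c, mul_ne_zero (inv_ne_zero hb) hc, (c⁻¹ * b) • v, ⟨w', hw', ?_⟩, ?_⟩
  · have := G.smul_mem c⁻¹ h
    rwa [Prod.smul_mk, smul_smul, smul_smul, inv_mul_cancel₀ hc, one_smul] at this
  · rw [smul_smul]
    have : b⁻¹ * c * (c⁻¹ * b) = 1 := by field_simp
    rw [this, one_smul]

/-- The dimensions and degrees which are linked by the recursion to `2`-forms on `4`-simplices. -/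
def Linked (n k : ℕ) : Prop :=
  k = 0 ∨ k = n ∨ (n = 2 ∧ k = 1) ∨ (n = 3 ∧ k = 1) ∨ (n = 3 ∧ k = 2) ∨ (n = 4 ∧ k = 2)

/-- The recursion passes to a face and to the complementary form degree. From `(4,2)` it gives
`(2,0)`, `(3,1)` and `(4,2)`; from `(3,1)` also `(2,1)` and `(3,2)`. It never needs 1-forms or
3-forms on 4-simplices. -/
lemma Linked.face {n k m l : ℕ} (h : Linked n k) (hm : m ≤ n) (hl : k + l = m) : Linked m l := by
  unfold Linked at *
  omega

variable (B : ∀ (n k : ℕ) (T : Affine.Simplex ℝ E n), Set (Form T k))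

lemma sign_ne_zero {N : ℕ} (π : Equiv.Perm (Fin N)) : ((π.sign : ℤ) : ℂ) ≠ 0 := by
  rcases Int.units_eq_one_or π.sign with h | h <;> simp [h]

/-- If the recursion starts with covariant families, then it produces covariant families. -/
theorem isCovariant_basisP_and_basisPMinus
    (hC : ∀ n k : ℕ, Linked n k → IsCovariant (E := E) fun T => constBasis B n k T)
    (r : ℕ) : ∀ n k : ℕ, Linked n k → IsCovariant (E := E) (fun T => basisP B r n k T) ∧
      IsCovariant (E := E) (fun T => basisPMinus B r n k T) := by
  induction r using Nat.strong_induction_on with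
  | _ r ih =>
  have hminus : ∀ n k : ℕ, Linked n k →
      IsCovariant (E := E) (fun T => basisPMinus B r n k T) := by
    intro n k hnk T T' π η hη
    beta_reduce at hη ⊢
    rw [basisPMinus_eq] at hη ⊢
    simp only [Set.mem_iUnion] at hη
    obtain ⟨m, ι', ω, hω, h⟩ := hη
    have hm : m ≤ n := by simpa using Fintype.card_le_of_embedding ι'.toEmbedding
    obtain ⟨ι, θ, hθ⟩ := exists_face_perm π ι'
    have h1 := pull_mem_graphExtMinus T T' hθ h
    have h2 : ∃ c : ℂ, c ≠ 0 ∧ ∃ ω' ∈ basisPMinus0 B r m k (face T ι),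
        pull (face T ι) (face T' ι') θ k ω = c • ω' := by
      by_cases hex : ∃ l s, k + l = m ∧ s + l + 1 = r
      · obtain ⟨l, s, hl, rfl⟩ := hex
        obtain rfl : m = l + k := by omega
        rw [basisPMinus0_eq] at hω ⊢
        obtain ⟨ω₀, hω₀, hg⟩ := hω
        exact exists_smul_mem_image (sign_ne_zero θ)
          (pull_mem_graphI (face T ι) (face T' ι') θ hg)
          ((ih s (by omega) _ _ (hnk.face hm hl)).1 _ _ θ _ hω₀)
      · rw [basisPMinus0_eq_empty B _ hex] at hω
        exact absurd hω (Set.notMem_empty _)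
    obtain ⟨c, hc, η', hη', e⟩ := exists_smul_mem_image one_ne_zero
      (by rw [one_smul]; exact h1) h2
    exact ⟨c, hc, η', Set.mem_iUnion₂.2 ⟨m, ι, hη'⟩, e⟩
  refine fun n k hnk => ⟨?_, hminus n k hnk⟩
  rcases r with _ | q
  · simp only [basisP_zero]
    exact hC n k hnk
  · intro T T' π η hη
    beta_reduce at hη ⊢
    rw [basisP_succ] at hη ⊢
    simp only [Set.mem_iUnion] at hη
    obtain ⟨m, ι', ω, hω, h⟩ := hη
    have hm : m ≤ n := by simpa using Fintype.card_le_of_embedding ι'.toEmbedding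
    obtain ⟨ι, θ, hθ⟩ := exists_face_perm π ι'
    have h1 := pull_mem_graphExt T T' hθ h
    have h2 : ∃ c : ℂ, c ≠ 0 ∧ ∃ ω' ∈ basisP0 B (q + 1) m k (face T ι),
        pull (face T ι) (face T' ι') θ k ω = c • ω' := by
      by_cases hex : ∃ l s, k + l = m ∧ s + l = q + 1
      · obtain ⟨l, s, rfl, hs⟩ := hex
        have h3 : IsCovariant (E := E) (fun T => basisPMinus B s (k + l) l T) := by
          rcases Nat.lt_or_ge s (q + 1) with h | h
          · exact (ih s h _ _ (hnk.face hm rfl)).2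
          · obtain rfl : s = q + 1 := by omega
            exact hminus _ _ (hnk.face hm rfl)
        rw [← hs, basisP0_eq] at hω ⊢
        obtain ⟨ω₀, hω₀, hg⟩ := hω
        exact exists_smul_mem_preimage (sign_ne_zero θ)
          (pull_mem_graphJ (face T ι) (face T' ι') θ hg) (h3 _ _ θ _ hω₀)
      · rw [basisP0_eq_empty B _ hex] at hω
        exact absurd hω (Set.notMem_empty _)
    obtain ⟨c, hc, η', hη', e⟩ := exists_smul_mem_image one_ne_zero
      (by rw [one_smul]; exact h1) h2
    exact ⟨c, hc, η', Set.mem_iUnion₂.2 ⟨m, ι, hη'⟩, e⟩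

end Equivariance

/-! ### Symmetries of a simplex -/

section Symmetries

variable {n : ℕ} {T : Affine.Simplex ℝ E n}

lemma affine_apply_eq_sum (g : Hull T →ᵃ[ℝ] ℝ) (x : Hull T) :
    g x = ∑ i, lam T i x * g (vertexBasis T i) := by
  have key : x = Finset.univ.affineCombination ℝ (vertexBasis T) (bary T x) :=
    ((vertexBasis T).affineCombination_coord_eq_self x).symm
  conv_lhs => rw [key]
  have hs : ∑ i, bary T x i = 1 := sum_lam T x
  rw [Finset.univ.map_affineCombination _ _ hs,
    Finset.affineCombination_eq_linear_combination _ _ _ hs]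
  rfl

lemma vertex_mem_body (i : Fin (n + 1)) : vertexBasis T i ∈ Body T := by
  rw [mem_body_iff]
  intro j
  rw [lam_vertex]
  split_ifs <;> norm_num

/-- A symmetry of a simplex permutes the vertices. -/
lemma exists_perm_of_sym (S : Sym T) :
    ∃ π : Equiv.Perm (Fin (n + 1)), ∀ i, S.1 (vertexBasis T i) = vertexBasis T (π i) := by
  have hbody : ∀ i, S.1 (vertexBasis T i) ∈ Body T := fun i => (S.2 _).2 (vertex_mem_body i)
  have hbody' : ∀ i, S.1.symm (vertexBasis T i) ∈ Body T := fun i => by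
    rw [← S.2, AffineEquiv.apply_symm_apply]; exact vertex_mem_body i
  have hex : ∀ i, ∃ j, S.1 (vertexBasis T i) = vertexBasis T j := by
    intro i
    have hc0 : ∀ j, 0 ≤ lam T j (S.1 (vertexBasis T i)) := (mem_body_iff T _).1 (hbody i)
    -- This writes `v_i` as a convex combination of the points `S⁻¹ v_j` of the simplex. As `v_i` is
    -- extreme, every such point with positive weight equals `v_i`.
    have h1 : ∀ a, lam T a (vertexBasis T i) = ∑ j, lam T j (S.1 (vertexBasis T i)) *
        lam T a (S.1.symm (vertexBasis T j)) := by
      intro a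
      have := affine_apply_eq_sum ((lam T a).comp S.1.symm.toAffineMap) (S.1 (vertexBasis T i))
      simpa using this
    obtain ⟨j, hj⟩ : ∃ j, lam T j (S.1 (vertexBasis T i)) ≠ 0 := by
      by_contra! H
      have := sum_lam T (S.1 (vertexBasis T i))
      simp [H] at this
    refine ⟨j, ?_⟩
    rw [← AffineEquiv.eq_symm_apply]
    refine (lam_ext T fun a => ?_)
    have hz : ∀ a, a ≠ i → lam T a (S.1.symm (vertexBasis T j)) = 0 := by
      intro a ha
      have h2 := h1 a
      rw [lam_vertex, if_neg ha] at h2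
      have h3 := (Finset.sum_eq_zero_iff_of_nonneg (fun b _ =>
        mul_nonneg (hc0 b) ((mem_body_iff T _).1 (hbody' b) a))).1 h2.symm j (Finset.mem_univ j)
      exact (mul_eq_zero.1 h3).resolve_left hj
    rw [lam_vertex]
    split_ifs with ha
    · subst ha
      have := sum_lam T (S.1.symm (vertexBasis T j))
      rw [Finset.sum_eq_single_of_mem a (Finset.mem_univ a) fun b _ hb => hz b hb] at this
      exact this.symm
    · exact (hz a ha).symm
  choose g hg using hex
  have hinj : Function.Injective g := by
    intro a b hab
    have := (hg a).trans ((congrArg _ hab).trans (hg b).symm)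
    exact (vertexBasis T).ind.injective (S.1.injective this)
  exact ⟨Equiv.ofBijective g (Finite.injective_iff_bijective.1 hinj), hg⟩

/-- An affine map is determined by its values on the vertices; the linear part follows by writing
tangent vectors as differences of points. -/
lemma pullback_eq_pull {k : ℕ} (S : Sym T) {π : Equiv.Perm (Fin (n + 1))}
    (hπ : ∀ i, S.1 (vertexBasis T i) = vertexBasis T (π i)) (ω : Form T k) :
    pullback S ω = pull T T π k ω := by
  have h1 : ∀ (x : Hull T) i, lam T (π i) (S.1 x) = lam T i x := by
    intro x i
    have := affine_apply_eq_sum ((lam T (π i)).comp S.1.toAffineMap) x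
    simp only [AffineMap.comp_apply, AffineEquiv.coe_toAffineMap, hπ, lam_vertex,
      π.injective.eq_iff] at this
    simpa using this
  have h2 : ∀ x : Body T, (⟨S.1 x, (S.2 x).2 x.2⟩ : Body T) = bodyMap T T π x := by
    intro x
    refine Subtype.ext (lam_ext T fun i => ?_)
    obtain ⟨j, rfl⟩ := π.surjective i
    rw [lam_bodyMap_apply T T π.injective]
    exact h1 x j
  have h3 : (S.1.linear : Tangent T →ₗ[ℝ] Tangent T) = tanMap T T π := by
    ext1 w
    refine dlam_ext T fun i => ?_
    obtain ⟨j, rfl⟩ := π.surjective i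
    rw [dlam_tanMap_perm]
    have hw : w = (w +ᵥ vertexBasis T 0) -ᵥ vertexBasis T 0 := by simp
    have h4 : S.1.linear w = S.1 (w +ᵥ vertexBasis T 0) -ᵥ S.1 (vertexBasis T 0) := by
      rw [AffineEquiv.map_vadd]; simp
    change dlam T (π j) (S.1.linear w) = _
    rw [h4, dlam_vsub, h1, h1, ← dlam_vsub, ← hw]
  funext x
  rw [pullback, h2, h3]
  rfl

/-- A covariant family of finite linearly independent sets is invariant. -/
lemma IsCovariant.isCInvariant {k : ℕ} {Q : ∀ T : Affine.Simplex ℝ E n, Set (Form T k)}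
    (h : IsCovariant Q) (hfin : (Q T).Finite) (hind : LinearIndepOn ℂ id (Q T)) :
    IsCInvariant (Q T) := by
  classical
  refine ⟨hfin, fun S => ?_⟩
  obtain ⟨π, hπ⟩ := exists_perm_of_sym S
  have h1 : ∀ ω : Q T, ∃ (c : ℂ) (ω' : Q T), c ≠ 0 ∧
      pull T T π k (ω : Form T k) = c • (ω' : Form T k) := fun ω => by
    obtain ⟨c, hc, ω', hω', e⟩ := h T T π ω ω.2
    exact ⟨c, ⟨ω', hω'⟩, hc, e⟩
  choose χ g hχ hg using h1
  have hinj : Function.Injective g := by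
    intro a b hab
    -- Two elements sent to multiples of the same form would be proportional, against linear
    -- independence.
    have h2 : pull T T π k (χ b • (a : Form T k) - χ a • (b : Form T k)) = 0 := by
      rw [map_sub, map_smul, map_smul, hg a, hg b, hab, smul_comm, sub_self]
    have h3 := pull_perm_injective T T π k (h2.trans (map_zero _).symm)
    by_contra hne
    have h4 := linearIndependent_iff'.1 hind {a, b} (fun q => if q = a then χ b else -χ a)
      (by
        rw [Finset.sum_pair hne, if_pos rfl, if_neg (Ne.symm hne), neg_smul, ← sub_eq_add_neg]
        exact h3) a (Finset.mem_insert_self _ _)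
    rw [if_pos rfl] at h4
    exact hχ b h4
  have : Finite (Q T) := hfin
  refine ⟨Equiv.ofBijective g (Finite.injective_iff_bijective.1 hinj), χ, fun ω => ⟨hχ ω, ?_⟩⟩
  rw [pullback_eq_pull S hπ]
  exact hg ω

lemma finite_degree (N r : ℕ) : {α : Fin N → ℕ | ∑ i, α i = r}.Finite := by
  refine (Set.finite_Iic (fun _ : Fin N => r)).subset fun α hα i => ?_
  have hα' : ∑ i, α i = r := hα
  rw [← hα']
  exact Finset.single_le_sum (f := α) (fun _ _ => Nat.zero_le _) (Finset.mem_univ i)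

lemma IsBasisOf.finite {V : Type*} [AddCommGroup V] [Module ℂ V] {Q s : Set V}
    (hQ : IsBasisOf Q (Submodule.span ℂ s)) (hs : s.Finite) : Q.Finite := by
  have : Finite s := hs
  refine LinearIndependent.finite_of_le_span_finite (fun v : Q => (v : V)) hQ.1 s ?_
  rintro _ ⟨v, rfl⟩
  exact hQ.subset v.2

lemma finite_of_isBasisOf_pForms {r k : ℕ} {Q : Set (Form T k)}
    (hQ : IsBasisOf Q (PForms r k T)) : Q.Finite := by
  refine hQ.finite (((finite_degree (n + 1) r).prod
    (Set.finite_univ (α := Fin k ↪o Fin (n + 1)))).image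
      (fun p => lamPow T p.1 • dlamWedge T p.2) |>.subset ?_)
  rintro _ ⟨α, σ, hα, rfl⟩
  exact ⟨(α, σ), ⟨hα, trivial⟩, rfl⟩

lemma finite_of_isBasisOf_pMinusForms {r k : ℕ} {Q : Set (Form T k)}
    (hQ : IsBasisOf Q (PMinusForms r k T)) : Q.Finite := by
  refine hQ.finite (((finite_degree (n + 1) (r - 1)).prod
    (Set.finite_univ (α := Fin (k + 1) ↪o Fin (n + 1)))).image
      (fun p => lamPow T p.1 • whitney T p.2) |>.subset ?_)
  rintro _ ⟨α, ρ, hα, rfl⟩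
  refine ⟨(α, ρ), ⟨?_, trivial⟩, rfl⟩
  change ∑ i, α i = r - 1
  omega

end Symmetries

/-! ### Constant forms -/

section Constant

variable {n : ℕ} (T : Affine.Simplex ℝ E n)

/-- The vector from the barycenter to the vertex `a`. -/
def centerVec (a : Fin (n + 1)) : Tangent T :=
  vec T fun i => (if i = a then 1 else 0) - 1 / (n + 1)

lemma dlam_centerVec (i a : Fin (n + 1)) :
    dlam T i (centerVec T a) = (if i = a then 1 else 0) - 1 / (n + 1) := by
  refine dlam_vec T ?_ i
  rw [Finset.sum_sub_distrib]
  have : (n + 1 : ℝ) ≠ 0 := by positivity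
  simp [this]

lemma sum_smul_centerVec (w : Tangent T) : ∑ a, dlam T a w • centerVec T a = w := by
  refine dlam_ext T fun i => ?_
  simp only [map_sum, map_smul, dlam_centerVec, smul_eq_mul, mul_sub, Finset.sum_sub_distrib,
    ← Finset.sum_mul, sum_dlam]
  simp

/-- Coefficients of `∑ c_i dλ_i` are unique only up to a constant; normalized to sum zero, they are
read off by these vectors. -/
lemma covector_centerVec {c : Fin (n + 1) → ℝ} (hc : ∑ i, c i = 0) (a : Fin (n + 1)) :
    covector T c (centerVec T a) = c a := by
  simp only [covector, LinearMap.sum_apply, LinearMap.smul_apply, dlam_centerVec, smul_eq_mul,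
    mul_sub, Finset.sum_sub_distrib, ← Finset.sum_mul, hc]
  simp

lemma tanMap_centerVec (T' : Affine.Simplex ℝ E n) (π : Equiv.Perm (Fin (n + 1)))
    (a : Fin (n + 1)) : tanMap T T' π (centerVec T a) = centerVec T' (π a) := by
  refine dlam_ext T' fun i => ?_
  obtain ⟨i, rfl⟩ := π.surjective i
  simp [dlam_tanMap_perm, dlam_centerVec]

variable {T}

/-- The vectors from the barycenter span the tangent space. They are linearly dependent but, unlike
a basis of edges, are permuted by all relabellings, so identities between constant forms become
symmetric finite tables. -/
lemma alternatingMap_ext_centerVec {k : ℕ} {A A' : (Tangent T) [⋀^Fin k]→ₗ[ℝ] ℂ}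
    (h : ∀ f : Fin k → Fin (n + 1),
      A (fun j => centerVec T (f j)) = A' fun j => centerVec T (f j)) : A = A' := by
  ext w
  have hw : w = fun j => ∑ a, dlam T a (w j) • centerVec T a := by
    simp only [sum_smul_centerVec]
  have key : ∀ A : (Tangent T) [⋀^Fin k]→ₗ[ℝ] ℂ, A w = ∑ f : Fin k → Fin (n + 1),
      (∏ j, dlam T (f j) (w j)) • A fun j => centerVec T (f j) := by
    intro A
    conv_lhs => rw [hw]
    rw [← A.coe_multilinearMap, MultilinearMap.map_sum]
    simp only [MultilinearMap.map_smul_univ]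
  rw [key, key]
  simp only [h]

lemma eq_of_mem_pForms_zero {k : ℕ} {ω : Form T k} (hω : ω ∈ PForms 0 k T) (x y : Body T) :
    ω x = ω y := by
  induction hω using Submodule.span_induction with
  | mem ω h =>
    obtain ⟨α, σ, hα, rfl⟩ := h
    have : α = 0 := by
      funext i
      exact (Finset.sum_eq_zero_iff.1 hα) i (Finset.mem_univ i)
    subst this
    simp [lamPow, dlamWedge, constWedge]
  | zero => rfl
  | add a b _ _ ha hb => rw [Pi.add_apply, Pi.add_apply, ha, hb]
  | smul c a _ ha => rw [Pi.smul_apply, Pi.smul_apply, ha]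

lemma lamPow_zero : lamPow T 0 = 1 := by
  funext x
  simp [lamPow]

lemma dlamWedge_mem_pForms_zero {k : ℕ} (f : Fin k → Fin (n + 1)) :
    dlamWedge T f ∈ PForms 0 k T := by
  simpa [lamPow_zero] using
    lamPow_smul_dlamWedge_mem T (α := (0 : Fin (n + 1) → ℕ)) (by simp) f

lemma constWedge_covector_mem_pForms_zero {k : ℕ} (c : Fin k → Fin (n + 1) → ℝ) :
    constWedge T (fun j => covector T (c j)) ∈ PForms 0 k T := by
  have : constWedge T (fun j => covector T (c j)) =
      ∑ f : Fin k → Fin (n + 1), ((∏ j, c j (f j) : ℝ) : ℂ) • dlamWedge T f := by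
    funext x
    rw [Finset.sum_apply]
    exact wedge_sum_smul (dlam T) c
  rw [this]
  exact Submodule.sum_mem _ fun f _ => Submodule.smul_mem _ _ (dlamWedge_mem_pForms_zero f)

/-- A criterion for a family of constant forms to be a basis, in terms of their values `m` on the
vectors from the barycenter to the vertices: there are a dual family `d` and a reproducing formula
for the barycentric alternators. -/
lemma isBasisOf_range_of_eval {k : ℕ} {J : Type*} [Fintype J] [DecidableEq J] {v : J → Form T k}
    (hv : ∀ j, v j ∈ PForms 0 k T) {m d : J → (Fin k → Fin (n + 1)) → ℂ}
    (hm : ∀ j x f, v j x (fun i => centerVec T (f i)) = m j f) {N N' : ℂ} (hN : N ≠ 0)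
    (hd : ∀ i j, ∑ f, d i f * m j f = if i = j then N else 0) (hN' : N' ≠ 0)
    (hr : ∀ f g x, ∑ j, d j f * m j g = N' * dlamWedge T f x fun i => centerVec T (g i)) :
    IsBasisOf (Set.range v) (PForms 0 k T) := by
  constructor
  · have h : LinearIndependent ℂ v := by
      rw [Fintype.linearIndependent_iff]
      intro c hc i
      have h1 : ∀ f, ∑ j, c j * m j f = 0 := by
        intro f
        have := DFunLike.congr_fun
          (congrFun hc ⟨vertexBasis T 0, vertex_mem_body 0⟩) fun i => centerVec T (f i)
        rw [Finset.sum_apply, alternatingMap_sum_apply] at this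
        simpa [hm] using this
      have h2 : ∑ j, c j * ∑ f, d i f * m j f = 0 := by
        have : ∑ f, d i f * ∑ j, c j * m j f = 0 := by simp [h1]
        rw [← this]
        simp only [Finset.mul_sum]
        rw [Finset.sum_comm]
        exact Finset.sum_congr rfl fun f _ => Finset.sum_congr rfl fun j _ => by ring
      simpa [hd, hN] using h2
    exact h.linearIndepOn_id
  · refine le_antisymm (Submodule.span_le.2 ?_) (Submodule.span_le.2 ?_)
    · rintro _ ⟨j, rfl⟩
      exact hv j
    · rintro _ ⟨α, σ, hα, rfl⟩
      have : α = 0 := by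
        funext i
        exact (Finset.sum_eq_zero_iff.1 hα) i (Finset.mem_univ i)
      subst this
      -- The reproducing formula is the expansion of the alternator, with `d j σ` as coefficients.
      have h : dlamWedge T σ = N'⁻¹ • ∑ j, d j σ • v j := by
        funext x
        refine alternatingMap_ext_centerVec fun g => ?_
        rw [Pi.smul_apply, Finset.sum_apply, AlternatingMap.smul_apply,
          alternatingMap_sum_apply]
        simp only [Pi.smul_apply, AlternatingMap.smul_apply, hm, smul_eq_mul, hr _ _ x,
          inv_mul_cancel_left₀ hN']
      rw [lamPow_zero, one_smul, h]
      exact Submodule.smul_mem _ _ (Submodule.sum_mem _ fun j _ =>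
        Submodule.smul_mem _ _ (Submodule.subset_span ⟨j, rfl⟩))

/-- A criterion for a family of constant forms to be covariant, in terms of their values `m` on
the vectors from the barycenter to the vertices. -/
lemma isCovariant_range_of_eval {k : ℕ} {J : Type*} {v : ∀ T : Affine.Simplex ℝ E n, J → Form T k}
    {m : J → (Fin k → Fin (n + 1)) → ℂ}
    (hm : ∀ T j x f, v T j x (fun i => centerVec T (f i)) = m j f)
    (hπ : ∀ (π : Equiv.Perm (Fin (n + 1))) j, ∃ c : ℂ, c ≠ 0 ∧ ∃ j', ∀ f,
      m j (fun i => π (f i)) = c * m j' f) : IsCovariant fun T => Set.range (v T) := by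
  rintro T T' π _ ⟨j, rfl⟩
  obtain ⟨c, hc, j', h⟩ := hπ π j
  refine ⟨c, hc, _, ⟨j', rfl⟩, ?_⟩
  funext x
  refine alternatingMap_ext_centerVec fun f => ?_
  rw [pull_apply, AlternatingMap.compLinearMap_apply, Pi.smul_apply, AlternatingMap.smul_apply,
    hm, smul_eq_mul, ← h, ← hm T']
  congr 1
  funext i
  exact tanMap_centerVec T T' π (f i)

/-! ### Constant forms of degree zero and of maximal degree -/

/-- Alternating forms of degree zero or of maximal degree are determined by one value. -/
lemma exists_frame {k : ℕ} (hk : k = 0 ∨ k = n) : ∃ e : Fin k → Tangent T,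
    ∀ A A' : (Tangent T) [⋀^Fin k]→ₗ[ℝ] ℂ, A e = A' e → A = A' := by
  rcases hk with rfl | rfl
  · refine ⟨Fin.elim0, fun A A' h => ?_⟩
    ext w
    rwa [Subsingleton.elim w Fin.elim0]
  · refine ⟨edgeBasis T, fun A A' h => Module.Basis.ext_alternating (edgeBasis T) fun σ hσ => ?_⟩
    have key : ∀ A : (Tangent T) [⋀^Fin k]→ₗ[ℝ] ℂ, (A fun i => edgeBasis T (σ i)) =
        Equiv.Perm.sign (Equiv.ofBijective σ (Finite.injective_iff_bijective.1 hσ)) •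
          A (edgeBasis T) :=
      fun A => A.map_perm (edgeBasis T) (Equiv.ofBijective σ _)
    rw [key, key, h]

/-- One evaluation determines a constant form of these degrees, so nonzero constant forms are
proportional and any choice of basis is covariant. -/
lemma isCovariant_of_isBasisOf {k : ℕ} (hk : k = 0 ∨ k = n)
    {Q : ∀ T : Affine.Simplex ℝ E n, Set (Form T k)}
    (hQ : ∀ T, IsBasisOf (Q T) (PForms 0 k T)) : IsCovariant Q := by
  intro T T' π ω hω
  have hω0 : ω ≠ 0 := (hQ T').1.ne_zero hω
  have hp := pull_mem_pForms T T' π ((hQ T').subset hω)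
  have hp0 : pull T T' π k ω ≠ 0 := fun h =>
    hω0 (pull_perm_injective T T' π k (h.trans (map_zero _).symm))
  obtain ⟨ω', hω'⟩ : (Q T).Nonempty := by
    rw [Set.nonempty_iff_ne_empty]
    intro h
    rw [← (hQ T).2, h, Submodule.span_empty, Submodule.mem_bot] at hp
    exact hp0 hp
  have hω'0 : ω' ≠ 0 := (hQ T).1.ne_zero hω'
  obtain ⟨e, he⟩ := exists_frame (T := T) hk
  let x₀ : Body T := ⟨vertexBasis T 0, vertex_mem_body 0⟩
  have key : ∀ {η : Form T k}, η ∈ PForms 0 k T → η ≠ 0 → η x₀ e ≠ 0 := by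
    intro η hη h0 h
    refine h0 (funext fun x => ?_)
    rw [eq_of_mem_pForms_zero hη x x₀]
    exact he _ _ h
  have h1 := key hp hp0
  have h2 := key ((hQ T).subset hω') hω'0
  refine ⟨pull T T' π k ω x₀ e / ω' x₀ e, div_ne_zero h1 h2, ω', hω', funext fun x => ?_⟩
  rw [Pi.smul_apply, eq_of_mem_pForms_zero hp x x₀,
    eq_of_mem_pForms_zero ((hQ T).subset hω') x x₀]
  refine he _ _ ?_
  rw [AlternatingMap.smul_apply, smul_eq_mul, div_mul_cancel₀ _ h2]

lemma dlamWedge_one_centerVec (f g : Fin 1 → Fin (n + 1)) (x : Body T) :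
    (dlamWedge T f x fun i => centerVec T (g i)) =
      (if f 0 = g 0 then 1 else 0) - 1 / (n + 1) := by
  rw [dlamWedge, constWedge, wedge_apply, Matrix.det_fin_one, Matrix.of_apply, dlam_centerVec]
  split_ifs <;> simp

lemma dlamWedge_two_centerVec (f g : Fin 2 → Fin (n + 1)) (x : Body T) :
    (dlamWedge T f x fun i => centerVec T (g i)) =
      ((if f 0 = g 0 then 1 else 0) - 1 / (n + 1)) * ((if f 1 = g 1 then 1 else 0) - 1 / (n + 1)) -
      ((if f 1 = g 0 then 1 else 0) - 1 / (n + 1)) *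
        ((if f 0 = g 1 then 1 else 0) - 1 / (n + 1)) := by
  rw [dlamWedge, constWedge, wedge_apply, Matrix.det_fin_two]
  simp only [Matrix.of_apply, dlam_centerVec]
  push_cast
  simp only [apply_ite Complex.ofReal, Complex.ofReal_one, Complex.ofReal_zero]

lemma oneForm_mem_pForms_zero (c : Fin (n + 1) → ℂ) : oneForm T c ∈ PForms 0 1 T :=
  Submodule.sum_mem _ fun _ _ => Submodule.smul_mem _ _ (dlamWedge_mem_pForms_zero _)

lemma oneForm_centerVec {c : Fin (n + 1) → ℂ} (hc : ∑ i, c i = 0) (f : Fin 1 → Fin (n + 1))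
    (x : Body T) : (oneForm T c x fun i => centerVec T (f i)) = c (f 0) := by
  rw [oneForm, Finset.sum_apply, alternatingMap_sum_apply]
  simp only [Pi.smul_apply, AlternatingMap.smul_apply, dlamWedge_one_centerVec, smul_eq_mul,
    mul_sub, Finset.sum_sub_distrib, ← Finset.sum_mul, hc]
  simp

lemma constWedge_covector_one_centerVec {c : Fin 1 → Fin (n + 1) → ℝ} (hc : ∀ j, ∑ i, c j i = 0)
    (f : Fin 1 → Fin (n + 1)) (x : Body T) :
    (constWedge T (fun j => covector T (c j)) x fun i => centerVec T (f i)) = c 0 (f 0) := by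
  rw [constWedge, wedge_apply, Matrix.det_fin_one, Matrix.of_apply, covector_centerVec T (hc 0)]

lemma constWedge_covector_two_centerVec {c : Fin 2 → Fin (n + 1) → ℝ} (hc : ∀ j, ∑ i, c j i = 0)
    (f : Fin 2 → Fin (n + 1)) (x : Body T) :
    (constWedge T (fun j => covector T (c j)) x fun i => centerVec T (f i)) =
      c 0 (f 0) * c 1 (f 1) - c 1 (f 0) * c 0 (f 1) := by
  rw [constWedge, wedge_apply, Matrix.det_fin_two]
  simp only [Matrix.of_apply, covector_centerVec T (hc _)]
  push_cast
  rfl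

end Constant

lemma sum_fin_one_arrow {α M : Type*} [Fintype α] [AddCommMonoid M] (g : α → M) :
    ∑ f : Fin 1 → α, g (f 0) = ∑ a, g a :=
  (Equiv.funUnique (Fin 1) α).sum_comp g

lemma sum_fin_two_arrow {α M : Type*} [Fintype α] [AddCommMonoid M] (g : α × α → M) :
    ∑ f : Fin 2 → α, g (f 0, f 1) = ∑ p, g p :=
  (finTwoArrowEquiv α).sum_comp g

lemma range_fin_succ {α : Type*} {N : ℕ} (g : Fin (N + 1) → α) :
    Set.range g = {g 0} ∪ Set.range fun j : Fin N => g j.succ := by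
  ext ω
  simp [Fin.exists_fin_succ, eq_comm]

lemma range_fin_three {α : Type*} (g : Fin 3 → α) : Set.range g = {g 0, g 1, g 2} := by
  ext ω
  simp [Fin.exists_fin_succ, eq_comm]

/-! ### Constant one-forms on triangles -/

section Triangle

lemma xi3_isPrimitiveRoot : IsPrimitiveRoot xi3 3 := by
  convert Complex.isPrimitiveRoot_exp 3 (by norm_num) using 1
  rw [xi3]
  congr 1
  push_cast
  ring

lemma xi3_pow_three : xi3 ^ 3 = 1 := xi3_isPrimitiveRoot.pow_eq_one

lemma xi3_sum : 1 + xi3 + xi3 ^ 2 = 0 := by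
  have := xi3_isPrimitiveRoot.geom_sum_eq_zero (by norm_num)
  simpa [Finset.sum_range_succ] using this

lemma xi3_ne_zero : xi3 ≠ 0 := Complex.exp_ne_zero _

/-- The exponents of the coefficients of the two basis forms on a triangle. -/
def cubicExp : Fin 2 → Fin 3 → ℕ := ![![0, 1, 2], ![0, 2, 1]]

lemma constBasis_two_one (B : ∀ (n k : ℕ) (T : Affine.Simplex ℝ E n), Set (Form T k))
    (T : Affine.Simplex ℝ E 2) :
    constBasis B 2 1 T = Set.range fun j => oneForm T fun a => xi3 ^ cubicExp j a := by
  have h0 : (fun a => xi3 ^ cubicExp 0 a) = ![1, xi3, xi3 ^ 2] := by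
    funext a; fin_cases a <;> simp [cubicExp]
  have h1 : (fun a => xi3 ^ cubicExp 1 a) = ![1, xi3 ^ 2, xi3] := by
    funext a; fin_cases a <;> simp [cubicExp]
  change {_, _} = _
  rw [← h0, ← h1]
  ext ω
  simp [Fin.exists_fin_two, eq_comm]

lemma sum_cubicExp (j : Fin 2) : ∑ a, xi3 ^ cubicExp j a = 0 := by
  fin_cases j <;> simp [cubicExp, Fin.sum_univ_three] <;> linear_combination xi3_sum

/-- Every permutation of `ℤ/3` is affine: a shift multiplies a character by a root of unity, and
negation swaps the two characters. -/
lemma cubicExp_perm : ∀ (π : Equiv.Perm (Fin 3)) (j : Fin 2), ∃ (s : Fin 3) (j' : Fin 2), ∀ a,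
    cubicExp j (π a) % 3 = (s + cubicExp j' a) % 3 := by
  decide

lemma isBasisOf_constBasis_two_one
    (B : ∀ (n k : ℕ) (T : Affine.Simplex ℝ E n), Set (Form T k)) (T : Affine.Simplex ℝ E 2) :
    IsBasisOf (constBasis B 2 1 T) (PForms 0 1 T) := by
  rw [constBasis_two_one]
  -- The two coefficient vectors are complex conjugate, so index `1 - j` gives the conjugate dual
  -- family.
  refine isBasisOf_range_of_eval (fun j => oneForm_mem_pForms_zero _)
    (d := fun j f => xi3 ^ cubicExp (1 - j) (f 0))
    (fun j x f => oneForm_centerVec (sum_cubicExp j) f x) (N := 3) (N' := 3)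
    (by norm_num) (fun i j => ?_) (by norm_num) fun f g x => ?_
  · rw [sum_fin_one_arrow fun a => xi3 ^ cubicExp (1 - i) a * xi3 ^ cubicExp j a]
    fin_cases i <;> fin_cases j <;> simp [cubicExp, Fin.sum_univ_three] <;>
      grind [xi3_sum, xi3_pow_three]
  · rw [dlamWedge_one_centerVec]
    generalize f 0 = a
    generalize g 0 = b
    fin_cases a <;> fin_cases b <;> simp [cubicExp, Fin.sum_univ_two] <;>
      grind [xi3_sum, xi3_pow_three]

lemma isCovariant_constBasis_two_one
    (B : ∀ (n k : ℕ) (T : Affine.Simplex ℝ E n), Set (Form T k)) :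
    IsCovariant (E := E) fun T => constBasis B 2 1 T := by
  simp only [constBasis_two_one]
  refine isCovariant_range_of_eval
    (fun T j x f => oneForm_centerVec (sum_cubicExp j) f x) fun π j => ?_
  obtain ⟨s, j', h⟩ := cubicExp_perm π j
  refine ⟨xi3 ^ (s : ℕ), pow_ne_zero _ xi3_ne_zero, j', fun f => ?_⟩
  rw [← pow_add, pow_eq_pow_mod _ xi3_pow_three, h, ← pow_eq_pow_mod _ xi3_pow_three]

end Triangle

/-! ### Constant forms on tetrahedra -/

section Tetrahedron

/-- The coefficients of the three basis one-forms on a tetrahedron. -/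
def signVec : Fin 3 → Fin 4 → ℤ := ![![1, -1, 1, -1], ![1, 1, -1, -1], ![1, -1, -1, 1]]

/-- The pairs of basis one-forms on a tetrahedron. -/
def signPair : Fin 3 → Fin 2 → Fin 3 := ![![0, 1], ![0, 2], ![1, 2]]

/-- The coefficients of the three basis two-forms on a tetrahedron. -/
def signMinor (j : Fin 3) (p : Fin 4 × Fin 4) : ℤ :=
  signVec (signPair j 0) p.1 * signVec (signPair j 1) p.2 -
    signVec (signPair j 1) p.1 * signVec (signPair j 0) p.2

lemma sum_signVec (j : Fin 3) : ∑ a, (signVec j a : ℝ) = 0 := by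
  have : ∀ j, ∑ a, signVec j a = 0 := by decide
  exact_mod_cast this j

lemma sum_signVec_mul : ∀ i j, ∑ a, signVec i a * signVec j a = if i = j then 4 else 0 := by
  decide

lemma signVec_reproducing :
    ∀ a b, ∑ j, signVec j a * signVec j b = 4 * (if a = b then 1 else 0) - 1 := by
  decide

/-- Each sign vector encodes, up to sign, a splitting of the four vertices into two pairs, and
permutations permute the three splittings. -/
lemma signVec_perm : ∀ (π : Equiv.Perm (Fin 4)) (j : Fin 3), ∃ (s : ℤˣ) (j' : Fin 3), ∀ a,
    signVec j (π a) = s * signVec j' a := by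
  decide +kernel

/-- By orthogonality of the sign vectors each Gram minor is `4²`; summing over ordered pairs doubles
it. -/
lemma sum_signMinor_mul :
    ∀ i j, ∑ p, signMinor i p * signMinor j p = if i = j then 32 else 0 := by
  decide +kernel

/-- This is the Cauchy–Binet formula applied to `signVec_reproducing`. -/
lemma signMinor_reproducing : ∀ a b c d, ∑ j, signMinor j (a, b) * signMinor j (c, d) =
    (4 * (if a = c then 1 else 0) - 1) * (4 * (if b = d then 1 else 0) - 1) -
      (4 * (if b = c then 1 else 0) - 1) * (4 * (if a = d then 1 else 0) - 1) := by
  decide +kernel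

lemma signMinor_perm : ∀ (π : Equiv.Perm (Fin 4)) (j : Fin 3), ∃ (s : ℤˣ) (j' : Fin 3), ∀ a b,
    signMinor j (π a, π b) = s * signMinor j' (a, b) := by
  decide +kernel

lemma units_int_cast_ne_zero (s : ℤˣ) : ((s : ℤ) : ℂ) ≠ 0 := by
  exact_mod_cast s.ne_zero

variable (B : ∀ (n k : ℕ) (T : Affine.Simplex ℝ E n), Set (Form T k))

lemma psi_eq (T : Affine.Simplex ℝ E 3) : ![psiW T, psiP T, psiK T] =
    fun j => covector T fun a => (signVec j a : ℝ) := by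
  funext j
  fin_cases j
  · refine congrArg (covector T) (funext fun a => ?_)
    fin_cases a <;> simp [signVec]
  · refine congrArg (covector T) (funext fun a => ?_)
    fin_cases a <;> simp [signVec]
  · refine congrArg (covector T) (funext fun a => ?_)
    fin_cases a <;> simp [signVec]

lemma constBasis_three_one (T : Affine.Simplex ℝ E 3) : constBasis B 3 1 T =
    Set.range fun j => constWedge T fun _ : Fin 1 => covector T fun a => (signVec j a : ℝ) := by
  have h : ∀ j, (fun _ : Fin 1 => covector T fun a => (signVec j a : ℝ)) =
      ![![psiW T, psiP T, psiK T] j] := by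
    intro j
    rw [psi_eq]
    funext i
    fin_cases i
    rfl
  simp only [h]
  rw [range_fin_three]
  rfl

lemma constBasis_three_two (T : Affine.Simplex ℝ E 3) : constBasis B 3 2 T =
    Set.range fun j => constWedge T fun i => covector T fun a => (signVec (signPair j i) a : ℝ) := by
  have h : ∀ j, (fun i => covector T fun a => (signVec (signPair j i) a : ℝ)) =
      ![![psiW T, psiP T], ![psiW T, psiK T], ![psiP T, psiK T]] j := by
    intro j
    have h' : (fun i => covector T fun a => (signVec (signPair j i) a : ℝ)) =
        fun i => ![psiW T, psiP T, psiK T] (signPair j i) := by rw [psi_eq]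
    rw [h']
    funext i
    fin_cases j <;> fin_cases i <;> rfl
  simp only [h]
  rw [range_fin_three]
  rfl

lemma constWedge_signVec_centerVec (T : Affine.Simplex ℝ E 3) (j : Fin 3) (x : Body T)
    (f : Fin 1 → Fin 4) :
    (constWedge T (fun _ : Fin 1 => covector T fun a => (signVec j a : ℝ)) x
      fun i => centerVec T (f i)) = (signVec j (f 0) : ℂ) := by
  rw [constWedge_covector_one_centerVec (c := fun _ a => (signVec j a : ℝ))
    (fun _ => sum_signVec j)]
  push_cast
  rfl

lemma constWedge_signMinor_centerVec (T : Affine.Simplex ℝ E 3) (j : Fin 3) (x : Body T)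
    (f : Fin 2 → Fin 4) :
    (constWedge T (fun i => covector T fun a => (signVec (signPair j i) a : ℝ)) x
      fun i => centerVec T (f i)) = (signMinor j (f 0, f 1) : ℂ) := by
  rw [constWedge_covector_two_centerVec (c := fun i a => (signVec (signPair j i) a : ℝ))
    (fun _ => sum_signVec _), signMinor]
  push_cast
  rfl

lemma isBasisOf_constBasis_three_one (T : Affine.Simplex ℝ E 3) :
    IsBasisOf (constBasis B 3 1 T) (PForms 0 1 T) := by
  rw [constBasis_three_one]
  refine isBasisOf_range_of_eval
    (fun j => constWedge_covector_mem_pForms_zero fun _ a => (signVec j a : ℝ))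
    (d := fun j f => (signVec j (f 0) : ℂ)) (constWedge_signVec_centerVec T) (N := 4) (N' := 4)
    (by norm_num) (fun i j => ?_) (by norm_num) fun f g x => ?_
  · rw [sum_fin_one_arrow fun a => (signVec i a : ℂ) * (signVec j a : ℂ)]
    exact_mod_cast congrArg (Int.cast (R := ℂ)) (sum_signVec_mul i j)
  · have := congrArg (Int.cast (R := ℂ)) (signVec_reproducing (f 0) (g 0))
    push_cast at this
    rw [dlamWedge_one_centerVec, this]
    push_cast
    ring

lemma isCovariant_constBasis_three_one :
    IsCovariant (E := E) fun T => constBasis B 3 1 T := by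
  simp only [constBasis_three_one]
  refine isCovariant_range_of_eval constWedge_signVec_centerVec fun π j => ?_
  obtain ⟨s, j', h⟩ := signVec_perm π j
  exact ⟨_, units_int_cast_ne_zero s, j', fun f => by rw [h]; push_cast; rfl⟩

lemma isBasisOf_constBasis_three_two (T : Affine.Simplex ℝ E 3) :
    IsBasisOf (constBasis B 3 2 T) (PForms 0 2 T) := by
  rw [constBasis_three_two]
  refine isBasisOf_range_of_eval
    (fun j => constWedge_covector_mem_pForms_zero fun i a => (signVec (signPair j i) a : ℝ))
    (d := fun j f => (signMinor j (f 0, f 1) : ℂ)) (constWedge_signMinor_centerVec T)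
    (N := 32) (N' := 16) (by norm_num) (fun i j => ?_) (by norm_num) fun f g x => ?_
  · rw [sum_fin_two_arrow fun p => (signMinor i p : ℂ) * (signMinor j p : ℂ)]
    exact_mod_cast congrArg (Int.cast (R := ℂ)) (sum_signMinor_mul i j)
  · have := congrArg (Int.cast (R := ℂ)) (signMinor_reproducing (f 0) (f 1) (g 0) (g 1))
    push_cast at this
    rw [dlamWedge_two_centerVec, this]
    push_cast
    ring

lemma isCovariant_constBasis_three_two :
    IsCovariant (E := E) fun T => constBasis B 3 2 T := by
  simp only [constBasis_three_two]
  refine isCovariant_range_of_eval constWedge_signMinor_centerVec fun π j => ?_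
  obtain ⟨s, j', h⟩ := signMinor_perm π j
  exact ⟨_, units_int_cast_ne_zero s, j', fun f => by rw [h]; push_cast; rfl⟩

end Tetrahedron

/-! ### Constant two-forms on four-simplices -/

section FourSimplex

/-- The coefficient of `dλ_a ∧ dλ_b` in `ζ₀` as a function of `b - a` modulo five. -/
def chi : Fin 5 → GaussianInt := ![0, 1, ⟨0, 1⟩, ⟨0, -1⟩, -1]

/-- The permutation by which the `j`-th basis form arises from `ζ₀`. -/
def zetaPerm : Fin 6 → Equiv.Perm (Fin 5) :=
  Fin.cons 1 fun j : Fin 5 => finRotate 5 ^ (j : ℕ) * Equiv.swap 0 1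

/-- The inverse of `zetaPerm`. -/
def zetaIdx (j : Fin 6) (a : Fin 5) : Fin 5 :=
  Fin.cases a (fun i : Fin 5 => Equiv.swap 0 1 (a - i)) j

/-- The coefficient of `dλ_a ∧ dλ_b` in the `j`-th basis form. -/
def zetaCoeff (j : Fin 6) (p : Fin 5 × Fin 5) : GaussianInt :=
  chi (zetaIdx j p.2 - zetaIdx j p.1)

lemma zetaPerm_zetaIdx : ∀ (j : Fin 6) (a : Fin 5), zetaPerm j (zetaIdx j a) = a := by
  decide +kernel

/-- The six forms are orthogonal for the Hermitian product; `20` counts the ordered pairs of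
distinct vertices, where the coefficients have modulus one. -/
lemma sum_star_zetaCoeff_mul : ∀ i j : Fin 6,
    ∑ p, star (zetaCoeff i p) * zetaCoeff j p = if i = j then 20 else 0 := by
  decide +kernel

/-- The values of the alternators on the barycentric vectors involve fifths; the factor `5` clears
denominators so that the identity lives in the Gaussian integers. -/
lemma zetaCoeff_reproducing : ∀ a b c d : Fin 5,
    5 * ∑ j, star (zetaCoeff j (a, b)) * zetaCoeff j (c, d) =
      10 * (5 * ((if a = c then 1 else 0) * (if b = d then 1 else 0) -
        (if b = c then 1 else 0) * (if a = d then 1 else 0)) - (if a = c then 1 else 0) -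
          (if b = d then 1 else 0) + (if a = d then 1 else 0) + (if b = c then 1 else 0)) := by
  decide +kernel

/-- An affine map `a ↦ u a + t` modulo 5 multiplies `chi (b - a)` by `chi u`, as `chi` is
multiplicative. The six forms represent the cosets of this group of order 20, so any permutation
moves them among each other with factors `chi s`. -/
lemma zetaCoeff_perm : ∀ (π : Equiv.Perm (Fin 5)) (j : Fin 6), ∃ (s : Fin 5) (j' : Fin 6),
    s ≠ 0 ∧ ∀ a b, zetaCoeff j (π a, π b) = chi s * zetaCoeff j' (a, b) := by
  decide +kernel

lemma chi_ne_zero : ∀ s, s ≠ 0 → chi s ≠ 0 := by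
  decide

/-- The coefficient matrix `chi (b - a)` is antisymmetric with zero row sums, so the corrections by
`1/5` cancel and the value is the coefficient itself. -/
lemma zeta_centerVec (T : Affine.Simplex ℝ E 4) (g : Equiv.Perm (Fin 5)) (x : Body T)
    (f : Fin 2 → Fin 5) {a b : Fin 5} (ha : g a = f 0) (hb : g b = f 1) :
    (zeta T g x fun i => centerVec T (f i)) = GaussianInt.toComplex (chi (b - a)) := by
  simp only [zeta, Pi.add_apply, Pi.sub_apply, Pi.smul_apply, AlternatingMap.add_apply,
    AlternatingMap.sub_apply, AlternatingMap.smul_apply, dlamWedge_two_centerVec, ← ha, ← hb,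
    Matrix.cons_val_zero, Matrix.cons_val_one, g.injective.eq_iff, smul_eq_mul]
  fin_cases a <;> fin_cases b <;> simp [chi, GaussianInt.toComplex_def] <;> ring

variable (B : ∀ (n k : ℕ) (T : Affine.Simplex ℝ E n), Set (Form T k))

lemma constBasis_four_two (T : Affine.Simplex ℝ E 4) :
    constBasis B 4 2 T = Set.range fun j => zeta T (zetaPerm j) := by
  rw [range_fin_succ]
  rfl

lemma zeta_zetaPerm_centerVec (T : Affine.Simplex ℝ E 4) (j : Fin 6) (x : Body T)
    (f : Fin 2 → Fin 5) : (zeta T (zetaPerm j) x fun i => centerVec T (f i)) =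
      GaussianInt.toComplex (zetaCoeff j (f 0, f 1)) :=
  zeta_centerVec T _ x f (zetaPerm_zetaIdx j _) (zetaPerm_zetaIdx j _)

lemma zeta_mem_pForms_zero (T : Affine.Simplex ℝ E 4) (g : Equiv.Perm (Fin 5)) :
    zeta T g ∈ PForms 0 2 T := by
  have h : ∀ f : Fin 2 → Fin 5, dlamWedge T f ∈ PForms 0 2 T := dlamWedge_mem_pForms_zero
  have h' : ∀ f : Fin 2 → Fin 5, Complex.I • dlamWedge T f ∈ PForms 0 2 T := fun f =>
    Submodule.smul_mem _ _ (h f)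
  exact add_mem (add_mem (add_mem (sub_mem (add_mem (add_mem (sub_mem (sub_mem (add_mem
    (h _) (h' _)) (h' _)) (h _)) (h _)) (h' _)) (h' _)) (h _)) (h' _)) (h _)

lemma isBasisOf_constBasis_four_two (T : Affine.Simplex ℝ E 4) :
    IsBasisOf (constBasis B 4 2 T) (PForms 0 2 T) := by
  rw [constBasis_four_two]
  -- The dual family consists of the complex conjugates of the coefficients, by orthogonality.
  refine isBasisOf_range_of_eval (fun j => zeta_mem_pForms_zero T _)
    (d := fun j f => GaussianInt.toComplex (star (zetaCoeff j (f 0, f 1))))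
    (zeta_zetaPerm_centerVec T) (N := 20) (N' := 10) (by norm_num) (fun i j => ?_) (by norm_num)
    fun f g x => ?_
  · rw [sum_fin_two_arrow fun p => GaussianInt.toComplex (star (zetaCoeff i p)) *
      GaussianInt.toComplex (zetaCoeff j p)]
    simp only [← map_mul, ← map_sum, sum_star_zetaCoeff_mul]
    split_ifs
    exacts [map_ofNat _ 20, map_zero _]
  · have := congrArg GaussianInt.toComplex (zetaCoeff_reproducing (f 0) (f 1) (g 0) (g 1))
    simp only [map_mul, map_sum, map_add, map_sub, apply_ite GaussianInt.toComplex, map_one,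
      map_zero, map_ofNat] at this
    rw [dlamWedge_two_centerVec]
    push_cast
    linear_combination (1 / 5) * this

lemma isCovariant_constBasis_four_two :
    IsCovariant (E := E) fun T => constBasis B 4 2 T := by
  simp only [constBasis_four_two]
  refine isCovariant_range_of_eval zeta_zetaPerm_centerVec fun π j => ?_
  obtain ⟨s, j', hs, h⟩ := zetaCoeff_perm π j
  refine ⟨GaussianInt.toComplex (chi s), ?_, j', fun f => by rw [h, map_mul]⟩
  rw [Ne, GaussianInt.toComplex_eq_zero]
  exact chi_ne_zero s hs

end FourSimplex

/-! ### The start of the recursion -/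

section Start

variable (B : ∀ (n k : ℕ) (T : Affine.Simplex ℝ E n), Set (Form T k))

lemma constBasis_of_not {n k : ℕ} (T : Affine.Simplex ℝ E n)
    (h : ¬ ((n = 2 ∧ k = 1) ∨ (n = 3 ∧ k = 1) ∨ (n = 3 ∧ k = 2) ∨ (n = 4 ∧ k = 2))) :
    constBasis B n k T = B n k T := by
  unfold constBasis
  split <;> simp_all

variable {B}

lemma isBasisOf_constBasis
    (hB : ∀ (n k : ℕ) (T : Affine.Simplex ℝ E n), IsBasisOf (B n k T) (PForms 0 k T))
    (n k : ℕ) (T : Affine.Simplex ℝ E n) : IsBasisOf (constBasis B n k T) (PForms 0 k T) := by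
  by_cases h : (n = 2 ∧ k = 1) ∨ (n = 3 ∧ k = 1) ∨ (n = 3 ∧ k = 2) ∨ (n = 4 ∧ k = 2)
  · rcases h with ⟨rfl, rfl⟩ | ⟨rfl, rfl⟩ | ⟨rfl, rfl⟩ | ⟨rfl, rfl⟩
    exacts [isBasisOf_constBasis_two_one B T, isBasisOf_constBasis_three_one B T,
      isBasisOf_constBasis_three_two B T, isBasisOf_constBasis_four_two B T]
  · rw [constBasis_of_not B T h]
    exact hB n k T

lemma isCovariant_constBasis
    (hB : ∀ (n k : ℕ) (T : Affine.Simplex ℝ E n), IsBasisOf (B n k T) (PForms 0 k T))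
    (n k : ℕ) (h : Linked n k) : IsCovariant (E := E) fun T => constBasis B n k T := by
  have h' : (k = 0 ∨ k = n) ∨
      ((n = 2 ∧ k = 1) ∨ (n = 3 ∧ k = 1) ∨ (n = 3 ∧ k = 2) ∨ (n = 4 ∧ k = 2)) := by
    unfold Linked at h
    tauto
  rcases h' with h | ⟨rfl, rfl⟩ | ⟨rfl, rfl⟩ | ⟨rfl, rfl⟩ | ⟨rfl, rfl⟩
  exacts [isCovariant_of_isBasisOf h (isBasisOf_constBasis hB n k),
    isCovariant_constBasis_two_one B, isCovariant_constBasis_three_one B,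
    isCovariant_constBasis_three_two B, isCovariant_constBasis_four_two B]

end Start

end FEEC

end

theorem mainTheorem3 {E : Type*} [AddCommGroup E] [Module ℝ E]
    (B : ∀ (n k : ℕ) (T : Affine.Simplex ℝ E n), Set (FEEC.Form T k))
    (hB : ∀ (n k : ℕ) (T : Affine.Simplex ℝ E n),
      FEEC.IsBasisOf (B n k T) (FEEC.PForms 0 k T))
    (T : Affine.Simplex ℝ E 4) (r : ℕ) :
    (FEEC.IsBasisOf (FEEC.basisP B r 4 2 T) (FEEC.PForms r 2 T) ∧
      FEEC.IsCInvariant (FEEC.basisP B r 4 2 T)) ∧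
    (FEEC.IsBasisOf (FEEC.basisPMinus B r 4 2 T) (FEEC.PMinusForms r 2 T) ∧
      FEEC.IsCInvariant (FEEC.basisPMinus B r 4 2 T)) := by
  have hb := FEEC.isBasisOf_basisP_and_basisPMinus B (FEEC.isBasisOf_constBasis hB) r 4 2 T
  have hc := FEEC.isCovariant_basisP_and_basisPMinus B (FEEC.isCovariant_constBasis hB) r 4 2
    (by simp [FEEC.Linked])
  exact ⟨⟨hb.1, hc.1.isCInvariant (FEEC.finite_of_isBasisOf_pForms hb.1) hb.1.1⟩,
    ⟨hb.2, hc.2.isCInvariant (FEEC.finite_of_isBasisOf_pMinusForms hb.2) hb.2.1⟩⟩
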